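/- Let $d\ge 1$, let $F,\tilde F,\hat D,H:\mathbb R\to\mathbb R$, let $\lambda,\tau,\tilde\tau\in\mathbb R$ and $\eta_{\rm T},\eta_{\rm G}\ge 0$ be constants, and let $\mathcal P_c,\mathcal P_{\tilde c}$ be probability laws on $\mathbb R^d$; none of these depends on $n$. For every $n\ge d$ consider the following random variables: an initial state $X_0=[U,V_0,w_0]$ with $U,V_0\in\mathbb R^{n\times d}$, $w_0\in\mathbb R^n$ and $U^\top U=I_d$ almost surely ($U$ may be deterministic), and, for $k=0,1,2,\dots$, vectors $c_k,\tilde c_k\in\mathbb R^d$ and $a_k,\tilde a_k\in\mathbb R^n$. Put $\mathcal G(c,a;V,\eta)=Vc+\sqrt{\eta}\,a$ and $$\mathcal L(y,\tilde y;w,V)=F(\hat D(y^\top w))-\tilde F(\hat D(\tilde y^\top w))-\tfrac{\lambda}{2}H(w^\top w)+\tfrac{\lambda}{2}\operatorname{tr}H(V^\top V),$$ where $H$ acts entrywise on matrices. The online stochastic gradient descent/ascent training of the single-layer GAN is $$w_{k+1}=w_k+\tfrac{\tau}{n}\nabla_{w}\mathcal L(y_k,\tilde y_{2k};w,V_k)\big|_{w=w_k},\qquad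 V_{k+1}=V_k-\tfrac{\tilde\tau}{n}\nabla_{V}\mathcal L\big(y_k,\mathcal G(\tilde c_{2k+1},\tilde a_{2k+1};V,\eta_{\rm G});w_k,V\big)\big|_{V=V_k},$$ with $y_k=\mathcal G(c_k,a_k;U,\eta_{\rm T})$ and $\tilde y_{2k}=\mathcal G(\tilde c_{2k},\tilde a_{2k};V_k,\eta_{\rm G})$. Let $X_k=[U,V_k,w_k]$ and $M_k=X_k^\top X_k\in\mathbb R^{(2d+1)\times(2d+1)}$ (the macroscopic state), and let $\|\cdot\|$ be the Frobenius norm. Assume: (A.1) the $c_k$ are i.i.d. with law $\mathcal P_c$, the $\tilde c_k$ are i.i.d. with law $\mathcal P_{\tilde c}$, and both laws have finite moments of all orders; (A.2) the $a_k$ and $\tilde a_k$ are standard Gaussian vectors in $\mathbb R^n$; moreover the initial state and all the vectors $c_k,\tilde c_k,a_k,\tilde a_k$ $(k\ge 0)$ are mutually independent; (A.3) $F\circ\hat D$ and $\tilde F\circ\hat D$ are four times differentiable with bounded derivatives of orders $1,\dots,4$; $H$ is differentiable, and $H'$ is bounded and locally Lipschitz; (A.4) there is a constant $C$ independent of $n$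 with $\mathbb E\sum_{\ell=1}^d\big([U]_{i,\ell}^4+[V_0]_{i,\ell}^4+[w_0]_i^4\big)\le C/n^2$ for all $n\ge d$ and $i=1,\dots,n$; (A.5) there are a deterministic matrix $M_0^\ast$ and a constant $C$, both independent of $n$, with $\mathbb E\|M_0-M_0^\ast\|\le C/\sqrt n$ for all $n\ge d$. Fix $T>0$. Then the ODE $$\begin{aligned} \dot P_t&=\tilde\tau\,(q_t\tilde g_t^\top+P_tL_t),\\ \dot q_t&=\tau\,(g_t-P_t\tilde g_t+h_tq_t),\\ \dot r_t&=\tau\,(P_t^\top g_t-S_t\tilde g_t+h_tr_t)+\tilde\tau\,(z_t\tilde g_t+L_tr_t),\\ \dot S_t&=\tilde\tau\,(r_t\tilde g_t^\top+\tilde g_tr_t^\top+S_tL_t+L_tS_t),\\ \dot z_t&=2\tau\,(q_t^\top g_t-r_t^\top\tilde g_t+z_th_t)+\tau^2b_t \end{aligned}$$ on $[0,T]$ for $P_t,S_t\in\mathbb R^{d\times d}$, $q_t,r_t\in\mathbb R^d$, $z_t\ge 0$, has exactly one solution for which $$M(t)=\begin{bmatrix}I&P_t&q_t\\P_t^\top&S_t&r_t\\q_t^\top&r_t^\top&z_t\end{bmatrix}$$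 satisfies $M(0)=M_0^\ast$, and there is a constant $C(T)$, independent of $n$, such that for all $n\ge d$ $$\max_{0\le k\le nT}\mathbb E\,\big\|M_k-M(k/n)\big\|\le\frac{C(T)}{\sqrt n}.$$ Here $f=(F\circ\hat D)'$, $\tilde f=(\tilde F\circ\hat D)'$, and, with $c\sim\mathcal P_c$, $\tilde c\sim\mathcal P_{\tilde c}$ and $e\sim\mathcal N(0,1)$ independent of $c$ and of $\tilde c$, $$\begin{aligned} g_t&=\mathbb E\,c\,f(c^\top q_t+e\sqrt{z_t\eta_{\rm T}}),\qquad \tilde g_t=\mathbb E\,\tilde c\,\tilde f(\tilde c^\top r_t+e\sqrt{z_t\eta_{\rm G}}),\qquad L_t=-\lambda\operatorname{diag}(H'(S_t)),\\ h_t&=\eta_{\rm T}\,\mathbb E f'(c^\top q_t+e\sqrt{z_t\eta_{\rm T}})-\eta_{\rm G}\,\mathbb E\tilde f'(\tilde c^\top r_t+e\sqrt{z_t\eta_{\rm G}})-\lambda H'(z_t),\\ b_t&=\eta_{\rm T}\,\mathbb E f^2(c^\top q_t+e\sqrt{z_t\eta_{\rm T}})+\eta_{\rm G}\,\mathbb E\tilde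 f^2(\tilde c^\top r_t+e\sqrt{z_t\eta_{\rm G}}), \end{aligned}$$ where $\operatorname{diag}(H'(S))$ is the diagonal matrix with entries $H'(S_{\ell\ell})$. -/

import Mathlib

open MeasureTheory ProbabilityTheory Matrix
open scoped Matrix.Norms.Frobenius

noncomputable section

/-- The `n`-independent data of the model: the functions `F`, `Ft` (the paper's `F`, `F̃`), the
discriminator function `D`, the regularizer `H`, the regularization constant `lam`, the learning
rates `tau` (discriminator) and `taut` (generator), the noise strengths `etaT` (true data) and
`etaG` (generator), and the laws `Pc`, `Pct` of the latent vectors of the real and fake samples. -/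
structure GANModel (d : ℕ) where
  F : ℝ → ℝ
  Ft : ℝ → ℝ
  D : ℝ → ℝ
  H : ℝ → ℝ
  lam : ℝ
  tau : ℝ
  taut : ℝ
  etaT : ℝ
  etaG : ℝ
  Pc : Measure (Fin d → ℝ)
  Pct : Measure (Fin d → ℝ)

/-- The random inputs of a training run in dimension `n`: the feature matrix `U`, the initial
parameters `V0`, `w0`, the latent vectors `c k`, `ct k` and the background noises `a k`, `atil k`
of the real and of the fake samples. -/
structure TrainingData (n d : ℕ) (Ω : Type*) where
  U : Ω → Matrix (Fin n) (Fin d) ℝ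
  V0 : Ω → Matrix (Fin n) (Fin d) ℝ
  w0 : Ω → Fin n → ℝ
  c : ℕ → Ω → Fin d → ℝ
  ct : ℕ → Ω → Fin d → ℝ
  a : ℕ → Ω → Fin n → ℝ
  atil : ℕ → Ω → Fin n → ℝ

/-- The linear generator `𝒢(c, a; V, η) = V c + √η a`. -/
def generate {n d : ℕ} (c : Fin d → ℝ) (a : Fin n → ℝ) (V : Matrix (Fin n) (Fin d) ℝ) (η : ℝ) :
    Fin n → ℝ :=
  V *ᵥ c + √η • a

/-- The gradient of a function of a vector: the vector of its partial derivatives. -/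
def vecGrad {n : ℕ} (φ : (Fin n → ℝ) → ℝ) (w : Fin n → ℝ) : Fin n → ℝ :=
  fun i => lineDeriv ℝ φ w (Pi.single i 1)

/-- The gradient of a function of a matrix: the matrix of its partial derivatives. -/
def matGrad {n d : ℕ} (φ : Matrix (Fin n) (Fin d) ℝ → ℝ) (V : Matrix (Fin n) (Fin d) ℝ) :
    Matrix (Fin n) (Fin d) ℝ :=
  Matrix.of fun i l => lineDeriv ℝ φ V (Matrix.single i l 1)

namespace GANModel

variable {d : ℕ} (G : GANModel d)

/-- `f = (F ∘ D)'`. -/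
def f : ℝ → ℝ := deriv (G.F ∘ G.D)

/-- `f̃ = (F̃ ∘ D)'`. -/
def ft : ℝ → ℝ := deriv (G.Ft ∘ G.D)

/-- The loss
`F(D(yᵀw)) - F̃(D(ỹᵀw)) - (λ/2) H(wᵀw) + (λ/2) tr H(VᵀV)`, with `H` applied entrywise. -/
def loss {n : ℕ} (y yt w : Fin n → ℝ) (V : Matrix (Fin n) (Fin d) ℝ) : ℝ :=
  G.F (G.D (y ⬝ᵥ w)) - G.Ft (G.D (yt ⬝ᵥ w)) - G.lam / 2 * G.H (w ⬝ᵥ w)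
    + G.lam / 2 * ((Vᵀ * V).map G.H).trace

/-- The trainable parameters `(V_k, w_k)` produced by online stochastic gradient descent/ascent:
step `k` uses the real sample `y_k` and the two fake samples with indices `2k` and `2k+1`. -/
def params {n : ℕ} {Ω : Type*} (X : TrainingData n d Ω) (ω : Ω) :
    ℕ → Matrix (Fin n) (Fin d) ℝ × (Fin n → ℝ)
  | 0 => (X.V0 ω, X.w0 ω)
  | k + 1 =>
    let V := (params X ω k).1
    let w := (params X ω k).2
    let y := generate (X.c k ω) (X.a k ω) (X.U ω) G.etaT
    let yt := generate (X.ct (2 * k) ω) (X.atil (2 * k) ω) V G.etaG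
    (V - (G.taut / n) • matGrad (fun V' =>
        G.loss y (generate (X.ct (2 * k + 1) ω) (X.atil (2 * k + 1) ω) V' G.etaG) w V') V,
      w + (G.tau / n) • vecGrad (fun w' => G.loss y yt w' V) w)

/-- The microscopic state `X_k = [U, V_k, w_k]`. -/
def micro {n : ℕ} {Ω : Type*} (X : TrainingData n d Ω) (k : ℕ) (ω : Ω) :
    Matrix (Fin n) (Fin d ⊕ Fin d ⊕ Unit) ℝ :=
  fromCols (X.U ω) (fromCols (G.params X ω k).1 (replicateCol Unit (G.params X ω k).2))

/-- The macroscopic state `M_k = X_kᵀ X_k`. -/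
def macroState {n : ℕ} {Ω : Type*} (X : TrainingData n d Ω) (k : ℕ) (ω : Ω) :
    Matrix (Fin d ⊕ Fin d ⊕ Unit) (Fin d ⊕ Fin d ⊕ Unit) ℝ :=
  (G.micro X k ω)ᵀ * G.micro X k ω

end GANModel

/-- The tuple `(P, q, r, S, z)`. -/
structure MacroState (d : ℕ) where
  P : Matrix (Fin d) (Fin d) ℝ
  q : Fin d → ℝ
  r : Fin d → ℝ
  S : Matrix (Fin d) (Fin d) ℝ
  z : ℝ

/-- The block matrix `[[I, P, q], [Pᵀ, S, r], [qᵀ, rᵀ, z]]`. -/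
def MacroState.toMatrix {d : ℕ} (m : MacroState d) :
    Matrix (Fin d ⊕ Fin d ⊕ Unit) (Fin d ⊕ Fin d ⊕ Unit) ℝ :=
  fromBlocks 1 (fromCols m.P (replicateCol Unit m.q))
    (fromRows m.Pᵀ (replicateRow Unit m.q))
    (fromBlocks m.S (replicateCol Unit m.r) (replicateRow Unit m.r) (Matrix.of fun _ _ => m.z))

/-- The average `⟨φ(c, cᵀv + e√s)⟩` over independent `c ∼ μ` and `e ∼ N(0,1)`. -/
def bracket {d : ℕ} (μ : Measure (Fin d → ℝ)) (v : Fin d → ℝ) (s : ℝ)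
    (φ : (Fin d → ℝ) → ℝ → ℝ) : ℝ :=
  ∫ p : (Fin d → ℝ) × ℝ, φ p.1 (p.1 ⬝ᵥ v + p.2 * √s) ∂(μ.prod (gaussianReal 0 1))

namespace GANModel

variable {d : ℕ} (G : GANModel d)

/-- `g = ⟨c f(cᵀq + e√(z η_T))⟩`. -/
def g (m : MacroState d) : Fin d → ℝ :=
  fun l => bracket G.Pc m.q (m.z * G.etaT) fun c x => c l * G.f x

/-- `g̃ = ⟨c̃ f̃(c̃ᵀr + e√(z η_G))⟩`. -/
def gt (m : MacroState d) : Fin d → ℝ :=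
  fun l => bracket G.Pct m.r (m.z * G.etaG) fun c x => c l * G.ft x

/-- `L = -λ diag(H'(S))`. -/
def L (m : MacroState d) : Matrix (Fin d) (Fin d) ℝ :=
  -(G.lam • diagonal fun l => deriv G.H (m.S l l))

/-- `h = η_T ⟨f'(cᵀq + e√(z η_T))⟩ - η_G ⟨f̃'(c̃ᵀr + e√(z η_G))⟩ - λ H'(z)`. -/
def h (m : MacroState d) : ℝ :=
  G.etaT * bracket G.Pc m.q (m.z * G.etaT) (fun _ x => deriv G.f x)
    - G.etaG * bracket G.Pct m.r (m.z * G.etaG) (fun _ x => deriv G.ft x)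
    - G.lam * deriv G.H m.z

/-- `b = η_T ⟨f²(cᵀq + e√(z η_T))⟩ + η_G ⟨f̃²(c̃ᵀr + e√(z η_G))⟩`. -/
def b (m : MacroState d) : ℝ :=
  G.etaT * bracket G.Pc m.q (m.z * G.etaT) (fun _ x => G.f x ^ 2)
    + G.etaG * bracket G.Pct m.r (m.z * G.etaG) (fun _ x => G.ft x ^ 2)

/-- The right-hand side of the limiting ODE. -/
def drift (m : MacroState d) : MacroState d where
  P := G.taut • (vecMulVec m.q (G.gt m) + m.P * G.L m)
  q := G.tau • (G.g m - m.P *ᵥ G.gt m + G.h m • m.q)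
  r := G.tau • (m.Pᵀ *ᵥ G.g m - m.S *ᵥ G.gt m + G.h m • m.r)
    + G.taut • (m.z • G.gt m + G.L m *ᵥ m.r)
  S := G.taut • (vecMulVec m.r (G.gt m) + vecMulVec (G.gt m) m.r + m.S * G.L m + G.L m * m.S)
  z := 2 * G.tau * (m.q ⬝ᵥ G.g m - m.r ⬝ᵥ G.gt m + m.z * G.h m) + G.tau ^ 2 * G.b m

/-- `m` solves the limiting ODE on `[0, T]` (one-sided derivatives at the end points); since the
right-hand side contains `√z`, a solution takes its values in `z ≥ 0`. -/
structure IsODESolution (T : ℝ) (m : ℝ → MacroState d) : Prop where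
  z_nonneg : ∀ t ∈ Set.Icc 0 T, 0 ≤ (m t).z
  deriv_P : ∀ t ∈ Set.Icc 0 T, ∀ i j,
    HasDerivWithinAt (fun s => (m s).P i j) ((G.drift (m t)).P i j) (Set.Icc 0 T) t
  deriv_q : ∀ t ∈ Set.Icc 0 T, ∀ i,
    HasDerivWithinAt (fun s => (m s).q i) ((G.drift (m t)).q i) (Set.Icc 0 T) t
  deriv_r : ∀ t ∈ Set.Icc 0 T, ∀ i,
    HasDerivWithinAt (fun s => (m s).r i) ((G.drift (m t)).r i) (Set.Icc 0 T) t
  deriv_S : ∀ t ∈ Set.Icc 0 T, ∀ i j,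
    HasDerivWithinAt (fun s => (m s).S i j) ((G.drift (m t)).S i j) (Set.Icc 0 T) t
  deriv_z : ∀ t ∈ Set.Icc 0 T,
    HasDerivWithinAt (fun s => (m s).z) ((G.drift (m t)).z) (Set.Icc 0 T) t

end GANModel

/-- `φ` is `N` times differentiable, with uniformly bounded derivatives of orders `1, …, N`. -/
def BoundedDerivs (N : ℕ) (φ : ℝ → ℝ) : Prop :=
  (∀ j < N, Differentiable ℝ (iteratedDeriv j φ)) ∧
    ∀ j ∈ Finset.Icc 1 N, ∃ B : ℝ, ∀ x, |iteratedDeriv j φ x| ≤ B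

/-- The law `μ` has finite absolute moments of all orders. -/
def HasAllMoments {d : ℕ} (μ : Measure (Fin d → ℝ)) : Prop :=
  ∀ p : ℕ, Integrable (fun x => ‖x‖ ^ p) μ

/-- The labels of the independent sources of randomness of a training run. -/
inductive Source
  | init
  | latent (k : ℕ)
  | fakeLatent (k : ℕ)
  | noise (k : ℕ)
  | fakeNoise (k : ℕ)

namespace TrainingData

variable {n d : ℕ} {Ω : Type*}

/-- The σ-algebra generated by one source of randomness. -/
@[reducible]
def sigma (X : TrainingData n d Ω) : Source → MeasurableSpace Ω
  | .init => MeasurableSpace.comap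
      (fun ω => ((fun i l => X.U ω i l, fun i l => X.V0 ω i l, X.w0 ω) :
        (Fin n → Fin d → ℝ) × (Fin n → Fin d → ℝ) × (Fin n → ℝ))) inferInstance
  | .latent k => MeasurableSpace.comap (X.c k) inferInstance
  | .fakeLatent k => MeasurableSpace.comap (X.ct k) inferInstance
  | .noise k => MeasurableSpace.comap (X.a k) inferInstance
  | .fakeNoise k => MeasurableSpace.comap (X.atil k) inferInstance

/-- The probabilistic setting: `UᵀU = I`; the latent vectors have laws `Pc`, `Pct`; the noises are
standard Gaussian vectors; the initial state, all latent vectors and all noises are mutually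
independent. -/
structure IsValid [MeasurableSpace Ω] (X : TrainingData n d Ω) (G : GANModel d)
    (Pr : Measure Ω) : Prop where
  measurable_U : ∀ i l, Measurable fun ω => X.U ω i l
  measurable_V0 : ∀ i l, Measurable fun ω => X.V0 ω i l
  measurable_w0 : Measurable X.w0
  measurable_c : ∀ k, Measurable (X.c k)
  measurable_ct : ∀ k, Measurable (X.ct k)
  measurable_a : ∀ k, Measurable (X.a k)
  measurable_at : ∀ k, Measurable (X.atil k)
  orthonormal : ∀ᵐ ω ∂Pr, (X.U ω)ᵀ * X.U ω = 1
  law_c : ∀ k, Measure.map (X.c k) Pr = G.Pc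
  law_ct : ∀ k, Measure.map (X.ct k) Pr = G.Pct
  law_a : ∀ k, Measure.map (X.a k) Pr = Measure.pi fun _ => gaussianReal 0 1
  law_at : ∀ k, Measure.map (X.atil k) Pr = Measure.pi fun _ => gaussianReal 0 1
  indep : iIndep X.sigma Pr

/-- The sum of the fourth powers of the entries of the `i`-th row of the initial state. -/
def fourthPowers (X : TrainingData n d Ω) (i : Fin n) (ω : Ω) : ℝ :=
  ∑ l : Fin d, (X.U ω i l ^ 4 + X.V0 ω i l ^ 4 + X.w0 ω i ^ 4)

end TrainingData

/-- `𝔼 Y ≤ B`, for an integrable random variable `Y`. -/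
def MeanLE {Ω : Type*} [MeasurableSpace Ω] (Pr : Measure Ω) (Y : Ω → ℝ) (B : ℝ) : Prop :=
  Integrable Y Pr ∧ ∫ ω, Y ω ∂Pr ≤ B

end

/-! ### Ordinary differential equations with semi-Lipschitz right-hand sides. -/

section ODE

/-! Samples are combinations of columns of `U` or `V` plus background noise. Hence one training step
moves `X = [U, V, w]` to `X + D / n`, where `D = X B` plus a noise vector `τ α` in the column of
`w`, with a random `B` of fixed size (`GANModel.micro_succ`). The Gram matrix `M = Xᵀ X` changes by
`(Xᵀ D + Dᵀ X) / n + Dᵀ D / n²`. Now average over the inputs of the step, which are independent of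
`X`. A Gaussian vector projected on `w` is Gaussian with variance `|w|²`, so the latent terms become
brackets depending on `M` alone. The projections of `α` on the columns of `X` are correlated with
the argument of `f`, and Stein's identity turns them into the terms with `f'` in `h`. In `Dᵀ D` only
`τ² |α|²`, of mean about `τ² n b`, survives the division by `n²`. So the mean increment of `M` is
the drift divided by `n` up to `O(n^(-3/2))`, and its second moment is `O(n⁻²)`, with factors
polynomial in the trace of `M` (`exists_overlapStep_mean_bound`, `exists_overlapStep_sq_bound`).

The error `e = M_k - M(k/n)` is controlled in mean, as it is at time zero, through `Ψ(e) = √(|e|² +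
1/n)`. The second-order remainder of `Ψ` under an increment `δ` is at most `|δ|² / (2 Ψ) ≤ √n |δ|² /
2`, of mean `O(n^(-3/2))`. Thus one step multiplies the mean of `Ψ` by at most `1 + K/n` and adds
`O(n^(-3/2))` (`exists_smoothNorm_step_bound`); a discrete Grönwall inequality over `nT` steps
leaves `O(n^(-1/2))`. A second Grönwall argument, started from the fourth moments of the initial
entries, controls the trace.

The drift is built from products of entries of `M` with bounded functions of `M`, which need not be
globally Lipschitz. It is Lipschitz between two points of which only one is bounded
(`semiLip_macroDrift`), and the bounded point is the value of the ODE solution, so the random state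
needs no truncation. The square root of `z` in the brackets is harmless: its first-order
contribution averages to zero, and brackets are Lipschitz in `z` down to `z = 0`
(`bracket_lipschitz`).

The equation is solved among all matrices first. Symmetry, the identity block and `z ≥ 0` then come
from the convergence itself: the solution is a limit of true Gram matrices, and these properties are
closed (`isGood_of_approx`). Uniqueness for the block system reduces to the matrix equation once `S`
is known to stay symmetric. -/

/-- `Φ` is Lipschitz between points of which only one has to stay in a bounded set. -/
def SemiLip {E E' : Type*} [NormedAddCommGroup E] [NormedAddCommGroup E'] (Φ : E → E') : Prop :=
  ∀ R : ℝ, ∃ K : ℝ, 0 ≤ K ∧ ∀ x y, ‖x‖ ≤ R → ‖Φ y - Φ x‖ ≤ K * ‖y - x‖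

variable {E : Type*} [NormedAddCommGroup E] [NormedSpace ℝ E]

/-- Truncation makes the field bounded and globally Lipschitz, so that Picard–Lindelöf reaches the
end of the interval at once. If one of two points lies in the ball of radius `|R| + 1`, the
semi-Lipschitz bound applies from there; if neither does, the cutoff kills both values. -/
theorem cutoff_lipschitz {Φ : E → E} (hΦ : SemiLip Φ) (R : ℝ) :
    ∃ K L : NNReal, LipschitzWith K (fun y => max 0 (min 1 (R + 1 - ‖y‖)) • Φ y) ∧
      ∀ y, ‖max 0 (min 1 (R + 1 - ‖y‖)) • Φ y‖ ≤ L := by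
  obtain ⟨K, hK, h⟩ := hΦ (|R| + 1)
  obtain ⟨K0, hK0, h0⟩ := hΦ 0
  set χ : E → ℝ := fun y => max 0 (min 1 (R + 1 - ‖y‖)) with hχ
  have χ0 : ∀ y, 0 ≤ χ y := fun y => le_max_left _ _
  have χ1 : ∀ y, χ y ≤ 1 := fun y => max_le zero_le_one (min_le_left _ _)
  have χL : ∀ x y, |χ y - χ x| ≤ ‖y - x‖ := by
    intro x y
    have h1 : |‖y‖ - ‖x‖| ≤ ‖y - x‖ := abs_norm_sub_norm_le y x
    simp only [hχ]
    rw [abs_le] at h1 ⊢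
    constructor
    · rcases max_cases (0:ℝ) (min 1 (R + 1 - ‖y‖)) with ⟨a, b⟩ | ⟨a, b⟩ <;>
      rcases max_cases (0:ℝ) (min 1 (R + 1 - ‖x‖)) with ⟨a', b'⟩ | ⟨a', b'⟩ <;>
      rcases min_cases (1:ℝ) (R + 1 - ‖y‖) with ⟨c, e⟩ | ⟨c, e⟩ <;>
      rcases min_cases (1:ℝ) (R + 1 - ‖x‖) with ⟨c', e'⟩ | ⟨c', e'⟩ <;> linarith
    · rcases max_cases (0:ℝ) (min 1 (R + 1 - ‖y‖)) with ⟨a, b⟩ | ⟨a, b⟩ <;>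
      rcases max_cases (0:ℝ) (min 1 (R + 1 - ‖x‖)) with ⟨a', b'⟩ | ⟨a', b'⟩ <;>
      rcases min_cases (1:ℝ) (R + 1 - ‖y‖) with ⟨c, e⟩ | ⟨c, e⟩ <;>
      rcases min_cases (1:ℝ) (R + 1 - ‖x‖) with ⟨c', e'⟩ | ⟨c', e'⟩ <;> linarith
  have χz : ∀ y, |R| + 1 < ‖y‖ → χ y = 0 := by
    intro y hy
    have : R ≤ |R| := le_abs_self R
    exact max_eq_left ((min_le_right _ _).trans (by linarith))
  have hb : ∀ x, ‖x‖ ≤ |R| + 1 → ‖Φ x‖ ≤ ‖Φ 0‖ + K0 * (|R| + 1) := by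
    intro x hx
    have h1 := h0 0 x (by simp)
    rw [sub_zero] at h1
    have h2 := norm_sub_norm_le (Φ x) (Φ 0)
    nlinarith [mul_le_mul_of_nonneg_left hx hK0]
  have hL0 : 0 ≤ ‖Φ 0‖ + K0 * (|R| + 1) := by positivity
  have key : ∀ x y, ‖x‖ ≤ |R| + 1 →
      ‖χ y • Φ y - χ x • Φ x‖ ≤ (K + (‖Φ 0‖ + K0 * (|R| + 1))) * ‖y - x‖ := by
    intro x y hx
    -- The value `Φ y` at the possibly unbounded point occurs only in a difference with `Φ x`.
    have e : χ y • Φ y - χ x • Φ x = χ y • (Φ y - Φ x) + (χ y - χ x) • Φ x := by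
      rw [smul_sub, sub_smul]; abel
    rw [e]
    refine (norm_add_le _ _).trans ?_
    rw [norm_smul, norm_smul, Real.norm_eq_abs, Real.norm_eq_abs, abs_of_nonneg (χ0 y), add_mul]
    refine add_le_add ?_ ?_
    · calc χ y * ‖Φ y - Φ x‖ ≤ 1 * ‖Φ y - Φ x‖ :=
            mul_le_mul_of_nonneg_right (χ1 y) (norm_nonneg _)
        _ ≤ K * ‖y - x‖ := by rw [one_mul]; exact h x y hx
    · rw [mul_comm]
      exact mul_le_mul (hb x hx) (χL x y) (abs_nonneg _) hL0
  refine ⟨⟨_, add_nonneg hK hL0⟩, ⟨_, hL0⟩, LipschitzWith.of_dist_le_mul fun y x => ?_, fun y => ?_⟩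
  · rw [dist_eq_norm, dist_eq_norm]
    change ‖χ y • Φ y - χ x • Φ x‖ ≤ (K + (‖Φ 0‖ + K0 * (|R| + 1))) * ‖y - x‖
    by_cases hx : ‖x‖ ≤ |R| + 1
    · exact key x y hx
    by_cases hy : ‖y‖ ≤ |R| + 1
    · rw [norm_sub_rev, norm_sub_rev y x]; exact key y x hy
    · rw [χz x (not_le.1 hx), χz y (not_le.1 hy)]
      simp only [zero_smul, sub_self, norm_zero]
      positivity
  · change ‖χ y • Φ y‖ ≤ ‖Φ 0‖ + K0 * (|R| + 1)
    by_cases hy : ‖y‖ ≤ |R| + 1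
    · rw [norm_smul, Real.norm_eq_abs, abs_of_nonneg (χ0 y)]
      exact (mul_le_mul_of_nonneg_right (χ1 y) (norm_nonneg _)).trans (by rw [one_mul]; exact hb y hy)
    · rw [χz y (not_le.1 hy), zero_smul, norm_zero]; exact hL0

theorem HasDerivWithinAt.Ici_of_Icc {a b t : ℝ} {α : ℝ → E} {v : E} (ht : t ∈ Set.Ico a b)
    (h : HasDerivWithinAt α v (Set.Icc a b) t) : HasDerivWithinAt α v (Set.Ici t) t :=
  (h.mono (Set.Icc_subset_Icc_left ht.1)).mono_of_mem_nhdsWithin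
    (Icc_mem_nhdsGE ht.2)

/-- The case `R = 0` of the hypothesis is linear growth, which the truncated field inherits.
Grönwall then keeps the truncated solution in the ball of radius `R`, on which the cutoff equals
one. -/
theorem SemiLip.exists_solution [CompleteSpace E] {Φ : E → E} (hΦ : SemiLip Φ) (x₀ : E) {T : ℝ}
    (hT : 0 < T) : ∃ α : ℝ → E, α 0 = x₀ ∧
      ∀ t ∈ Set.Icc 0 T, HasDerivWithinAt α (Φ (α t)) (Set.Icc 0 T) t := by
  obtain ⟨K0, hK0, h0⟩ := hΦ 0
  set R := gronwallBound ‖x₀‖ K0 ‖Φ 0‖ T with hR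
  obtain ⟨K, L, hKlip, hL⟩ := cutoff_lipschitz hΦ R
  -- The field is bounded by `L`, so with radius `L * T` the whole of `[0, T]` is admissible.
  have hP : IsPicardLindelof (fun _ : ℝ => fun y => max 0 (min 1 (R + 1 - ‖y‖)) • Φ y)
      (tmin := 0) (tmax := T) ⟨0, le_rfl, hT.le⟩ x₀ (L * ⟨T, hT.le⟩) 0 L K :=
    { lipschitzOnWith := fun t _ => hKlip.lipschitzOnWith
      continuousOn := fun x _ => continuousOn_const
      norm_le := fun t _ x _ => hL x
      mul_max_le := by
        have : ((L * ⟨T, hT.le⟩ : NNReal) : ℝ) = L * T := NNReal.coe_mul L ⟨T, hT.le⟩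
        simp [hT.le, this] }
  obtain ⟨α, hα0, hα⟩ := hP.exists_eq_forall_mem_Icc_hasDerivWithinAt₀
  refine ⟨α, hα0, fun t ht => ?_⟩
  have hbd : ∀ t ∈ Set.Icc (0:ℝ) T, ‖α t‖ ≤ gronwallBound ‖x₀‖ K0 ‖Φ 0‖ (t - 0) := by
    refine norm_le_gronwallBound_of_norm_deriv_right_le (fun t ht => (hα t ht).continuousWithinAt)
      (fun t ht => (hα t (Set.Ico_subset_Icc_self ht)).Ici_of_Icc ht) (le_of_eq ?_) ?_
    · exact congrArg _ hα0
    · intro t _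
      have h1 := h0 0 (α t) (by simp)
      rw [sub_zero] at h1
      have h2 := norm_sub_norm_le (Φ (α t)) (Φ 0)
      rw [norm_smul, Real.norm_eq_abs, abs_of_nonneg (le_max_left _ _)]
      refine (mul_le_mul_of_nonneg_right (max_le zero_le_one (min_le_left _ _))
        (norm_nonneg _)).trans ?_
      linarith
  have hle : ‖α t‖ ≤ R := (hbd t ht).trans
    (gronwallBound_mono (norm_nonneg _) (norm_nonneg _) hK0 (by linarith [ht.2]))
  have e := hα t ht
  rwa [min_eq_left (by linarith), max_eq_right zero_le_one, one_smul] at e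

/-- With `α` bounded by compactness, the semi-Lipschitz bound at `α t` gives `‖(β - α)'‖ ≤ K ‖β -
α‖`, and the difference vanishes at time zero. -/
theorem SemiLip.unique_solution {Φ : E → E} (hΦ : SemiLip Φ) {T : ℝ}
    {α β : ℝ → E} (h0 : α 0 = β 0)
    (hα : ∀ t ∈ Set.Icc 0 T, HasDerivWithinAt α (Φ (α t)) (Set.Icc 0 T) t)
    (hβ : ∀ t ∈ Set.Icc 0 T, HasDerivWithinAt β (Φ (β t)) (Set.Icc 0 T) t) :
    ∀ t ∈ Set.Icc 0 T, α t = β t := by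
  have hαc : ContinuousOn α (Set.Icc 0 T) := fun t ht => (hα t ht).continuousWithinAt
  have hβc : ContinuousOn β (Set.Icc 0 T) := fun t ht => (hβ t ht).continuousWithinAt
  obtain ⟨R, hR⟩ := isCompact_Icc.exists_bound_of_continuousOn hαc
  obtain ⟨K, hK, h⟩ := hΦ R
  intro t ht
  have := eq_zero_of_abs_deriv_le_mul_abs_self_of_eq_zero_right (f := fun t => β t - α t) (K := K)
    (hβc.sub hαc)
    (fun t ht => ((hβ t (Set.Ico_subset_Icc_self ht)).Ici_of_Icc ht).sub
      ((hα t (Set.Ico_subset_Icc_self ht)).Ici_of_Icc ht)) (by simp [h0])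
    (fun t ht => h _ _ (hR t (Set.Ico_subset_Icc_self ht))) t ht
  exact (sub_eq_zero.1 this).symm

/-- The error of one explicit Euler step along a solution is quadratic in the step size. -/
theorem SemiLip.euler_error {Φ : E → E} (hΦ : SemiLip Φ) {T : ℝ} {α : ℝ → E}
    (hα : ∀ t ∈ Set.Icc 0 T, HasDerivWithinAt α (Φ (α t)) (Set.Icc 0 T) t) :
    ∃ B : ℝ, 0 ≤ B ∧ (∀ t ∈ Set.Icc 0 T, ‖α t‖ ≤ B ∧ ‖Φ (α t)‖ ≤ B) ∧
      ∀ s t, 0 ≤ s → s ≤ t → t ≤ T → ‖α t - α s - (t - s) • Φ (α s)‖ ≤ B * (t - s) ^ 2 := by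
  have hαc : ContinuousOn α (Set.Icc 0 T) := fun t ht => (hα t ht).continuousWithinAt
  obtain ⟨R, hR⟩ := isCompact_Icc.exists_bound_of_continuousOn hαc
  obtain ⟨K, hK, h⟩ := hΦ R
  obtain ⟨K0, hK0, h0⟩ := hΦ 0
  set B1 := ‖Φ 0‖ + K0 * |R| with hB1
  have hB1' : 0 ≤ B1 := by positivity
  have hb : ∀ t ∈ Set.Icc 0 T, ‖Φ (α t)‖ ≤ B1 := by
    intro t ht
    have h1 := h0 0 (α t) (by simp)
    rw [sub_zero] at h1
    have h2 := norm_sub_norm_le (Φ (α t)) (Φ 0)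
    have := mul_le_mul_of_nonneg_left ((hR t ht).trans (le_abs_self R)) hK0
    linarith
  have hKB : 0 ≤ K * B1 := mul_nonneg hK hB1'
  have hR0 := abs_nonneg R
  refine ⟨|R| + B1 + K * B1, by linarith, fun t ht => ⟨?_, ?_⟩, fun s t hs hst htT => ?_⟩
  · linarith [hR t ht, le_abs_self R]
  · linarith [hb t ht]
  have hsub : Set.Icc s t ⊆ Set.Icc 0 T := Set.Icc_subset_Icc hs htT
  have l1 : ∀ u ∈ Set.Icc s t, ‖α u - α s‖ ≤ B1 * (t - s) := by
    intro u hu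
    have := (convex_Icc s t).norm_image_sub_le_of_norm_hasDerivWithin_le
      (fun x hx => (hα x (hsub hx)).mono hsub) (fun x hx => hb x (hsub hx))
      (Set.left_mem_Icc.2 hst) hu
    refine this.trans (mul_le_mul_of_nonneg_left ?_ hB1')
    rw [Real.norm_eq_abs, abs_of_nonneg (by linarith [hu.1])]; linarith [hu.2]
  -- Mean value inequality for `u ↦ α u - u • Φ (α s)`, whose derivative is of size `t - s` by `l1`.
  have l2 := (convex_Icc s t).norm_image_sub_le_of_norm_hasDerivWithin_le
      (f := fun u => α u - u • Φ (α s)) (f' := fun u => Φ (α u) - Φ (α s)) (C := K * (B1 * (t - s)))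
      (fun x hx => by
        have := ((hα x (hsub hx)).mono hsub).fun_sub
          ((hasDerivWithinAt_id x (Set.Icc s t)).smul_const (Φ (α s)))
        simpa using this)
      (fun x hx => (h _ _ (hR s ⟨hs, hst.trans htT⟩)).trans
        (mul_le_mul_of_nonneg_left (l1 x hx) hK))
      (Set.left_mem_Icc.2 hst) (Set.right_mem_Icc.2 hst)
  have e : α t - α s - (t - s) • Φ (α s) = α t - t • Φ (α s) - (α s - s • Φ (α s)) := by
    rw [sub_smul]; abel
  rw [e]
  refine l2.trans ?_
  rw [Real.norm_eq_abs, abs_of_nonneg (by linarith)]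
  have : 0 ≤ (t - s) ^ 2 := sq_nonneg _
  nlinarith [mul_nonneg hR0 this, mul_nonneg hB1' this]

end ODE

/-! ### Gaussian vectors: projections, Stein's identity, lengths. -/

section Gaussian

/-- The law of a standard Gaussian vector in `ℝⁿ`. -/
noncomputable abbrev stdGauss (n : ℕ) : Measure (Fin n → ℝ) := Measure.pi fun _ => gaussianReal 0 1

theorem integrable_pow_gaussianReal (k : ℕ) :
    Integrable (fun x : ℝ => x ^ k) (gaussianReal 0 1) := by
  have h := (memLp_id_gaussianReal (μ := 0) (v := 1) (k : NNReal)).integrable_norm_pow'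
  refine (integrable_norm_iff (by fun_prop)).1 ?_
  simpa using h

theorem integral_sq_gaussian : ∫ x, x ^ 2 ∂(gaussianReal 0 1) = 1 := by
  have h := variance_id_gaussianReal (μ := 0) (v := 1)
  rw [variance_of_integral_eq_zero (by fun_prop) (by simp)] at h
  simpa using h

/-- Both sides have the characteristic function `exp (-t² |w|² / 2)`; on the left it factorizes over
the coordinates. -/
theorem map_dotProduct_stdGauss {n : ℕ} (w : Fin n → ℝ) :
    (stdGauss n).map (fun a => a ⬝ᵥ w) = (gaussianReal 0 1).map (fun x => x * √(w ⬝ᵥ w)) := by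
  have hm : Measurable fun a : Fin n → ℝ => a ⬝ᵥ w := by unfold dotProduct; fun_prop
  have : IsProbabilityMeasure ((stdGauss n).map (fun a => a ⬝ᵥ w)) :=
    Measure.isProbabilityMeasure_map hm.aemeasurable
  have hw : 0 ≤ w ⬝ᵥ w := by simpa using dotProduct_star_self_nonneg w
  rw [gaussianReal_map_mul_const]
  apply Measure.ext_of_charFun
  ext t
  rw [charFun_apply_real, integral_map hm.aemeasurable (by fun_prop), charFun_gaussianReal]
  have e : ∀ a : Fin n → ℝ, Complex.exp (t * ((a ⬝ᵥ w : ℝ) : ℂ) * Complex.I)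
      = ∏ i, Complex.exp (((t * w i : ℝ) : ℂ) * (a i : ℂ) * Complex.I) := by
    intro a
    rw [← Complex.exp_sum]
    congr 1
    simp only [dotProduct, Complex.ofReal_sum, Finset.mul_sum, Finset.sum_mul, Complex.ofReal_mul]
    exact Finset.sum_congr rfl fun i _ => by ring
  simp_rw [e]
  rw [integral_fintype_prod_eq_prod
    (f := fun i (x : ℝ) => Complex.exp (((t * w i : ℝ) : ℂ) * (x : ℂ) * Complex.I))]
  simp_rw [← charFun_apply_real, charFun_gaussianReal, ← Complex.exp_sum]
  congr 1
  have h2 : ((√(w ⬝ᵥ w) ^ 2 : ℝ) : ℂ) = ∑ i, (w i : ℂ) ^ 2 := by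
    rw [Real.sq_sqrt hw, dotProduct]
    push_cast
    exact Finset.sum_congr rfl fun i _ => by ring
  simp only [NNReal.coe_mul, NNReal.coe_mk, Complex.ofReal_mul, h2]
  simp only [mul_zero, Complex.ofReal_zero, zero_mul, NNReal.coe_one, Complex.ofReal_one, mul_one,
    zero_sub, Finset.sum_neg_distrib, Finset.sum_mul, Finset.sum_div]
  congr 1
  exact Finset.sum_congr rfl fun i _ => by ring

theorem integrable_dotProduct_sq {n : ℕ} (w : Fin n → ℝ) :
    Integrable (fun a : Fin n → ℝ => (a ⬝ᵥ w) ^ 2) (stdGauss n) ∧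
      ∫ a, (a ⬝ᵥ w) ^ 2 ∂(stdGauss n) = w ⬝ᵥ w := by
  have hm : Measurable fun a : Fin n → ℝ => a ⬝ᵥ w := by unfold dotProduct; fun_prop
  have hw : 0 ≤ w ⬝ᵥ w := by simpa using dotProduct_star_self_nonneg w
  constructor
  · have : Integrable (fun x : ℝ => x ^ 2) ((stdGauss n).map (fun a => a ⬝ᵥ w)) := by
      rw [map_dotProduct_stdGauss, integrable_map_measure (by fun_prop) (by fun_prop)]
      simp only [Function.comp_def, mul_pow]
      exact (integrable_pow_gaussianReal 2).mul_const _
    exact this.comp_measurable hm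
  · rw [← integral_map (f := fun x : ℝ => x ^ 2) hm.aemeasurable (by fun_prop),
      map_dotProduct_stdGauss, integral_map (by fun_prop) (by fun_prop)]
    simp only [mul_pow]
    rw [integral_mul_const, integral_sq_gaussian, one_mul, Real.sq_sqrt hw]

/-- Averages over a latent vector and a projection of a Gaussian vector are brackets. -/
theorem integral_eq_bracket {n d : ℕ} (μ : Measure (Fin d → ℝ)) [IsProbabilityMeasure μ]
    (v : Fin d → ℝ) (w : Fin n → ℝ) (η : ℝ) {φ : (Fin d → ℝ) → ℝ → ℝ}
    (hφ : Measurable (Function.uncurry φ)) :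
    ∫ p : (Fin d → ℝ) × (Fin n → ℝ), φ p.1 (p.1 ⬝ᵥ v + √η * (p.2 ⬝ᵥ w)) ∂(μ.prod (stdGauss n))
      = bracket μ v ((w ⬝ᵥ w) * η) φ := by
  have hm : Measurable fun a : Fin n → ℝ => a ⬝ᵥ w := by unfold dotProduct; fun_prop
  have hw : 0 ≤ w ⬝ᵥ w := by simpa using dotProduct_star_self_nonneg w
  have hmap : (μ.prod (stdGauss n)).map (Prod.map id fun a => a ⬝ᵥ w)
      = (μ.prod (gaussianReal 0 1)).map (Prod.map id fun x => x * √(w ⬝ᵥ w)) := by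
    rw [← Measure.map_prod_map _ _ measurable_id hm,
      ← Measure.map_prod_map _ _ measurable_id (by fun_prop), map_dotProduct_stdGauss]
  have hΦ : Measurable fun p : (Fin d → ℝ) × ℝ => φ p.1 (p.1 ⬝ᵥ v + √η * p.2) := by
    have h1 : Measurable fun p : (Fin d → ℝ) × ℝ => p.1 ⬝ᵥ v + √η * p.2 := by
      unfold dotProduct; fun_prop
    exact hφ.comp (measurable_fst.prodMk h1)
  have e1 := integral_map (μ := μ.prod (stdGauss n)) (measurable_id.prodMap hm).aemeasurable
    hΦ.aestronglyMeasurable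
  have e2 := integral_map (μ := μ.prod (gaussianReal 0 1))
    (φ := Prod.map id fun x : ℝ => x * √(w ⬝ᵥ w)) (by fun_prop)
    hΦ.aestronglyMeasurable
  rw [hmap] at e1
  rw [bracket]
  simp only [Prod.map_fst, Prod.map_snd, id] at e1 e2
  rw [← e1, e2, Real.sqrt_mul hw]
  refine integral_congr_ae (Filter.Eventually.of_forall fun p => ?_)
  simp only
  congr 2
  ring

/-- Stein's identity for a standard Gaussian variable. -/
theorem stein_one {θ : ℝ → ℝ} {B : ℝ} (hθ : Differentiable ℝ θ) (hB : ∀ x, |θ x| ≤ B)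
    (hB' : ∀ x, |deriv θ x| ≤ B) (s t : ℝ) :
    ∫ x, x * θ (s + t * x) ∂(gaussianReal 0 1) = t * ∫ x, deriv θ (s + t * x) ∂(gaussianReal 0 1) := by
  have hθc : Continuous θ := hθ.continuous
  have hθm : Measurable (deriv θ) := measurable_deriv θ
  set p := gaussianPDFReal 0 1 with hp
  have hpd : ∀ x, HasDerivAt p (-(x * p x)) x := by
    intro x
    have h1 : HasDerivAt (fun x : ℝ => -(x - 0) ^ 2 / (2 * 1)) (-x) x := by
      have := (((hasDerivAt_id x).sub_const 0).pow 2).neg.div_const (2 * 1)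
      refine this.congr_deriv ?_
      simp only [id, Nat.cast_ofNat, sub_zero, Nat.add_one_sub_one, pow_one]
      ring
    have h2 := (h1.exp.const_mul (√(2 * Real.pi * 1))⁻¹)
    refine (h2.congr_deriv ?_)
    simp only [hp, gaussianPDFReal, NNReal.coe_one]
    ring
  have hpi : Integrable p := integrable_gaussianPDFReal 0 1
  have hxpi : Integrable fun x => x * p x := by
    have := ((integrable_mul_exp_neg_mul_sq (b := 1 / 2) (by norm_num)).const_mul
      (√(2 * Real.pi * 1))⁻¹)
    refine this.congr (Filter.Eventually.of_forall fun x => ?_)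
    simp only [hp, gaussianPDFReal, NNReal.coe_one]
    rw [show -(x - 0) ^ 2 / (2 * 1) = -(1 / 2) * x ^ 2 by ring]
    ring
  have hu : ∀ x, HasDerivAt (fun x => θ (s + t * x)) (t * deriv θ (s + t * x)) x := by
    intro x
    have h1 : HasDerivAt (fun x : ℝ => s + t * x) t x := by
      simpa using ((hasDerivAt_id x).const_mul t).const_add s
    have := (hθ (s + t * x)).hasDerivAt.comp x h1
    rwa [mul_comm] at this
  -- Integration by parts against the density `p`, which satisfies `p' = -x p`.
  have hbp := integral_mul_deriv_eq_deriv_mul_of_integrable (u := fun x => θ (s + t * x)) (v := p)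
    (u' := fun x => t * deriv θ (s + t * x)) (v' := fun x => -(x * p x))
    (fun x _ => hu x) (fun x _ => hpd x)
    (hxpi.neg.bdd_mul (c := B) (by fun_prop)
      (Filter.Eventually.of_forall fun x => hB _))
    (hpi.bdd_mul (c := |t| * B)
      ((hθm.comp (by fun_prop : Measurable fun x : ℝ => s + t * x)).const_mul t).aestronglyMeasurable
      (Filter.Eventually.of_forall fun x => by
        rw [Real.norm_eq_abs, abs_mul]
        exact mul_le_mul_of_nonneg_left (hB' _) (abs_nonneg _)))
    (hpi.bdd_mul (c := B) (by fun_prop)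
      (Filter.Eventually.of_forall fun x => hB _))
  rw [integral_gaussianReal_eq_integral_smul one_ne_zero,
    integral_gaussianReal_eq_integral_smul one_ne_zero, ← integral_const_mul]
  have e1 : ∀ x, p x • (x * θ (s + t * x)) = -(θ (s + t * x) * -(x * p x)) := by
    intro x; simp only [smul_eq_mul]; ring
  have e2 : ∀ x, t * p x • deriv θ (s + t * x) = t * deriv θ (s + t * x) * p x := by
    intro x; simp only [smul_eq_mul]; ring
  simp_rw [← hp, e1, e2, integral_neg]
  rw [hbp, neg_neg]

/-- Fubini isolates coordinate `i`; the other coordinates only shift `s` in the one-dimensional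
identity. -/
theorem stein_coord {n : ℕ} {θ : ℝ → ℝ} {B : ℝ} (hθ : Differentiable ℝ θ) (hB : ∀ x, |θ x| ≤ B)
    (hB' : ∀ x, |deriv θ x| ≤ B) (s : ℝ) (w : Fin n → ℝ) (i : Fin n) :
    ∫ a, a i * θ (s + a ⬝ᵥ w) ∂(stdGauss n) = w i * ∫ a, deriv θ (s + a ⬝ᵥ w) ∂(stdGauss n) := by
  obtain ⟨m, rfl⟩ : ∃ m, n = m + 1 := ⟨n - 1, by have := i.2; omega⟩
  have hθc : Continuous θ := hθ.continuous
  have hθm : Measurable (deriv θ) := measurable_deriv θ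
  have hP := (measurePreserving_piFinSuccAbove (fun _ : Fin (m + 1) => gaussianReal 0 1) i).symm
  have hdot : ∀ p : ℝ × (Fin m → ℝ),
      (Fin.insertNthEquiv (fun _ => ℝ) i p) ⬝ᵥ w = w i * p.1 + p.2 ⬝ᵥ (i.removeNth w) := by
    intro p
    simp only [dotProduct]
    rw [Fin.sum_univ_succAbove _ i]
    simp [Fin.removeNth, mul_comm]
  have hco : ∀ p : ℝ × (Fin m → ℝ), (Fin.insertNthEquiv (fun _ => ℝ) i p) i = p.1 := by simp
  rw [← hP.integral_comp', ← hP.integral_comp']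
  simp only [MeasurableEquiv.piFinSuccAbove_symm_apply, hco, hdot]
  have hm : Measurable fun p : ℝ × (Fin m → ℝ) => s + (w i * p.1 + p.2 ⬝ᵥ (i.removeNth w)) := by
    unfold dotProduct; fun_prop
  have i1 : Integrable (fun p : ℝ × (Fin m → ℝ) =>
      p.1 * θ (s + (w i * p.1 + p.2 ⬝ᵥ (i.removeNth w))))
      ((gaussianReal 0 1).prod (Measure.pi fun _ => gaussianReal 0 1)) := by
    have h1 := (integrable_pow_gaussianReal 1).comp_fst (Measure.pi fun _ : Fin m => gaussianReal 0 1)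
    simp only [pow_one] at h1
    exact h1.mul_bdd (c := B) (hθc.measurable.comp hm).aestronglyMeasurable
      (Filter.Eventually.of_forall fun x => hB _)
  have i2 : Integrable (fun p : ℝ × (Fin m → ℝ) =>
      deriv θ (s + (w i * p.1 + p.2 ⬝ᵥ (i.removeNth w))))
      ((gaussianReal 0 1).prod (Measure.pi fun _ => gaussianReal 0 1)) :=
    Integrable.of_bound (hθm.comp hm).aestronglyMeasurable B
      (Filter.Eventually.of_forall fun x => hB' _)
  erw [integral_prod_symm _ i1, integral_prod_symm _ i2]
  rw [← integral_const_mul]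
  congr 1
  ext y
  have := stein_one hθ hB hB' (s + y ⬝ᵥ (i.removeNth w)) (w i)
  simp only [show ∀ x, s + (w i * x + y ⬝ᵥ (i.removeNth w)) = s + y ⬝ᵥ (i.removeNth w) + w i * x by
    intro x; ring]
  exact this

theorem integrable_dotProduct {n : ℕ} (x : Fin n → ℝ) :
    Integrable (fun a : Fin n → ℝ => a ⬝ᵥ x) (stdGauss n) := by
  simp only [dotProduct]
  refine integrable_finsetSum _ fun i _ => ?_
  have h := integrable_comp_eval (μ := fun _ : Fin n => gaussianReal 0 1) (i := i)
    (integrable_pow_gaussianReal 1)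
  simp only [pow_one] at h
  exact h.mul_const _

/-- Stein's identity for a standard Gaussian vector. -/
theorem stein {n : ℕ} {θ : ℝ → ℝ} {B : ℝ} (hθ : Differentiable ℝ θ) (hB : ∀ x, |θ x| ≤ B)
    (hB' : ∀ x, |deriv θ x| ≤ B) (s : ℝ) (w x : Fin n → ℝ) :
    ∫ a, (a ⬝ᵥ x) * θ (s + a ⬝ᵥ w) ∂(stdGauss n)
      = (x ⬝ᵥ w) * ∫ a, deriv θ (s + a ⬝ᵥ w) ∂(stdGauss n) := by
  have hθc : Continuous θ := hθ.continuous
  have hm : Measurable fun a : Fin n → ℝ => s + a ⬝ᵥ w := by unfold dotProduct; fun_prop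
  simp only [dotProduct, Finset.sum_mul]
  rw [integral_finsetSum]
  · refine Finset.sum_congr rfl fun i _ => ?_
    have := stein_coord hθ hB hB' s w i
    simp only [dotProduct] at this
    rw [mul_assoc, ← this, ← integral_const_mul]
    congr 1; ext a; ring
  · intro i _
    have h := integrable_comp_eval (μ := fun _ : Fin n => gaussianReal 0 1) (i := i)
      (integrable_pow_gaussianReal 1)
    simp only [pow_one] at h
    exact (h.mul_const _).mul_bdd (c := B) (hθc.measurable.comp hm).aestronglyMeasurable
      (Filter.Eventually.of_forall fun x => hB _)

/-- The squared length is a sum of `n` independent squares of mean one, so its variance is `n` times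
that of a single square. -/
theorem exists_normSq_moments : ∃ K : ℝ, 0 ≤ K ∧ ∀ n : ℕ,
    Integrable (fun a : Fin n → ℝ => (a ⬝ᵥ a) ^ 2) (stdGauss n) ∧
    ∫ a, (a ⬝ᵥ a - n) ^ 2 ∂(stdGauss n) ≤ K * n := by
  refine ⟨Var[fun x => x ^ 2; gaussianReal 0 1], variance_nonneg _ _, fun n => ?_⟩
  have h2 : MemLp (fun x : ℝ => x ^ 2) 2 (gaussianReal 0 1) := by
    rw [memLp_two_iff_integrable_sq (by fun_prop)]
    simpa [← pow_mul] using integrable_pow_gaussianReal 4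
  have hsum : MemLp (fun a : Fin n → ℝ => a ⬝ᵥ a) 2 (stdGauss n) := by
    simp only [dotProduct]
    refine memLp_finsetSum _ fun i _ => ?_
    have := h2.comp_measurePreserving (measurePreserving_eval (fun _ : Fin n => gaussianReal 0 1) i)
    simpa [Function.comp_def, sq] using this
  refine ⟨(memLp_two_iff_integrable_sq hsum.1).1 hsum, le_of_eq ?_⟩
  have hmean : ∫ a, a ⬝ᵥ a ∂(stdGauss n) = n := by
    simp only [dotProduct]
    rw [integral_finsetSum]
    · have : ∀ i : Fin n, ∫ a : Fin n → ℝ, a i * a i ∂(stdGauss n) = 1 := by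
        intro i
        have := integral_comp_eval (μ := fun _ : Fin n => gaussianReal 0 1) (i := i)
          (f := fun x : ℝ => x ^ 2) (by fun_prop)
        rw [integral_sq_gaussian] at this
        simpa [sq] using this
      simp [this]
    · intro i _
      have := integrable_comp_eval (μ := fun _ : Fin n => gaussianReal 0 1) (i := i)
        (integrable_pow_gaussianReal 2)
      simpa [sq] using this
  have hv := variance_eq_integral hsum.1.aemeasurable
  rw [hmean] at hv
  rw [← hv]
  have := variance_sum_pi (μ := fun _ : Fin n => gaussianReal 0 1)
    (X := fun _ => fun x : ℝ => x ^ 2) (fun _ => h2)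
  simp only [Finset.sum_const, Finset.card_univ, Fintype.card_fin, nsmul_eq_mul] at this
  rw [mul_comm, ← this]
  congr 1
  ext a
  simp [dotProduct, sq]

end Gaussian

/-! ### Calculus of semi-Lipschitz functions. -/

section SemiLip

variable {E : Type*} [NormedAddCommGroup E]

theorem SemiLip.growth {E' : Type*} [NormedAddCommGroup E'] {Φ : E → E'} (h : SemiLip Φ) (R : ℝ) :
    ∃ B, 0 ≤ B ∧ ∀ x, ‖x‖ ≤ R → ‖Φ x‖ ≤ B := by
  obtain ⟨K0, hK0, h0⟩ := h 0
  refine ⟨‖Φ 0‖ + K0 * |R|, by positivity, fun x hx => ?_⟩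
  have h1 := h0 0 x (by simp)
  rw [sub_zero] at h1
  have h2 := norm_sub_norm_le (Φ x) (Φ 0)
  have := mul_le_mul_of_nonneg_left (hx.trans (le_abs_self R)) hK0
  linarith

theorem SemiLip.of_lipschitz {E' : Type*} [NormedAddCommGroup E'] {Φ : E → E'} {K : ℝ}
    (h : ∀ x y, ‖Φ y - Φ x‖ ≤ K * ‖y - x‖) : SemiLip Φ := fun _ =>
  ⟨|K|, abs_nonneg K, fun x y _ => (h x y).trans
    (mul_le_mul_of_nonneg_right (le_abs_self K) (norm_nonneg _))⟩

theorem SemiLip.add {E' : Type*} [NormedAddCommGroup E'] {Φ Ψ : E → E'} (h : SemiLip Φ)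
    (h' : SemiLip Ψ) : SemiLip fun x => Φ x + Ψ x := fun R => by
  obtain ⟨K, hK, h⟩ := h R
  obtain ⟨K', hK', h'⟩ := h' R
  refine ⟨K + K', add_nonneg hK hK', fun x y hx => ?_⟩
  rw [add_sub_add_comm, add_mul]
  exact (norm_add_le _ _).trans (add_le_add (h x y hx) (h' x y hx))

theorem SemiLip.sum {κ E' : Type*} [NormedAddCommGroup E'] {Φ : κ → E → E'} (s : Finset κ)
    (h : ∀ k ∈ s, SemiLip (Φ k)) : SemiLip fun x => ∑ k ∈ s, Φ k x := by
  classical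
  induction s using Finset.induction_on with
  | empty => exact SemiLip.of_lipschitz (K := 0) (by simp)
  | insert a s ha ih =>
    simp only [Finset.sum_insert ha]
    exact (h a (by simp)).add (ih fun k hk => h k (by simp [hk]))

theorem SemiLip.pi {κ : Type*} [Fintype κ] {F : κ → Type*} [∀ k, NormedAddCommGroup (F k)]
    {Φ : E → ∀ k, F k} (h : ∀ k, SemiLip fun x => Φ x k) : SemiLip Φ := fun R => by
  choose K hK h using fun k => h k R
  refine ⟨∑ k, K k, Finset.sum_nonneg fun k _ => hK k, fun x y hx => ?_⟩
  rw [pi_norm_le_iff_of_nonneg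
    (mul_nonneg (Finset.sum_nonneg fun k _ => hK k) (norm_nonneg _))]
  intro k
  exact (h k x y hx).trans (mul_le_mul_of_nonneg_right
    (Finset.single_le_sum (fun k _ => hK k) (Finset.mem_univ k)) (norm_nonneg _))

/-- Bounded functions that are Lipschitz in the sense of `SemiLip`. -/
def BddSemiLip (β : E → ℝ) : Prop := (∃ B, ∀ x, |β x| ≤ B) ∧ SemiLip β

theorem BddSemiLip.const (c : ℝ) : BddSemiLip fun _ : E => c :=
  ⟨⟨|c|, fun _ => le_rfl⟩, SemiLip.of_lipschitz (K := 0) (by simp)⟩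

theorem BddSemiLip.add {β γ : E → ℝ} (h : BddSemiLip β) (h' : BddSemiLip γ) :
    BddSemiLip fun x => β x + γ x := by
  obtain ⟨⟨B, hB⟩, h⟩ := h
  obtain ⟨⟨B', hB'⟩, h'⟩ := h'
  exact ⟨⟨B + B', fun x => (abs_add_le _ _).trans (add_le_add (hB x) (hB' x))⟩, h.add h'⟩

/-- In `(u y - u x) β y + u x (β y - β x)` the unbounded factor `u` appears alone only at the
bounded point `x`. The entries of the drift are sums of such products. -/
theorem SemiLip.mul_bdd {u β : E → ℝ} (hu : SemiLip u) (hβ : BddSemiLip β) :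
    SemiLip fun x => u x * β x := fun R => by
  obtain ⟨⟨B, hB⟩, hβ⟩ := hβ
  obtain ⟨K, hK, h⟩ := hu R
  obtain ⟨K', hK', h'⟩ := hβ R
  obtain ⟨A, hA, hA'⟩ := hu.growth R
  refine ⟨K * |B| + A * K', by positivity, fun x y hx => ?_⟩
  have e : u y * β y - u x * β x = (u y - u x) * β y + u x * (β y - β x) := by ring
  rw [e, add_mul]
  refine (norm_add_le _ _).trans (add_le_add ?_ ?_)
  · rw [norm_mul, mul_right_comm]
    exact mul_le_mul (h x y hx) ((hB y).trans (le_abs_self B)) (norm_nonneg _) (by positivity)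
  · rw [norm_mul, mul_assoc]
    exact mul_le_mul (hA' x hx) (h' x y hx) (norm_nonneg _) hA

theorem BddSemiLip.const_mul {β : E → ℝ} (c : ℝ) (h : BddSemiLip β) :
    BddSemiLip fun x => c * β x := by
  refine ⟨?_, (BddSemiLip.const c).2.mul_bdd h⟩
  obtain ⟨⟨B, hB⟩, -⟩ := h
  exact ⟨|c| * B, fun x => by
    rw [abs_mul]; exact mul_le_mul_of_nonneg_left (hB x) (abs_nonneg c)⟩

theorem BddSemiLip.neg {β : E → ℝ} (h : BddSemiLip β) : BddSemiLip fun x => -β x := by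
  simpa using h.const_mul (-1)

theorem BddSemiLip.comp_nonexpansive {F : Type*} [NormedAddCommGroup F] {β : F → ℝ}
    (h : BddSemiLip β) {π : E → F} (hπ : ∀ x, ‖π x‖ ≤ ‖x‖) (hπ' : ∀ x y, ‖π y - π x‖ ≤ ‖y - x‖) :
    BddSemiLip fun x => β (π x) := by
  obtain ⟨⟨B, hB⟩, h⟩ := h
  refine ⟨⟨B, fun x => hB _⟩, fun R => ?_⟩
  obtain ⟨K, hK, h⟩ := h R
  exact ⟨K, hK, fun x y hx => (h _ _ ((hπ x).trans hx)).trans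
    (mul_le_mul_of_nonneg_left (hπ' x y) hK)⟩

/-- A `y` in a slightly larger ball is covered by compactness. Any other `y` is at distance at least
one from `x`, where boundedness alone gives the estimate. This is how the assumptions on `H'` are
used. -/
theorem BddSemiLip.of_locallyLipschitz {β : ℝ → ℝ} {B : ℝ} (hB : ∀ x, |β x| ≤ B)
    (h : LocallyLipschitz β) : BddSemiLip β := by
  refine ⟨⟨B, hB⟩, fun R => ?_⟩
  have hB0 : 0 ≤ B := (abs_nonneg _).trans (hB 0)
  obtain ⟨K, hK⟩ := (h.locallyLipschitzOn (s := Metric.closedBall 0 (|R| + 1))).exists_lipschitzOnWith_of_compact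
    (isCompact_closedBall (0:ℝ) (|R| + 1))
  refine ⟨K + 2 * B, by positivity, fun x y hx => ?_⟩
  have hxR : ‖x‖ ≤ |R| := hx.trans (le_abs_self R)
  by_cases hy : ‖y‖ ≤ |R| + 1
  · have := hK.norm_sub_le (show y ∈ Metric.closedBall (0:ℝ) (|R| + 1) by simpa using hy)
      (show x ∈ Metric.closedBall (0:ℝ) (|R| + 1) by
        rw [mem_closedBall_zero_iff]; linarith)
    refine this.trans (mul_le_mul_of_nonneg_right ?_ (norm_nonneg _))
    linarith
  · have h1 : 1 ≤ ‖y - x‖ := by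
      have := norm_sub_norm_le y x
      linarith
    have h2 : ‖β y - β x‖ ≤ 2 * B := by
      refine (norm_sub_le _ _).trans ?_
      have := hB x; have := hB y
      simp only [Real.norm_eq_abs]; linarith
    have : 0 ≤ (K:ℝ) := K.2
    nlinarith

end SemiLip

/-! ### Brackets as functions of their parameters. -/

section Bracket

/-- `θ` and its first two derivatives are bounded by `B`. -/
structure C2Bdd (θ : ℝ → ℝ) (B : ℝ) : Prop where
  diff : Differentiable ℝ θ
  diff' : Differentiable ℝ (deriv θ)
  bound : ∀ x, |θ x| ≤ B
  bound' : ∀ x, |deriv θ x| ≤ B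
  bound'' : ∀ x, |deriv (deriv θ) x| ≤ B

namespace C2Bdd

variable {θ : ℝ → ℝ} {B : ℝ}

theorem nonneg (h : C2Bdd θ B) : 0 ≤ B := (abs_nonneg _).trans (h.bound 0)

theorem mono (h : C2Bdd θ B) {B' : ℝ} (hB : B ≤ B') : C2Bdd θ B' :=
  ⟨h.diff, h.diff', fun x => (h.bound x).trans hB, fun x => (h.bound' x).trans hB,
    fun x => (h.bound'' x).trans hB⟩

theorem abs_sub_le {θ : ℝ → ℝ} {B : ℝ} (h : Differentiable ℝ θ) (hb : ∀ x, |deriv θ x| ≤ B)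
    (x y : ℝ) : |θ y - θ x| ≤ B * |y - x| :=
  convex_univ.norm_image_sub_le_of_norm_deriv_le (fun x _ => h x) (fun x _ => hb x)
    (Set.mem_univ x) (Set.mem_univ y)

/-- The constant is dictated by the second derivative `2 (θ'² + θ θ'')`, with both terms in the
parenthesis at most `B²`. -/
theorem sq (h : C2Bdd θ B) : C2Bdd (fun x => θ x ^ 2) (4 * B ^ 2) := by
  have hB := h.nonneg
  have e1 : deriv (fun x => θ x ^ 2) = fun x => 2 * (θ x * deriv θ x) := by
    ext x
    rw [deriv_fun_pow (h.diff x)]; ring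
  have e2 : deriv (deriv fun x => θ x ^ 2) = fun x => 2 * (deriv θ x * deriv θ x
      + θ x * deriv (deriv θ) x) := by
    rw [e1]; ext x
    rw [deriv_const_mul _ ((h.diff x).fun_mul (h.diff' x)), deriv_fun_mul (h.diff x) (h.diff' x)]
  have hm : ∀ {a b : ℝ}, |a| ≤ B → |b| ≤ B → |a * b| ≤ B ^ 2 := by
    intro a b ha hb
    rw [abs_mul, _root_.sq]
    exact mul_le_mul ha hb (abs_nonneg _) hB
  refine ⟨h.diff.pow 2, ?_, fun x => ?_, fun x => ?_, fun x => ?_⟩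
  · rw [e1]; exact (h.diff.mul h.diff').const_mul 2
  · have := hm (h.bound x) (h.bound x)
    rw [← _root_.sq] at this
    nlinarith [sq_nonneg B]
  · rw [e1]
    have := hm (h.bound x) (h.bound' x)
    rw [abs_mul, abs_two]
    nlinarith [sq_nonneg B]
  · rw [e2]
    have h1 := hm (h.bound' x) (h.bound' x)
    have h2 := hm (h.bound x) (h.bound'' x)
    rw [abs_mul, abs_two]
    have := abs_add_le (deriv θ x * deriv θ x) (θ x * deriv (deriv θ) x)
    linarith

/-- After subtraction of its linear part, `σ ↦ θ (x + e σ)` is Lipschitz in `σ ^ 2`. -/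
theorem scale_bound (h : C2Bdd θ B) (x e σ σ' : ℝ) (hσ : 0 ≤ σ) (hσ' : 0 ≤ σ') :
    |θ (x + e * σ) - θ (x + e * σ') - (σ - σ') * (e * deriv θ x)|
      ≤ B * e ^ 2 * |σ ^ 2 - σ' ^ 2| := by
  wlog hle : σ' ≤ σ generalizing σ σ'
  · have := this σ' σ hσ' hσ (le_of_not_ge hle)
    rw [abs_sub_comm (σ ^ 2), ← abs_neg]
    convert this using 2
    ring
  have hB := h.nonneg
  have hd : ∀ u : ℝ, HasDerivAt (fun u => θ (x + e * u) - u * (e * deriv θ x))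
      (e * deriv θ (x + e * u) - e * deriv θ x) u := by
    intro u
    have h1 : HasDerivAt (fun u : ℝ => x + e * u) e u := by
      simpa using ((hasDerivAt_id u).const_mul e).const_add x
    have h2 := ((h.diff (x + e * u)).hasDerivAt.comp u h1).sub
      ((hasDerivAt_id u).mul_const (e * deriv θ x))
    refine h2.congr_deriv ?_
    ring
  have hb : ∀ u ∈ Set.Icc σ' σ, ‖e * deriv θ (x + e * u) - e * deriv θ x‖ ≤ B * e ^ 2 * σ := by
    intro u hu
    have h1 := abs_sub_le h.diff' h.bound'' x (x + e * u)
    rw [add_sub_cancel_left, abs_mul, abs_of_nonneg (hσ'.trans hu.1)] at h1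
    rw [← mul_sub, norm_mul, Real.norm_eq_abs, Real.norm_eq_abs]
    calc |e| * |deriv θ (x + e * u) - deriv θ x| ≤ |e| * (B * (|e| * σ)) := by
          refine mul_le_mul_of_nonneg_left (h1.trans ?_) (abs_nonneg e)
          gcongr
          exact hu.2
      _ = B * e ^ 2 * σ := by rw [← sq_abs e]; ring
  have := (convex_Icc σ' σ).norm_image_sub_le_of_norm_hasDerivWithin_le
    (fun u _ => (hd u).hasDerivWithinAt) hb (Set.left_mem_Icc.2 hle) (Set.right_mem_Icc.2 hle)
  have e1 : θ (x + e * σ) - θ (x + e * σ') - (σ - σ') * (e * deriv θ x)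
      = θ (x + e * σ) - σ * (e * deriv θ x) - (θ (x + e * σ') - σ' * (e * deriv θ x)) := by ring
  rw [e1]
  refine this.trans ?_
  rw [Real.norm_eq_abs, abs_of_nonneg (sub_nonneg.2 hle),
    abs_of_nonneg (by nlinarith : 0 ≤ σ ^ 2 - σ' ^ 2), mul_assoc]
  -- It remains to see that `σ (σ - σ') ≤ (σ + σ') (σ - σ')`; this turns a bound in `σ` into one in
  -- `σ²`.
  refine mul_le_mul_of_nonneg_left ?_ (mul_nonneg hB (sq_nonneg e))
  nlinarith

end C2Bdd

variable {d : ℕ} {μ : Measure (Fin d → ℝ)}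

theorem abs_dotProduct_le (c v : Fin d → ℝ) : |c ⬝ᵥ v| ≤ d * (‖c‖ * ‖v‖) := by
  rw [dotProduct]
  refine (Finset.abs_sum_le_sum_abs _ _).trans ?_
  refine (Finset.sum_le_card_nsmul _ _ (‖c‖ * ‖v‖) fun i _ => ?_).trans (by simp)
  rw [abs_mul]
  exact mul_le_mul (norm_le_pi_norm c i) (norm_le_pi_norm v i) (abs_nonneg _) (norm_nonneg _)

theorem HasAllMoments.integrable_one_add (h : HasAllMoments μ) [IsProbabilityMeasure μ] :
    Integrable (fun c => 1 + ‖c‖) μ := by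
  have := h 1
  simp only [pow_one] at this
  exact (integrable_const 1).add this

theorem bracket_bound [IsProbabilityMeasure μ] (hμ : HasAllMoments μ) {θ : ℝ → ℝ} {B : ℝ}
    (hB : ∀ x, |θ x| ≤ B) {ψ : (Fin d → ℝ) → ℝ} (hψ1 : ∀ c, |ψ c| ≤ 1 + ‖c‖) :
    ∀ v s, |bracket μ v s fun c x => ψ c * θ x| ≤ B * ∫ c, (1 + ‖c‖) ∂μ := by
  intro v s
  have hB0 : 0 ≤ B := (abs_nonneg _).trans (hB 0)
  have h1 := hμ.integrable_one_add.comp_fst (gaussianReal 0 1)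
  have h2 := norm_integral_le_of_norm_le (μ := μ.prod (gaussianReal 0 1))
    (f := fun p : (Fin d → ℝ) × ℝ => ψ p.1 * θ (p.1 ⬝ᵥ v + p.2 * √s)) (h1.const_mul B)
    (Filter.Eventually.of_forall fun p => by
      rw [norm_mul, mul_comm]
      exact mul_le_mul (hB _) (hψ1 _) (norm_nonneg _) hB0)
  rw [integral_const_mul, integral_fun_fst (fun c : Fin d → ℝ => 1 + ‖c‖)] at h2
  simpa [bracket] using h2

/-- Although `√s` enters, the dependence on `s` is Lipschitz: the part of the integrand that is
linear in the centred Gaussian `e` integrates to zero and may be subtracted, and by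
`C2Bdd.scale_bound` the rest varies with `√s ^ 2`. The bound on `ψ` covers the two weights that
occur, a coordinate and the constant one. -/
theorem bracket_lipschitz [IsProbabilityMeasure μ] (hμ : HasAllMoments μ) {θ : ℝ → ℝ} {B : ℝ}
    (h : C2Bdd θ B) {ψ : (Fin d → ℝ) → ℝ} (hψ : Measurable ψ) (hψ1 : ∀ c, |ψ c| ≤ 1 + ‖c‖) :
    ∃ K : ℝ, 0 ≤ K ∧ ∀ v v' s s', |(bracket μ v s fun c x => ψ c * θ x)
      - bracket μ v' s' fun c x => ψ c * θ x| ≤ K * (‖v - v'‖ + |s - s'|) := by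
  have hB := h.nonneg
  have hθc := h.diff.continuous
  have hθc' := h.diff'.continuous
  set ν := μ.prod (gaussianReal 0 1)
  have hW : Integrable (fun p : (Fin d → ℝ) × ℝ => (1 + ‖p.1‖) * p.2 ^ 2 + (‖p.1‖ + ‖p.1‖ ^ 2)) ν := by
    refine (hμ.integrable_one_add.mul_prod (integrable_pow_gaussianReal 2)).add ?_
    have := ((hμ 1).add (hμ 2)).comp_fst (gaussianReal 0 1)
    simpa using this
  refine ⟨(B * d + B) * ∫ p : (Fin d → ℝ) × ℝ, ((1 + ‖p.1‖) * p.2 ^ 2 + (‖p.1‖ + ‖p.1‖ ^ 2)) ∂ν,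
    mul_nonneg (by positivity) (integral_nonneg fun p => by positivity), fun v v' s s' => ?_⟩
  have hmv : ∀ (v : Fin d → ℝ) (σ : ℝ), Measurable fun p : (Fin d → ℝ) × ℝ => p.1 ⬝ᵥ v + p.2 * σ := by
    intro v σ; unfold dotProduct; fun_prop
  have hi : ∀ (v : Fin d → ℝ) (σ : ℝ), Integrable
      (fun p : (Fin d → ℝ) × ℝ => ψ p.1 * θ (p.1 ⬝ᵥ v + p.2 * σ)) ν := by
    intro v σ
    refine ((hμ.integrable_one_add.comp_fst (gaussianReal 0 1)).const_mul B).mono'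
      ((hψ.comp measurable_fst).mul (hθc.measurable.comp (hmv v σ))).aestronglyMeasurable
      (Filter.Eventually.of_forall fun p => ?_)
    rw [norm_mul, mul_comm]
    exact mul_le_mul (h.bound _) (hψ1 _) (norm_nonneg _) hB
  have hlin : Integrable (fun p : (Fin d → ℝ) × ℝ => (ψ p.1 * deriv θ (p.1 ⬝ᵥ v)) * p.2) ν := by
    have h1 : Integrable (fun c : Fin d → ℝ => ψ c * deriv θ (c ⬝ᵥ v)) μ := by
      refine (hμ.integrable_one_add.const_mul B).mono' ?_
        (Filter.Eventually.of_forall fun p => ?_)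
      · refine (hψ.mul (hθc'.measurable.comp ?_)).aestronglyMeasurable
        unfold dotProduct; fun_prop
      · rw [norm_mul, mul_comm]
        exact mul_le_mul (h.bound' _) (hψ1 _) (norm_nonneg _) hB
    exact h1.mul_prod (by simpa using integrable_pow_gaussianReal 1)
  have hlin0 : ∫ p : (Fin d → ℝ) × ℝ, (ψ p.1 * deriv θ (p.1 ⬝ᵥ v)) * p.2 ∂ν = 0 := by
    rw [integral_prod_mul (fun c : Fin d → ℝ => ψ c * deriv θ (c ⬝ᵥ v)) (fun e : ℝ => e)]
    simp
  set σ := √s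
  set σ' := √s'
  -- Here `√s ^ 2 = max s 0`, so no sign of `s` is needed. This allows the matrix equation to be
  -- solved before `z ≥ 0` is known.
  have hσ : |σ ^ 2 - σ' ^ 2| ≤ |s - s'| := by
    simp only [σ, σ', Real.sq_sqrt']
    exact abs_max_sub_max_le_abs _ _ _
  have hi2 : Integrable (fun p : (Fin d → ℝ) × ℝ =>
      ψ p.1 * θ (p.1 ⬝ᵥ v + p.2 * σ) - ψ p.1 * θ (p.1 ⬝ᵥ v' + p.2 * σ')) ν := (hi v σ).sub (hi v' σ')
  have e : (bracket μ v s fun c x => ψ c * θ x) - (bracket μ v' s' fun c x => ψ c * θ x)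
      = ∫ p : (Fin d → ℝ) × ℝ, (ψ p.1 * θ (p.1 ⬝ᵥ v + p.2 * σ) - ψ p.1 * θ (p.1 ⬝ᵥ v' + p.2 * σ')
        - (σ - σ') * ((ψ p.1 * deriv θ (p.1 ⬝ᵥ v)) * p.2)) ∂ν := by
    rw [integral_sub hi2 (hlin.const_mul _), integral_const_mul, hlin0,
      mul_zero, sub_zero, integral_sub (hi v σ) (hi v' σ')]
    rfl
  rw [e]
  have hpt : ∀ p : (Fin d → ℝ) × ℝ, ‖ψ p.1 * θ (p.1 ⬝ᵥ v + p.2 * σ) - ψ p.1 * θ (p.1 ⬝ᵥ v' + p.2 * σ')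
        - (σ - σ') * ((ψ p.1 * deriv θ (p.1 ⬝ᵥ v)) * p.2)‖
      ≤ ((B * d + B) * (‖v - v'‖ + |s - s'|)) *
        ((1 + ‖p.1‖) * p.2 ^ 2 + (‖p.1‖ + ‖p.1‖ ^ 2)) := by
    intro p
    have h1 := h.scale_bound (p.1 ⬝ᵥ v) p.2 σ σ' (Real.sqrt_nonneg _) (Real.sqrt_nonneg _)
    have h2 := C2Bdd.abs_sub_le h.diff h.bound' (p.1 ⬝ᵥ v' + p.2 * σ') (p.1 ⬝ᵥ v + p.2 * σ')
    rw [add_sub_add_right_eq_sub, ← dotProduct_sub] at h2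
    have h3 := abs_dotProduct_le p.1 (v - v')
    have e1 : ψ p.1 * θ (p.1 ⬝ᵥ v + p.2 * σ) - ψ p.1 * θ (p.1 ⬝ᵥ v' + p.2 * σ')
        - (σ - σ') * ((ψ p.1 * deriv θ (p.1 ⬝ᵥ v)) * p.2)
        = ψ p.1 * ((θ (p.1 ⬝ᵥ v + p.2 * σ) - θ (p.1 ⬝ᵥ v + p.2 * σ')
          - (σ - σ') * (p.2 * deriv θ (p.1 ⬝ᵥ v)))
          + (θ (p.1 ⬝ᵥ v + p.2 * σ') - θ (p.1 ⬝ᵥ v' + p.2 * σ'))) := by ring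
    rw [e1, norm_mul, Real.norm_eq_abs, Real.norm_eq_abs]
    have hBe : 0 ≤ B * p.2 ^ 2 := by positivity
    have h4 : |(θ (p.1 ⬝ᵥ v + p.2 * σ) - θ (p.1 ⬝ᵥ v + p.2 * σ')
          - (σ - σ') * (p.2 * deriv θ (p.1 ⬝ᵥ v)))
          + (θ (p.1 ⬝ᵥ v + p.2 * σ') - θ (p.1 ⬝ᵥ v' + p.2 * σ'))|
        ≤ B * p.2 ^ 2 * |s - s'| + B * (d * (‖p.1‖ * ‖v - v'‖)) :=
      (abs_add_le _ _).trans (add_le_add (h1.trans (mul_le_mul_of_nonneg_left hσ hBe))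
        (h2.trans (mul_le_mul_of_nonneg_left h3 hB)))
    refine (mul_le_mul (hψ1 p.1) h4 (abs_nonneg _) (by positivity)).trans ?_
    have t1 : 0 ≤ B * p.2 ^ 2 * ‖v - v'‖ := by positivity
    have t2 : 0 ≤ B * d * (p.2 ^ 2 * (‖v - v'‖ + |s - s'|)) := by positivity
    have t3 : 0 ≤ B * (‖p.1‖ * (‖v - v'‖ + |s - s'|)) := by positivity
    have t4 : 0 ≤ B * d * (‖p.1‖ * |s - s'|) := by positivity
    have t5 : 0 ≤ 1 + ‖p.1‖ := by positivity
    have : B * p.2 ^ 2 * |s - s'| + B * (d * (‖p.1‖ * ‖v - v'‖))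
        ≤ (B * d + B) * (‖v - v'‖ + |s - s'|) * (p.2 ^ 2 + ‖p.1‖) := by nlinarith
    calc _ ≤ (1 + ‖p.1‖) * ((B * d + B) * (‖v - v'‖ + |s - s'|) * (p.2 ^ 2 + ‖p.1‖)) :=
          mul_le_mul_of_nonneg_left this t5
      _ = _ := by ring
  have := norm_integral_le_of_norm_le (hW.const_mul _) (Filter.Eventually.of_forall hpt)
  rw [integral_const_mul] at this
  refine this.trans (le_of_eq ?_)
  ring

end Bracket

/-! ### The macroscopic equation as a matrix equation. -/

/-- The index set of the rows and columns of the macroscopic state. -/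
abbrev MacroIdx (d : ℕ) := Fin d ⊕ Fin d ⊕ Unit

/-- Macroscopic states as functions of two indices, with the sup norm. -/
abbrev Macro (d : ℕ) := MacroIdx d → MacroIdx d → ℝ

/-- The index of the discriminator column. -/
abbrev wIdx (d : ℕ) : MacroIdx d := Sum.inr (Sum.inr ())

/-- The blocks of a macroscopic state. -/
def Macro.state {d : ℕ} (M : Macro d) : MacroState d where
  P := Matrix.of fun i j => M (Sum.inl i) (Sum.inr (Sum.inl j))
  q := fun i => M (Sum.inl i) (wIdx d)
  r := fun i => M (Sum.inr (Sum.inl i)) (wIdx d)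
  S := Matrix.of fun i j => M (Sum.inr (Sum.inl i)) (Sum.inr (Sum.inl j))
  z := M (wIdx d) (wIdx d)

/-- The matrix `B` for which `X * B` is the noiseless part of the update direction of
`X = [U, V, w]`. -/
def genMat {d : ℕ} (tau taut : ℝ) (g g1 g2 l : Fin d → ℝ) (h : ℝ) : Macro d
  | _, Sum.inl _ => 0
  | Sum.inl _, Sum.inr (Sum.inl _) => 0
  | Sum.inr (Sum.inl i), Sum.inr (Sum.inl j) => if i = j then taut * l j else 0
  | Sum.inr (Sum.inr _), Sum.inr (Sum.inl j) => taut * g2 j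
  | Sum.inl i, Sum.inr (Sum.inr _) => tau * g i
  | Sum.inr (Sum.inl i), Sum.inr (Sum.inr _) => -(tau * g1 i)
  | Sum.inr (Sum.inr _), Sum.inr (Sum.inr _) => tau * h

namespace GANModel

variable {d : ℕ} (G : GANModel d)

/-- The diagonal of `L`. -/
noncomputable def ldiag (M : Macro d) (l : Fin d) : ℝ :=
  -(G.lam * deriv G.H (M (Sum.inr (Sum.inl l)) (Sum.inr (Sum.inl l))))

/-- The averaged generator of the macroscopic dynamics. -/
noncomputable def meanGen (M : Macro d) : Macro d :=
  genMat G.tau G.taut (G.g M.state) (G.gt M.state) (G.gt M.state) (G.ldiag M) (G.h M.state)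

/-- The drift of the macroscopic state, `M B + Bᵀ M + τ² b e eᵀ`. -/
noncomputable def macroDrift (M : Macro d) : Macro d := fun i j =>
  ∑ k, M i k * G.meanGen M k j + ∑ k, M k j * G.meanGen M k i
    + if i = wIdx d ∧ j = wIdx d then G.tau ^ 2 * G.b M.state else 0

/-- The regularity of the data of the model that the proofs use. -/
structure Regular (B : ℝ) : Prop where
  prob_c : IsProbabilityMeasure G.Pc
  prob_ct : IsProbabilityMeasure G.Pct
  moments_c : HasAllMoments G.Pc
  moments_ct : HasAllMoments G.Pct
  etaT_nonneg : 0 ≤ G.etaT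
  etaG_nonneg : 0 ≤ G.etaG
  f_bdd : C2Bdd G.f B
  f_bdd' : C2Bdd (deriv G.f) B
  ft_bdd : C2Bdd G.ft B
  ft_bdd' : C2Bdd (deriv G.ft) B
  diff_F : Differentiable ℝ (G.F ∘ G.D)
  diff_Ft : Differentiable ℝ (G.Ft ∘ G.D)
  diff_H : Differentiable ℝ G.H
  H_bdd : ∀ x, |deriv G.H x| ≤ B
  H_lip : LocallyLipschitz (deriv G.H)

end GANModel

/-- Order four is what `h` requires: it averages `f'`, and the Lipschitz estimate for a bracket uses
two further derivatives. -/
theorem BoundedDerivs.c2Bdd {φ : ℝ → ℝ} (h : BoundedDerivs 4 φ) :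
    Differentiable ℝ φ ∧ ∃ B, C2Bdd (deriv φ) B ∧ C2Bdd (deriv (deriv φ)) B := by
  obtain ⟨hd, hb⟩ := h
  have e1 : iteratedDeriv 1 φ = deriv φ := iteratedDeriv_one
  have e2 : iteratedDeriv 2 φ = deriv (deriv φ) := by rw [iteratedDeriv_succ, e1]
  have e3 : iteratedDeriv 3 φ = deriv (deriv (deriv φ)) := by rw [iteratedDeriv_succ, e2]
  have e4 : iteratedDeriv 4 φ = deriv (deriv (deriv (deriv φ))) := by rw [iteratedDeriv_succ, e3]
  have d0 := hd 0 (by norm_num)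
  have d1 := hd 1 (by norm_num)
  have d2 := hd 2 (by norm_num)
  have d3 := hd 3 (by norm_num)
  obtain ⟨B1, b1⟩ := hb 1 (by simp)
  obtain ⟨B2, b2⟩ := hb 2 (by simp)
  obtain ⟨B3, b3⟩ := hb 3 (by simp)
  obtain ⟨B4, b4⟩ := hb 4 (by simp)
  rw [iteratedDeriv_zero] at d0
  rw [e1] at d1 b1
  rw [e2] at d2 b2
  rw [e3] at d3 b3
  rw [e4] at b4
  have p1 := (abs_nonneg _).trans (b1 0)
  have p2 := (abs_nonneg _).trans (b2 0)
  have p3 := (abs_nonneg _).trans (b3 0)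
  have p4 := (abs_nonneg _).trans (b4 0)
  refine ⟨d0, B1 + B2 + B3 + B4, ⟨d1, d2, fun x => ?_, fun x => ?_, fun x => ?_⟩,
    ⟨d2, d3, fun x => ?_, fun x => ?_, fun x => ?_⟩⟩
  · linarith [b1 x]
  · linarith [b2 x]
  · linarith [b3 x]
  · linarith [b2 x]
  · linarith [b3 x]
  · linarith [b4 x]

/-! ### Regularity of the drift. -/

section

variable {d : ℕ}

theorem SemiLip.coord (i j : MacroIdx d) : SemiLip fun M : Macro d => M i j :=
  SemiLip.of_lipschitz (K := 1) fun x y => by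
    rw [one_mul, ← Pi.sub_apply, ← Pi.sub_apply]
    exact (norm_le_pi_norm _ j).trans (norm_le_pi_norm (y - x) i)

theorem abs_coord_le (M : Macro d) (i j : MacroIdx d) : |M i j| ≤ ‖M‖ :=
  (norm_le_pi_norm _ j).trans (norm_le_pi_norm M i)

theorem bddSemiLip_bracket {μ : Measure (Fin d → ℝ)} [IsProbabilityMeasure μ]
    (hμ : HasAllMoments μ) {θ : ℝ → ℝ} {B : ℝ} (h : C2Bdd θ B) {ψ : (Fin d → ℝ) → ℝ}
    (hψ : Measurable ψ) (hψ1 : ∀ c, |ψ c| ≤ 1 + ‖c‖) (η : ℝ) {v : Macro d → Fin d → ℝ}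
    {z : Macro d → ℝ} (hv : ∀ x y, ‖v y - v x‖ ≤ ‖y - x‖) (hz : ∀ x y, |z y - z x| ≤ ‖y - x‖) :
    BddSemiLip fun M : Macro d => bracket μ (v M) (z M * η) fun c x => ψ c * θ x := by
  refine ⟨⟨_, fun M => bracket_bound hμ h.bound hψ1 _ _⟩, ?_⟩
  obtain ⟨K, hK, hK'⟩ := bracket_lipschitz hμ h hψ hψ1
  refine SemiLip.of_lipschitz (K := K * (1 + |η|)) fun x y => (hK' _ _ _ _).trans ?_
  rw [mul_assoc]
  refine mul_le_mul_of_nonneg_left ?_ hK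
  rw [← sub_mul, abs_mul, one_add_mul, mul_comm |η|]
  exact add_le_add (hv x y) (mul_le_mul_of_nonneg_right (hz x y) (abs_nonneg η))

theorem norm_pi_sub_le_of_coord {v : Macro d → Fin d → ℝ} {i : Fin d → MacroIdx d} {j : MacroIdx d}
    (hv : ∀ M l, v M l = M (i l) j) (x y : Macro d) : ‖v y - v x‖ ≤ ‖y - x‖ := by
  rw [pi_norm_le_iff_of_nonneg (norm_nonneg _)]
  intro l
  rw [Pi.sub_apply, hv, hv]
  exact abs_coord_le (y - x) (i l) j

namespace GANModel

variable {G : GANModel d} {B : ℝ}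

namespace Regular

theorem bddSemiLip_Hderiv (hG : G.Regular B) (i : MacroIdx d) :
    BddSemiLip fun M : Macro d => deriv G.H (M i i) :=
  (BddSemiLip.of_locallyLipschitz hG.H_bdd hG.H_lip).comp_nonexpansive
    (π := fun M : Macro d => M i i) (fun x => abs_coord_le x i i)
    (fun x y => abs_coord_le (y - x) i i)

theorem abs_coord_le_one_add (l : Fin d) (c : Fin d → ℝ) : |c l| ≤ 1 + ‖c‖ :=
  (norm_le_pi_norm c l).trans (by linarith)

theorem bddSemiLip_bracket_c (hG : G.Regular B) {θ : ℝ → ℝ} {B' : ℝ} (h : C2Bdd θ B')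
    {ψ : (Fin d → ℝ) → ℝ} (hψ : Measurable ψ) (hψ1 : ∀ c, |ψ c| ≤ 1 + ‖c‖) :
    BddSemiLip fun M : Macro d =>
      bracket G.Pc M.state.q (M.state.z * G.etaT) fun c x => ψ c * θ x :=
  have := hG.prob_c
  bddSemiLip_bracket hG.moments_c h hψ hψ1 _
    (norm_pi_sub_le_of_coord (i := Sum.inl) (j := wIdx d) fun _ _ => rfl)
    (fun x y => abs_coord_le (y - x) (wIdx d) (wIdx d))

theorem bddSemiLip_bracket_ct (hG : G.Regular B) {θ : ℝ → ℝ} {B' : ℝ} (h : C2Bdd θ B')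
    {ψ : (Fin d → ℝ) → ℝ} (hψ : Measurable ψ) (hψ1 : ∀ c, |ψ c| ≤ 1 + ‖c‖) :
    BddSemiLip fun M : Macro d =>
      bracket G.Pct M.state.r (M.state.z * G.etaG) fun c x => ψ c * θ x :=
  have := hG.prob_ct
  bddSemiLip_bracket hG.moments_ct h hψ hψ1 _
    (norm_pi_sub_le_of_coord (i := fun i => Sum.inr (Sum.inl i)) (j := wIdx d) fun _ _ => rfl)
    (fun x y => abs_coord_le (y - x) (wIdx d) (wIdx d))

theorem bddSemiLip_g (hG : G.Regular B) (l : Fin d) :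
    BddSemiLip fun M : Macro d => G.g M.state l :=
  hG.bddSemiLip_bracket_c hG.f_bdd (measurable_pi_apply l) (abs_coord_le_one_add l)

theorem bddSemiLip_gt (hG : G.Regular B) (l : Fin d) :
    BddSemiLip fun M : Macro d => G.gt M.state l :=
  hG.bddSemiLip_bracket_ct hG.ft_bdd (measurable_pi_apply l) (abs_coord_le_one_add l)

theorem bddSemiLip_h (hG : G.Regular B) : BddSemiLip fun M : Macro d => G.h M.state := by
  have h1 := hG.bddSemiLip_bracket_c hG.f_bdd' (ψ := fun _ => 1) measurable_const (by simp)
  have h2 := hG.bddSemiLip_bracket_ct hG.ft_bdd' (ψ := fun _ => 1) measurable_const (by simp)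
  simp only [one_mul] at h1 h2
  have h3 := ((h1.const_mul G.etaT).add (h2.const_mul G.etaG).neg).add
    ((hG.bddSemiLip_Hderiv (wIdx d)).const_mul G.lam).neg
  refine Eq.mp (congrArg BddSemiLip (funext fun M => ?_)) h3
  simp only [h, sub_eq_add_neg, Macro.state]

theorem bddSemiLip_b (hG : G.Regular B) : BddSemiLip fun M : Macro d => G.b M.state := by
  have h1 := hG.bddSemiLip_bracket_c hG.f_bdd.sq (ψ := fun _ => 1) measurable_const (by simp)
  have h2 := hG.bddSemiLip_bracket_ct hG.ft_bdd.sq (ψ := fun _ => 1) measurable_const (by simp)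
  simp only [one_mul] at h1 h2
  exact (h1.const_mul G.etaT).add (h2.const_mul G.etaG)

theorem bddSemiLip_meanGen (hG : G.Regular B) (i j : MacroIdx d) :
    BddSemiLip fun M : Macro d => G.meanGen M i j := by
  rcases i with i | i | i <;> rcases j with j | j | j <;> simp only [meanGen, genMat]
  · exact BddSemiLip.const 0
  · exact BddSemiLip.const 0
  · exact (hG.bddSemiLip_g i).const_mul _
  · exact BddSemiLip.const 0
  · split_ifs
    · exact (((hG.bddSemiLip_Hderiv (Sum.inr (Sum.inl j))).const_mul G.lam).neg).const_mul G.taut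
    · exact BddSemiLip.const 0
  · exact ((hG.bddSemiLip_gt i).const_mul _).neg
  · exact BddSemiLip.const 0
  · exact (hG.bddSemiLip_gt j).const_mul _
  · exact hG.bddSemiLip_h.const_mul _

/-- Each entry is a sum of coordinates times bounded semi-Lipschitz functions, plus a bounded term.
This is the only property of the drift used for existence, uniqueness and stability. -/
theorem semiLip_macroDrift (hG : G.Regular B) : SemiLip G.macroDrift := by
  refine SemiLip.pi fun i => SemiLip.pi fun j => ?_
  refine ((SemiLip.sum _ fun k _ => (SemiLip.coord i k).mul_bdd (hG.bddSemiLip_meanGen k j)).add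
    (SemiLip.sum _ fun k _ => (SemiLip.coord k j).mul_bdd (hG.bddSemiLip_meanGen k i))).add ?_
  split_ifs
  · exact (hG.bddSemiLip_b.const_mul _).2
  · exact (BddSemiLip.const 0).2

end Regular

end GANModel

end

/-! ### Matrix equation and block equations. -/

section MatrixODE

variable {d : ℕ} {G : GANModel d}

/-- The properties of the macroscopic states `Xᵀ X` of `X = [U, V, w]` with `Uᵀ U = 1`. -/
structure Macro.IsGood (M : Macro d) : Prop where
  symm : ∀ i j, M i j = M j i
  one : ∀ i j, M (Sum.inl i) (Sum.inl j) = (1 : Matrix (Fin d) (Fin d) ℝ) i j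
  nonneg : 0 ≤ M (wIdx d) (wIdx d)

/-- Closedness carries these properties from Gram matrices to their limits. -/
theorem Macro.isClosed_isGood : IsClosed {M : Macro d | M.IsGood} := by
  have e : {M : Macro d | M.IsGood} = (⋂ i, ⋂ j, {M | M i j = M j i}) ∩
      ((⋂ i, ⋂ j, {M | M (Sum.inl i) (Sum.inl j) = (1 : Matrix (Fin d) (Fin d) ℝ) i j}) ∩
        {M | 0 ≤ M (wIdx d) (wIdx d)}) := by
    ext M
    simp only [Set.mem_ofPred_eq, Set.mem_inter_iff, Set.mem_iInter]
    exact ⟨fun h => ⟨h.symm, h.one, h.nonneg⟩, fun h => ⟨h.1, h.2.1, h.2.2⟩⟩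
  rw [e]
  have hc : ∀ i j, Continuous fun M : Macro d => M i j := fun i j => by fun_prop
  refine (isClosed_iInter fun i => isClosed_iInter fun j => isClosed_eq (hc _ _) (hc _ _)).inter
    ((isClosed_iInter fun i => isClosed_iInter fun j =>
      isClosed_eq (hc _ _) continuous_const).inter (isClosed_le continuous_const (hc _ _)))

theorem Macro.IsGood.toMatrix_state {M : Macro d} (h : M.IsGood) (i j : MacroIdx d) :
    M.state.toMatrix i j = M i j := by
  rcases i with i | i | i <;> rcases j with j | j | j <;>
    simp [MacroState.toMatrix, Macro.state, h.one, h.symm]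

theorem MacroState.state_toMatrix (m : MacroState d) : Macro.state m.toMatrix = m := by
  cases m
  simp only [Macro.state, MacroState.toMatrix, MacroState.mk.injEq]
  refine ⟨?_, ?_, ?_, ?_, ?_⟩ <;> (try ext) <;> simp

/-- Block multiplication. The correction removes the `1` that `toMatrix` puts into the first corner
of every tuple, even of a derivative. Symmetry of `S` is needed because the entries below the
diagonal produce `Sᵀ g̃` where the block system has `S g̃`. -/
theorem macroDrift_toMatrix (G : GANModel d) (m : MacroState d) (hS : ∀ i j, m.S i j = m.S j i)
    (i j : MacroIdx d) : G.macroDrift m.toMatrix i j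
      = (G.drift m).toMatrix i j - fromBlocks (1 : Matrix (Fin d) (Fin d) ℝ) 0 0
        (0 : Matrix (Fin d ⊕ Unit) (Fin d ⊕ Unit) ℝ) i j := by
  have hld : ∀ l, G.ldiag m.toMatrix l = -(G.lam * deriv G.H (m.S l l)) := by
    intro l; simp [GANModel.ldiag, MacroState.toMatrix]
  rcases i with i | i | i <;> rcases j with j | j | j <;>
    simp only [GANModel.macroDrift, Fintype.sum_sum_type, GANModel.meanGen, genMat,
      MacroState.state_toMatrix, hld, Finset.univ_unique, Finset.sum_singleton, mul_ite, mul_zero,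
      Finset.sum_ite_eq', Finset.mem_univ, if_true, Finset.sum_const_zero,
      reduceCtorEq, and_false, false_and, if_false, add_zero, zero_add, Sum.inr.injEq] <;>
    simp [MacroState.toMatrix, GANModel.drift, GANModel.L, vecMulVec_apply, mulVec,
      dotProduct, mul_apply, diagonal_apply, one_apply, Finset.mul_sum, mul_add, mul_sub]
  all_goals first
    | ring1
    | (simp only [mul_assoc, mul_left_comm _ G.tau, ← Finset.mul_sum]; ring1)
    | (simp only [hS _ j, mul_assoc, mul_left_comm _ G.tau, ← Finset.mul_sum]; ring1)

theorem isODESolution_of_macroDrift {T : ℝ} {M : ℝ → Macro d}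
    (hM : ∀ t ∈ Set.Icc 0 T, HasDerivWithinAt M (G.macroDrift (M t)) (Set.Icc 0 T) t)
    (hg : ∀ t ∈ Set.Icc 0 T, (M t).IsGood) : G.IsODESolution T fun t => (M t).state := by
  have hd : ∀ t ∈ Set.Icc 0 T, ∀ i j, HasDerivWithinAt (fun s => M s i j)
      ((G.drift (M t).state).toMatrix i j - fromBlocks (1 : Matrix (Fin d) (Fin d) ℝ) 0 0
        (0 : Matrix (Fin d ⊕ Unit) (Fin d ⊕ Unit) ℝ) i j) (Set.Icc 0 T) t := by
    intro t ht i j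
    have h1 := hasDerivWithinAt_pi.1 (hasDerivWithinAt_pi.1 (hM t ht) i) j
    have e : G.macroDrift (M t) i j = G.macroDrift (M t).state.toMatrix i j := by
      have : M t = (M t).state.toMatrix :=
        funext fun i => funext fun j => ((hg t ht).toMatrix_state i j).symm
      exact congrArg (fun A : Macro d => G.macroDrift A i j) this
    rw [e, macroDrift_toMatrix G _ fun i j => (hg t ht).symm _ _] at h1
    exact h1
  refine ⟨fun t ht => (hg t ht).nonneg, fun t ht i j => ?_, fun t ht i => ?_, fun t ht i => ?_,
    fun t ht i j => ?_, fun t ht => ?_⟩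
  · simpa [MacroState.toMatrix, Macro.state] using hd t ht (Sum.inl i) (Sum.inr (Sum.inl j))
  · simpa [MacroState.toMatrix, Macro.state] using hd t ht (Sum.inl i) (wIdx d)
  · simpa [MacroState.toMatrix, Macro.state] using hd t ht (Sum.inr (Sum.inl i)) (wIdx d)
  · simpa [MacroState.toMatrix, Macro.state] using hd t ht (Sum.inr (Sum.inl i)) (Sum.inr (Sum.inl j))
  · simpa [MacroState.toMatrix, Macro.state] using hd t ht (wIdx d) (wIdx d)

/-- The rank-one terms are symmetric together and `L` is diagonal, so `S i j - S j i` solves a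
homogeneous linear equation with bounded coefficient. A competing solution in the uniqueness claim
is known to be symmetric only at time zero. -/
theorem symm_of_isODESolution {B : ℝ} (hG : G.Regular B) {T : ℝ} {m : ℝ → MacroState d}
    (hm : G.IsODESolution T m) (h0 : ∀ i j, (m 0).S i j = (m 0).S j i) :
    ∀ t ∈ Set.Icc 0 T, ∀ i j, (m t).S i j = (m t).S j i := by
  intro t ht i j
  have hB : 0 ≤ B := hG.f_bdd.nonneg
  have hd : ∀ t ∈ Set.Icc 0 T, HasDerivWithinAt (fun s => (m s).S i j - (m s).S j i)
      (-(G.taut * G.lam * (deriv G.H ((m t).S i i) + deriv G.H ((m t).S j j)))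
        * ((m t).S i j - (m t).S j i)) (Set.Icc 0 T) t := by
    intro t ht
    refine ((hm.deriv_S t ht i j).sub (hm.deriv_S t ht j i)).congr_deriv ?_
    simp [GANModel.drift, GANModel.L, vecMulVec_apply, mul_apply, diagonal_apply]
    ring
  have := eq_zero_of_abs_deriv_le_mul_abs_self_of_eq_zero_right
    (K := |G.taut * G.lam| * (B + B))
    (fun t ht => (hd t ht).continuousWithinAt)
    (fun t ht => (hd t (Set.Ico_subset_Icc_self ht)).Ici_of_Icc ht) (by simp [h0 i j])
    (fun t ht => by
      rw [norm_mul, norm_neg, Real.norm_eq_abs (_ * (_ + _)), abs_mul _ (_ + _)]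
      gcongr
      exact (abs_add_le _ _).trans (add_le_add (hG.H_bdd _) (hG.H_bdd _))) t ht
  exact sub_eq_zero.1 this

theorem macroDrift_of_isODESolution {B : ℝ} (hG : G.Regular B) {T : ℝ} {m : ℝ → MacroState d}
    (hm : G.IsODESolution T m) (h0 : ∀ i j, (m 0).S i j = (m 0).S j i) :
    ∀ t ∈ Set.Icc 0 T, HasDerivWithinAt (fun s => ((m s).toMatrix : Macro d))
      (G.macroDrift (m t).toMatrix) (Set.Icc 0 T) t := by
  intro t ht
  have hS := symm_of_isODESolution hG hm h0
  refine hasDerivWithinAt_pi.2 fun i => hasDerivWithinAt_pi.2 fun j => ?_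
  rw [macroDrift_toMatrix G _ (hS t ht)]
  rcases i with i | i | i <;> rcases j with j | j | j
  · simpa [MacroState.toMatrix] using hasDerivWithinAt_const t (Set.Icc 0 T) _
  · simpa [MacroState.toMatrix] using hm.deriv_P t ht i j
  · simpa [MacroState.toMatrix] using hm.deriv_q t ht i
  · simpa [MacroState.toMatrix] using hm.deriv_P t ht j i
  · simpa [MacroState.toMatrix] using hm.deriv_S t ht i j
  · simpa [MacroState.toMatrix] using hm.deriv_r t ht i
  · simpa [MacroState.toMatrix] using hm.deriv_q t ht j
  · simpa [MacroState.toMatrix] using hm.deriv_r t ht j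
  · simpa [MacroState.toMatrix] using hm.deriv_z t ht

end MatrixODE

/-! ### One training step as right multiplication plus noise. -/

section Step

variable {d n : ℕ} {G : GANModel d}

/-- One sample: a latent vector and a background noise. -/
abbrev Sample (n d : ℕ) := (Fin d → ℝ) × (Fin n → ℝ)

/-- The Gram matrix `Xᵀ X`. -/
def overlap (X : Matrix (Fin n) (MacroIdx d) ℝ) : Macro d := fun i j => ∑ k, X k i * X k j

namespace GANModel

variable (G)

/-- The argument `yᵀ w` of the discriminator at a real sample. -/
noncomputable def realArg (X : Matrix (Fin n) (MacroIdx d) ℝ) (s : Sample n d) : ℝ :=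
  s.1 ⬝ᵥ (overlap X).state.q + √G.etaT * (s.2 ⬝ᵥ fun i => X i (wIdx d))

/-- The argument `ỹᵀ w` of the discriminator at a fake sample. -/
noncomputable def fakeArg (X : Matrix (Fin n) (MacroIdx d) ℝ) (s : Sample n d) : ℝ :=
  s.1 ⬝ᵥ (overlap X).state.r + √G.etaG * (s.2 ⬝ᵥ fun i => X i (wIdx d))

/-- The random generator of one step. -/
noncomputable def stepGen (X : Matrix (Fin n) (MacroIdx d) ℝ)
    (ξ : Sample n d × Sample n d × Sample n d) : Macro d :=
  genMat G.tau G.taut (fun l => ξ.1.1 l * G.f (G.realArg X ξ.1))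
    (fun l => ξ.2.1.1 l * G.ft (G.fakeArg X ξ.2.1))
    (fun l => ξ.2.2.1 l * G.ft (G.fakeArg X ξ.2.2))
    (G.ldiag (overlap X)) (-(G.lam * deriv G.H (overlap X (wIdx d) (wIdx d))))

/-- The contribution of the background noises to the discriminator's update. -/
noncomputable def stepNoise (X : Matrix (Fin n) (MacroIdx d) ℝ)
    (ξ : Sample n d × Sample n d × Sample n d) (i : Fin n) : ℝ :=
  √G.etaT * G.f (G.realArg X ξ.1) * ξ.1.2 i - √G.etaG * G.ft (G.fakeArg X ξ.2.1) * ξ.2.1.2 i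

/-- `n` times the increment of one step. -/
noncomputable def stepDir (X : Matrix (Fin n) (MacroIdx d) ℝ)
    (ξ : Sample n d × Sample n d × Sample n d) : Matrix (Fin n) (MacroIdx d) ℝ :=
  X * Matrix.of (G.stepGen X ξ)
    + Matrix.of fun i j => if j = wIdx d then G.tau * G.stepNoise X ξ i else 0

/-- The inputs of the `k`-th step. -/
def _root_.TrainingData.input {Ω : Type*} (X : TrainingData n d Ω) (k : ℕ) (ω : Ω) :
    Sample n d × Sample n d × Sample n d :=
  ((X.c k ω, X.a k ω), (X.ct (2 * k) ω, X.atil (2 * k) ω),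
    (X.ct (2 * k + 1) ω, X.atil (2 * k + 1) ω))

variable {G}

theorem hasDerivAt_comp_of_line {θ p : ℝ → ℝ} {p' x : ℝ} (hθ : Differentiable ℝ θ)
    (hp : HasDerivAt p p' 0) (hx : p 0 = x) :
    HasDerivAt (fun t => θ (p t)) (deriv θ x * p') 0 := by
  subst hx
  exact (hθ (p 0)).hasDerivAt.comp 0 hp

theorem vecGrad_loss {B : ℝ} (hG : G.Regular B) (y yt w : Fin n → ℝ)
    (V : Matrix (Fin n) (Fin d) ℝ) (i : Fin n) :
    vecGrad (fun w' => G.loss y yt w' V) w i = G.f (y ⬝ᵥ w) * y i - G.ft (yt ⬝ᵥ w) * yt i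
      - G.lam * deriv G.H (w ⬝ᵥ w) * w i := by
  have hl : ∀ u : Fin n → ℝ, HasDerivAt (fun t : ℝ => u ⬝ᵥ (w + t • Pi.single i 1)) (u i) 0 := by
    intro u
    have : ∀ t : ℝ, u ⬝ᵥ (w + t • Pi.single i 1) = u ⬝ᵥ w + t * u i := by
      intro t; rw [dotProduct_add, dotProduct_smul, dotProduct_single_one, smul_eq_mul]
    simp only [this]
    simpa using ((hasDerivAt_id (0:ℝ)).mul_const (u i)).const_add (u ⬝ᵥ w)
  have hq : HasDerivAt (fun t : ℝ => (w + t • Pi.single i 1) ⬝ᵥ (w + t • Pi.single i (1:ℝ)))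
      (2 * w i) 0 := by
    have : ∀ t : ℝ, (w + t • Pi.single i 1) ⬝ᵥ (w + t • Pi.single i (1:ℝ))
        = w ⬝ᵥ w + t * (2 * w i) + t ^ 2 := by
      intro t
      simp only [dotProduct_add, add_dotProduct, dotProduct_smul, smul_dotProduct,
        dotProduct_single_one, single_one_dotProduct, smul_eq_mul, Pi.add_apply, Pi.smul_apply,
        Pi.single_eq_same]
      ring
    simp only [this]
    have := (((hasDerivAt_id (0:ℝ)).mul_const (2 * w i)).const_add (w ⬝ᵥ w)).fun_add
      (hasDerivAt_pow 2 (0:ℝ))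
    simpa using this
  have h1 := hasDerivAt_comp_of_line hG.diff_F (hl y) (x := y ⬝ᵥ w) (by simp)
  have h2 := hasDerivAt_comp_of_line hG.diff_Ft (hl yt) (x := yt ⬝ᵥ w) (by simp)
  have h3 := hasDerivAt_comp_of_line hG.diff_H hq (x := w ⬝ᵥ w) (by simp)
  have h := ((h1.sub h2).sub (h3.const_mul (G.lam / 2))).add_const
    (G.lam / 2 * ((Vᵀ * V).map G.H).trace)
  simp only [vecGrad, lineDeriv]
  refine (h.deriv.trans ?_)
  simp only [f, ft]
  ring

/-- The background noise does not depend on `V` and enters only through the argument of `f̃`. So the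
gradient is a multiple of `w cᵀ` plus rescaled columns of `V`, without a separate noise vector. -/
theorem matGrad_loss {B : ℝ} (hG : G.Regular B) (y w : Fin n → ℝ) (c : Fin d → ℝ) (a : Fin n → ℝ)
    (η : ℝ) (V : Matrix (Fin n) (Fin d) ℝ) (i : Fin n) (l : Fin d) :
    matGrad (fun V' => G.loss y (generate c a V' η) w V') V i l
      = -(G.ft (generate c a V η ⬝ᵥ w) * (c l * w i))
        + G.lam * deriv G.H ((Vᵀ * V) l l) * V i l := by
  have hgen : HasDerivAt (fun t : ℝ => generate c a (V + t • Matrix.single i l 1) η ⬝ᵥ w)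
      (c l * w i) 0 := by
    have : ∀ t : ℝ, generate c a (V + t • Matrix.single i l 1) η ⬝ᵥ w
        = generate c a V η ⬝ᵥ w + t * (c l * w i) := by
      intro t
      simp only [generate, add_mulVec, add_dotProduct, smul_mulVec, smul_dotProduct,
        single_mulVec, one_mul, smul_eq_mul]
      rw [show Function.update (0 : Fin n → ℝ) i (c l) = Pi.single i (c l) from rfl,
        single_dotProduct]
      ring
    simp only [this]
    simpa using ((hasDerivAt_id (0:ℝ)).mul_const (c l * w i)).const_add (generate c a V η ⬝ᵥ w)
  have hq : ∀ j, HasDerivAt (fun t : ℝ =>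
      ((V + t • Matrix.single i l 1)ᵀ * (V + t • Matrix.single i l 1) :
        Matrix (Fin d) (Fin d) ℝ) j j)
      (if j = l then 2 * V i l else 0) 0 := by
    intro j
    have : ∀ t : ℝ, ((V + t • Matrix.single i l 1)ᵀ * (V + t • Matrix.single i l 1) :
        Matrix (Fin d) (Fin d) ℝ) j j
        = (Vᵀ * V) j j + (t * (if j = l then 2 * V i l else 0) + if j = l then t ^ 2 else 0) := by
      intro t
      by_cases hj : j = l
      · subst hj
        simp only [mul_apply, transpose_apply, Matrix.add_apply, Matrix.smul_apply, single_apply,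
          and_true,
          smul_eq_mul, mul_ite, mul_one, mul_zero, add_mul, mul_add, ite_mul, zero_mul,
          Finset.sum_add_distrib, Finset.sum_ite_eq, Finset.mem_univ, if_true]
        ring
      · simp [mul_apply, hj, Ne.symm hj]
    simp only [this]
    have h2 : HasDerivAt (fun t : ℝ => if j = l then t ^ 2 else 0) 0 0 := by
      split_ifs
      · simpa using hasDerivAt_pow 2 (0:ℝ)
      · exact hasDerivAt_const _ _
    have := ((((hasDerivAt_id (0:ℝ)).mul_const (if j = l then 2 * V i l else 0))).fun_add
      h2).const_add ((Vᵀ * V) j j)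
    simpa using this
  have h2 := hasDerivAt_comp_of_line hG.diff_Ft hgen (x := generate c a V η ⬝ᵥ w) (by simp)
  have h3 := HasDerivAt.fun_sum (u := Finset.univ) fun j _ =>
    hasDerivAt_comp_of_line hG.diff_H (hq j) (x := (Vᵀ * V) j j) (by simp)
  have h := ((((hasDerivAt_const (0:ℝ) (G.F (G.D (y ⬝ᵥ w)))).sub h2).sub_const
    (G.lam / 2 * G.H (w ⬝ᵥ w))).add (h3.const_mul (G.lam / 2)))
  simp only [matGrad, lineDeriv, Matrix.of_apply]
  refine (h.deriv.trans ?_)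
  simp only [ft, mul_ite, mul_zero, Finset.sum_ite_eq', Finset.mem_univ, if_true]
  ring

theorem realArg_fromCols (U V : Matrix (Fin n) (Fin d) ℝ) (w : Fin n → ℝ) (s : Sample n d) :
    G.realArg (fromCols U (fromCols V (replicateCol Unit w))) s
      = generate s.1 s.2 U G.etaT ⬝ᵥ w := by
  rw [generate, add_dotProduct, smul_dotProduct, dotProduct_comm (U *ᵥ s.1), dotProduct_mulVec,
    dotProduct_comm (w ᵥ* U)]
  simp [realArg, overlap, Macro.state, dotProduct, vecMul, mul_comm]

theorem fakeArg_fromCols (U V : Matrix (Fin n) (Fin d) ℝ) (w : Fin n → ℝ) (s : Sample n d) :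
    G.fakeArg (fromCols U (fromCols V (replicateCol Unit w))) s
      = generate s.1 s.2 V G.etaG ⬝ᵥ w := by
  rw [generate, add_dotProduct, smul_dotProduct, dotProduct_comm (V *ᵥ s.1), dotProduct_mulVec,
    dotProduct_comm (w ᵥ* V)]
  simp [fakeArg, overlap, Macro.state, dotProduct, vecMul, mul_comm]

/-- Both gradients are combinations of the columns of `X`, except for the noise of the samples in
the column of `w`. This is why the Gram matrix obeys an approximately closed recursion. -/
theorem micro_succ {B : ℝ} (hG : G.Regular B) {Ω : Type*} (X : TrainingData n d Ω) (k : ℕ) (ω : Ω) :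
    G.micro X (k + 1) ω
      = G.micro X k ω + (n : ℝ)⁻¹ • G.stepDir (G.micro X k ω) (X.input k ω) := by
  ext i j
  simp only [micro, params]
  generalize (G.params X ω k).1 = V
  generalize (G.params X ω k).2 = w
  have hz : overlap (fromCols (X.U ω) (fromCols V (replicateCol Unit w))) (wIdx d) (wIdx d)
      = w ⬝ᵥ w := by simp [overlap, dotProduct]
  have hS : ∀ l, overlap (fromCols (X.U ω) (fromCols V (replicateCol Unit w)))
      (Sum.inr (Sum.inl l)) (Sum.inr (Sum.inl l)) = (Vᵀ * V) l l := by
    intro l; simp [overlap, mul_apply]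
  rcases j with j | j | j
  · simp [stepDir, mul_apply, stepGen, genMat]
  · simp [stepDir, mul_apply, stepGen, genMat, ldiag, matGrad_loss hG, hz, hS, fakeArg_fromCols,
      realArg_fromCols, TrainingData.input]
    ring
  · simp [stepDir, mul_apply, stepGen, genMat, ldiag, vecGrad_loss hG, hz, hS, fakeArg_fromCols,
      realArg_fromCols, TrainingData.input, stepNoise, generate, mulVec, dotProduct]
    have e : ∀ (u c : Fin d → ℝ) (p : ℝ), ∑ l, u l * (G.tau * (c l * p))
        = G.tau * p * ∑ l, u l * c l := by
      intro u c p
      rw [Finset.mul_sum]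
      exact Finset.sum_congr rfl fun l _ => by ring
    rw [e (X.U ω i) (X.c k ω), e (V i) (X.ct (2 * k) ω)]
    ring

end GANModel

end Step

/-! ### Increments of the Gram matrix: deterministic estimates. -/

section StepAlgebra

variable {d n : ℕ}

/-- The sum of the squares of the entries of the state. -/
def energy (X : Matrix (Fin n) (MacroIdx d) ℝ) : ℝ := ∑ k, ∑ i, X k i ^ 2

theorem energy_nonneg (X : Matrix (Fin n) (MacroIdx d) ℝ) : 0 ≤ energy X :=
  Finset.sum_nonneg fun _ _ => Finset.sum_nonneg fun _ _ => sq_nonneg _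

theorem energy_eq_sum_overlap (X : Matrix (Fin n) (MacroIdx d) ℝ) :
    energy X = ∑ i, overlap X i i := by
  simp only [energy, overlap]
  rw [Finset.sum_comm]
  simp [sq]

theorem overlap_symm (X : Matrix (Fin n) (MacroIdx d) ℝ) (i j : MacroIdx d) :
    overlap X i j = overlap X j i := by
  simp only [overlap, mul_comm]

theorem sum_sq_col_le_energy (X : Matrix (Fin n) (MacroIdx d) ℝ) (i : MacroIdx d) :
    ∑ k, X k i ^ 2 ≤ energy X :=
  Finset.sum_le_sum fun k _ =>
    Finset.single_le_sum (f := fun i => X k i ^ 2) (fun _ _ => sq_nonneg _) (Finset.mem_univ i)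

theorem abs_sum_mul_le_of_sum_sq {κ : Type*} [Fintype κ] {x y : κ → ℝ} {C : ℝ}
    (hx : ∑ k, x k ^ 2 ≤ C) (hy : ∑ k, y k ^ 2 ≤ C) : |∑ k, x k * y k| ≤ C := by
  have h : ∑ k, |x k * y k| ≤ ∑ k, (x k ^ 2 + y k ^ 2) / 2 :=
    Finset.sum_le_sum fun k _ => by
      rw [abs_mul]
      nlinarith [sq_nonneg (|x k| - |y k|), sq_abs (x k), sq_abs (y k)]
  rw [← Finset.sum_div, Finset.sum_add_distrib] at h
  linarith [Finset.abs_sum_le_sum_abs (fun k => x k * y k) Finset.univ]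

theorem abs_overlap_le (X : Matrix (Fin n) (MacroIdx d) ℝ) (i j : MacroIdx d) :
    |overlap X i j| ≤ energy X :=
  abs_sum_mul_le_of_sum_sq (sum_sq_col_le_energy X i) (sum_sq_col_le_energy X j)

theorem abs_sum_mul_le_card {κ : Type*} [Fintype κ] {x y : κ → ℝ} {C D : ℝ} (hC : 0 ≤ C)
    (hx : ∀ k, |x k| ≤ C) (hy : ∀ k, |y k| ≤ D) : |∑ k, x k * y k| ≤ Fintype.card κ * (C * D) := by
  refine (Finset.abs_sum_le_sum_abs _ _).trans
    ((Finset.sum_le_card_nsmul _ _ (C * D) fun k _ => ?_).trans (by simp))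
  rw [abs_mul]
  exact mul_le_mul (hx k) (hy k) (abs_nonneg _) hC

variable (X : Matrix (Fin n) (MacroIdx d) ℝ) (Bm : Macro d) (τ : ℝ) (α : Fin n → ℝ)

/-- The update direction with generator `Bm` and noise `α` in the discriminator column. -/
def updateDir : Matrix (Fin n) (MacroIdx d) ℝ :=
  X * Matrix.of Bm + Matrix.of fun i j => if j = wIdx d then τ * α i else 0

theorem updateDir_apply (k : Fin n) (j : MacroIdx d) :
    updateDir X Bm τ α k j = (∑ l, X k l * Bm l j) + if j = wIdx d then τ * α k else 0 := by
  simp [updateDir, mul_apply]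

theorem sum_mul_updateDir (i j : MacroIdx d) : ∑ k, X k i * updateDir X Bm τ α k j
    = ∑ l, overlap X i l * Bm l j + if j = wIdx d then τ * ∑ k, X k i * α k else 0 := by
  simp only [updateDir_apply, mul_add, Finset.sum_add_distrib, Finset.mul_sum, overlap,
    Finset.sum_mul]
  rw [Finset.sum_comm]
  congr 1
  · exact Finset.sum_congr rfl fun _ _ => Finset.sum_congr rfl fun _ _ => by ring
  · split_ifs
    · exact Finset.sum_congr rfl fun _ _ => by ring
    · simp

theorem overlap_add_smul (D : Matrix (Fin n) (MacroIdx d) ℝ) (ε : ℝ) (i j : MacroIdx d) :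
    overlap (X + ε • D) i j - overlap X i j
      = ε * ((∑ k, X k i * D k j) + ∑ k, X k j * D k i) + ε ^ 2 * ∑ k, D k i * D k j := by
  simp only [overlap, ← Finset.sum_sub_distrib, ← Finset.sum_add_distrib, Finset.mul_sum]
  refine Finset.sum_congr rfl fun k _ => ?_
  simp only [Matrix.add_apply, Matrix.smul_apply, smul_eq_mul]
  ring

variable {X Bm τ α} {β t : ℝ}

theorem sum_sq_mul_gen_le (hβ : ∀ i j, |Bm i j| ≤ β) (j : MacroIdx d) :
    ∑ k, (∑ l, X k l * Bm l j) ^ 2 ≤ Fintype.card (MacroIdx d) * β ^ 2 * energy X := by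
  rw [energy, Finset.mul_sum]
  refine Finset.sum_le_sum fun k _ => ?_
  refine (Finset.sum_mul_sq_le_sq_mul_sq _ _ _).trans ?_
  rw [mul_comm]
  refine mul_le_mul_of_nonneg_right ?_ (Finset.sum_nonneg fun _ _ => sq_nonneg _)
  refine (Finset.sum_le_card_nsmul _ _ (β ^ 2) fun l _ => ?_).trans (by simp)
  rw [← sq_abs]
  exact pow_le_pow_left₀ (abs_nonneg _) (hβ l j) 2

theorem abs_sum_updateDir_mul_le (hβ : ∀ i j, |Bm i j| ≤ β) (i j : MacroIdx d) :
    |∑ k, updateDir X Bm τ α k i * updateDir X Bm τ α k j|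
      ≤ 2 * (Fintype.card (MacroIdx d) * β ^ 2 * energy X) + 2 * τ ^ 2 * ∑ k, α k ^ 2 := by
  have h : ∀ j, ∑ k, updateDir X Bm τ α k j ^ 2
      ≤ 2 * (Fintype.card (MacroIdx d) * β ^ 2 * energy X) + 2 * τ ^ 2 * ∑ k, α k ^ 2 := by
    intro j
    have h1 := sum_sq_mul_gen_le (X := X) hβ j
    have h2 : ∀ k, updateDir X Bm τ α k j ^ 2
        ≤ 2 * (∑ l, X k l * Bm l j) ^ 2 + 2 * τ ^ 2 * α k ^ 2 := by
      intro k
      rw [updateDir_apply]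
      split_ifs
      · nlinarith [sq_nonneg ((∑ l, X k l * Bm l j) - τ * α k)]
      · nlinarith [sq_nonneg (∑ l, X k l * Bm l j), sq_nonneg (τ * α k)]
    have h3 := Finset.sum_le_sum fun k (_ : k ∈ Finset.univ) => h2 k
    rw [Finset.sum_add_distrib, ← Finset.mul_sum, ← Finset.mul_sum] at h3
    linarith
  exact abs_sum_mul_le_of_sum_sq (h i) (h j)

/-- The term `τ² |α|²` is the only one that will be of order `n`. The cross terms see `α` only
through its projections on the columns of `X`, whose squares are at most `t`, and Young's inequality
bounds them. -/
theorem abs_sum_updateDir_mul_sub_le (hβ : ∀ i j, |Bm i j| ≤ β)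
    (ht : ∀ i, (∑ k, X k i * α k) ^ 2 ≤ t) (i j : MacroIdx d) :
    |∑ k, updateDir X Bm τ α k i * updateDir X Bm τ α k j
        - if i = wIdx d ∧ j = wIdx d then τ ^ 2 * ∑ k, α k ^ 2 else 0|
      ≤ Fintype.card (MacroIdx d) * (β ^ 2 * energy X + β ^ 2 + τ ^ 2 * t) := by
  have hβ0 : 0 ≤ β := (abs_nonneg _).trans (hβ i j)
  have ht0 : 0 ≤ t := (sq_nonneg _).trans (ht i)
  have hN : (0:ℝ) ≤ Fintype.card (MacroIdx d) := Nat.cast_nonneg _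
  have h1 := abs_sum_mul_le_of_sum_sq (sum_sq_mul_gen_le (X := X) hβ i)
    (sum_sq_mul_gen_le (X := X) hβ j)
  have cross : ∀ i j, |∑ k, (∑ l, X k l * Bm l i) * (if j = wIdx d then τ * α k else 0)|
      ≤ Fintype.card (MacroIdx d) * ((β ^ 2 + τ ^ 2 * t) / 2) := by
    intro i j
    split_ifs
    · have e : ∑ k, (∑ l, X k l * Bm l i) * (τ * α k)
          = ∑ l, Bm l i * (τ * ∑ k, X k l * α k) := by
        simp only [Finset.sum_mul, Finset.mul_sum]
        rw [Finset.sum_comm]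
        exact Finset.sum_congr rfl fun _ _ => Finset.sum_congr rfl fun _ _ => by ring
      rw [e]
      refine (abs_sum_mul_le_card (D := |τ| * √t) hβ0 (fun l => hβ l i) fun l => ?_).trans ?_
      · rw [abs_mul]
        exact mul_le_mul_of_nonneg_left (Real.abs_le_sqrt (ht l)) (abs_nonneg _)
      · refine mul_le_mul_of_nonneg_left ?_ hN
        nlinarith [sq_nonneg (β - |τ| * √t), Real.sq_sqrt ht0, sq_abs τ]
    · simp only [mul_zero, Finset.sum_const_zero, abs_zero]
      positivity
  have e : ∑ k, updateDir X Bm τ α k i * updateDir X Bm τ α k j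
        - (if i = wIdx d ∧ j = wIdx d then τ ^ 2 * ∑ k, α k ^ 2 else 0)
      = ∑ k, (∑ l, X k l * Bm l i) * (∑ l, X k l * Bm l j)
        + ∑ k, (∑ l, X k l * Bm l i) * (if j = wIdx d then τ * α k else 0)
        + ∑ k, (∑ l, X k l * Bm l j) * (if i = wIdx d then τ * α k else 0) := by
    have e1 : (if i = wIdx d ∧ j = wIdx d then τ ^ 2 * ∑ k, α k ^ 2 else 0)
        = ∑ k, (if i = wIdx d then τ * α k else 0) * (if j = wIdx d then τ * α k else 0) := by
      rw [Finset.mul_sum]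
      by_cases hi : i = wIdx d <;> by_cases hj : j = wIdx d <;> simp [hi, hj]
      exact Finset.sum_congr rfl fun _ _ => by ring
    rw [e1]
    simp only [← Finset.sum_sub_distrib, ← Finset.sum_add_distrib, updateDir_apply]
    exact Finset.sum_congr rfl fun _ _ => by ring
  rw [e]
  have := cross i j
  have := cross j i
  refine (abs_add_three _ _ _).trans ?_
  linarith

/-- For second moments `|α|² / n` need not be centred, since it is already of order one. The
constants are `12 = 3 * 2 * 2` (three summands, two of them linear terms, each a square of two
parts) and `24 = 3 * 8` for the quadratic term. -/
theorem sq_overlap_update_le (hn : 1 ≤ n) (hβ : ∀ i j, |Bm i j| ≤ β)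
    (ht : ∀ i, (∑ k, X k i * α k) ^ 2 ≤ t) (i j : MacroIdx d) :
    (overlap (X + (n : ℝ)⁻¹ • updateDir X Bm τ α) i j - overlap X i j) ^ 2
      ≤ (12 * (Fintype.card (MacroIdx d) * β * energy X) ^ 2 + 12 * (τ ^ 2 * t)
        + 24 * (Fintype.card (MacroIdx d) * β ^ 2 * energy X) ^ 2
        + 24 * (τ ^ 2 * (∑ k, α k ^ 2) / n) ^ 2) / (n : ℝ) ^ 2 := by
  have hβ0 : 0 ≤ β := (abs_nonneg _).trans (hβ i j)
  have hn' : (1:ℝ) ≤ n := by exact_mod_cast hn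
  have hn0 : (0:ℝ) < n := by linarith
  have hK : ∀ i j, (∑ k, X k i * updateDir X Bm τ α k j) ^ 2
      ≤ 2 * (Fintype.card (MacroIdx d) * β * energy X) ^ 2 + 2 * (τ ^ 2 * t) := by
    intro i j
    rw [sum_mul_updateDir]
    have h1 := abs_sum_mul_le_card (energy_nonneg X) (abs_overlap_le X i) (fun l => hβ l j)
    have h2 := pow_le_pow_left₀ (abs_nonneg _) h1 2
    rw [sq_abs] at h2
    have h3 : (if j = wIdx d then τ * ∑ k, X k i * α k else 0) ^ 2 ≤ τ ^ 2 * t := by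
      have : 0 ≤ t := (sq_nonneg _).trans (ht i)
      split_ifs
      · rw [mul_pow]; exact mul_le_mul_of_nonneg_left (ht i) (sq_nonneg τ)
      · rw [zero_pow two_ne_zero]; positivity
    have h4 : ∀ a b : ℝ, (a + b) ^ 2 ≤ 2 * a ^ 2 + 2 * b ^ 2 := fun a b => by
      nlinarith [sq_nonneg (a - b)]
    refine (h4 _ _).trans ?_
    have e : (Fintype.card (MacroIdx d) * (energy X * β)) ^ 2
      = (Fintype.card (MacroIdx d) * β * energy X) ^ 2 := by ring
    rw [e] at h2
    linarith
  have hD := pow_le_pow_left₀ (abs_nonneg _) (abs_sum_updateDir_mul_le (X := X) (τ := τ) (α := α)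
    hβ i j) 2
  rw [sq_abs] at hD
  rw [overlap_add_smul, le_div_iff₀ (by positivity)]
  have h1 := hK i j
  have h2 := hK j i
  set k1 := ∑ k, X k i * updateDir X Bm τ α k j
  set k2 := ∑ k, X k j * updateDir X Bm τ α k i
  set D := ∑ k, updateDir X Bm τ α k i * updateDir X Bm τ α k j
  set S := ∑ k, α k ^ 2
  set N : ℝ := ((Fintype.card (MacroIdx d) : ℕ) : ℝ)
  have e : ((n:ℝ)⁻¹ * (k1 + k2) + (n:ℝ)⁻¹ ^ 2 * D) ^ 2 * (n:ℝ) ^ 2 = (k1 + k2 + D / n) ^ 2 := by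
    field_simp
  rw [e]
  have h5 : (D / n) ^ 2 ≤ 8 * (N * β ^ 2 * energy X) ^ 2 + 8 * (τ ^ 2 * S / n) ^ 2 := by
    have h6 : (D / n) ^ 2 ≤ ((2 * (N * β ^ 2 * energy X) + 2 * τ ^ 2 * S) / n) ^ 2 := by
      rw [div_pow, div_pow]
      exact div_le_div_of_nonneg_right hD (by positivity)
    refine h6.trans ?_
    have h7 : (N * β ^ 2 * energy X / n) ^ 2 ≤ (N * β ^ 2 * energy X) ^ 2 := by
      rw [div_pow]
      exact div_le_self (sq_nonneg _) (one_le_pow₀ hn')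
    have h8 : (2 * (N * β ^ 2 * energy X) + 2 * τ ^ 2 * S) / n
        = 2 * (N * β ^ 2 * energy X / n) + 2 * (τ ^ 2 * S / n) := by ring
    rw [h8]
    nlinarith [sq_nonneg (N * β ^ 2 * energy X / n - τ ^ 2 * S / n)]
  have h9 : (k1 + k2 + D / n) ^ 2 ≤ 3 * (k1 ^ 2 + k2 ^ 2 + (D / n) ^ 2) := by
    nlinarith [sq_nonneg (k1 - k2), sq_nonneg (k1 - D / n), sq_nonneg (k2 - D / n)]
  linarith

end StepAlgebra

/-! ### Bounds for the random generator and the noise of one step. -/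

section StepBounds

variable {d n : ℕ} {G : GANModel d} {B : ℝ}

namespace GANModel

theorem stepDir_eq_updateDir (X : Matrix (Fin n) (MacroIdx d) ℝ)
    (ξ : Sample n d × Sample n d × Sample n d) :
    G.stepDir X ξ = updateDir X (G.stepGen X ξ) G.tau (G.stepNoise X ξ) := rfl

/-- The size of the latent vectors that enter one step. -/
noncomputable def latentSize (ξ : Sample n d × Sample n d × Sample n d) : ℝ :=
  1 + ‖ξ.1.1‖ + ‖ξ.2.1.1‖ + ‖ξ.2.2.1‖

theorem one_le_latentSize (ξ : Sample n d × Sample n d × Sample n d) : 1 ≤ latentSize ξ := by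
  unfold latentSize
  linarith [norm_nonneg ξ.1.1, norm_nonneg ξ.2.1.1, norm_nonneg ξ.2.2.1]

variable (G B) in
/-- The constant in the bound of the random generator of one step. -/
noncomputable def genConst : ℝ := (|G.tau| + |G.taut|) * B * (1 + |G.lam|)

theorem Regular.genConst_nonneg (hG : G.Regular B) : 0 ≤ G.genConst B := by
  have := hG.f_bdd.nonneg
  unfold genConst; positivity

theorem abs_stepGen_le (hG : G.Regular B) (X : Matrix (Fin n) (MacroIdx d) ℝ)
    (ξ : Sample n d × Sample n d × Sample n d) (i j : MacroIdx d) :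
    |G.stepGen X ξ i j| ≤ G.genConst B * latentSize ξ := by
  have hB := hG.f_bdd.nonneg
  have hρ := one_le_latentSize ξ
  have key : ∀ (s x p : ℝ), |s| ≤ |G.tau| + |G.taut| → |x| ≤ (1 + |G.lam|) * latentSize ξ →
      |p| ≤ B → |s * (x * p)| ≤ G.genConst B * latentSize ξ := by
    intro s x p hs hx hp
    rw [abs_mul, abs_mul]
    calc |s| * (|x| * |p|) ≤ (|G.tau| + |G.taut|) * (((1 + |G.lam|) * latentSize ξ) * B) := by
          gcongr
      _ = G.genConst B * latentSize ξ := by unfold genConst; ring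
  have h0 : 0 ≤ G.genConst B * latentSize ξ := mul_nonneg hG.genConst_nonneg (by linarith)
  have hl := abs_nonneg G.lam
  have ht : |G.tau| ≤ |G.tau| + |G.taut| := by linarith [abs_nonneg G.taut]
  have htt : |G.taut| ≤ |G.tau| + |G.taut| := by linarith [abs_nonneg G.tau]
  have hlam : |-G.lam| ≤ (1 + |G.lam|) * latentSize ξ := by
    rw [abs_neg]; nlinarith
  have hc : ∀ x : ℝ, |x| ≤ latentSize ξ → |x| ≤ (1 + |G.lam|) * latentSize ξ := by
    intro x hx; nlinarith
  have hc1 : ∀ l, |ξ.1.1 l| ≤ latentSize ξ := fun l => by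
    have := norm_le_pi_norm ξ.1.1 l
    rw [Real.norm_eq_abs] at this
    unfold latentSize; linarith [norm_nonneg ξ.2.1.1, norm_nonneg ξ.2.2.1]
  have hc2 : ∀ l, |ξ.2.1.1 l| ≤ latentSize ξ := fun l => by
    have := norm_le_pi_norm ξ.2.1.1 l
    rw [Real.norm_eq_abs] at this
    unfold latentSize; linarith [norm_nonneg ξ.1.1, norm_nonneg ξ.2.2.1]
  have hc3 : ∀ l, |ξ.2.2.1 l| ≤ latentSize ξ := fun l => by
    have := norm_le_pi_norm ξ.2.2.1 l
    rw [Real.norm_eq_abs] at this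
    unfold latentSize; linarith [norm_nonneg ξ.1.1, norm_nonneg ξ.2.1.1]
  rcases i with i | i | i <;> rcases j with j | j | j <;> simp only [stepGen, genMat, ldiag]
  · simpa using h0
  · simpa using h0
  · exact key _ _ _ ht (hc _ (hc1 i)) (hG.f_bdd.bound _)
  · simpa using h0
  · split_ifs
    · rw [← neg_mul]
      exact key _ _ _ htt hlam (hG.H_bdd _)
    · simpa using h0
  · rw [abs_neg]
    exact key _ _ _ ht (hc _ (hc2 i)) (hG.ft_bdd.bound _)
  · simpa using h0
  · exact key _ _ _ htt (hc _ (hc3 j)) (hG.ft_bdd.bound _)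
  · rw [← neg_mul]
    exact key _ _ _ ht hlam (hG.H_bdd _)

variable (G B) in
/-- The constant in the bounds of the noise of one step. -/
noncomputable def noiseConst : ℝ := 2 * (G.etaT + G.etaG) * B ^ 2

theorem Regular.noiseConst_nonneg (hG : G.Regular B) : 0 ≤ G.noiseConst B := by
  have := hG.etaT_nonneg
  have := hG.etaG_nonneg
  unfold noiseConst; positivity

/-- The squared projections of the background noises to the columns of the state. -/
noncomputable def projSize (X : Matrix (Fin n) (MacroIdx d) ℝ)
    (ξ : Sample n d × Sample n d × Sample n d) : ℝ :=
  ∑ i, ((ξ.1.2 ⬝ᵥ fun k => X k i) ^ 2 + (ξ.2.1.2 ⬝ᵥ fun k => X k i) ^ 2)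

theorem sq_noise_le (hG : G.Regular B) (X : Matrix (Fin n) (MacroIdx d) ℝ)
    (ξ : Sample n d × Sample n d × Sample n d) (x y : ℝ) :
    (√G.etaT * G.f (G.realArg X ξ.1) * x - √G.etaG * G.ft (G.fakeArg X ξ.2.1) * y) ^ 2
      ≤ G.noiseConst B * (x ^ 2 + y ^ 2) := by
  have hB := hG.f_bdd.nonneg
  have h1 : (√G.etaT * G.f (G.realArg X ξ.1) * x) ^ 2 ≤ G.etaT * B ^ 2 * x ^ 2 := by
    rw [mul_pow, mul_pow, Real.sq_sqrt hG.etaT_nonneg, ← sq_abs (G.f _)]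
    have := hG.etaT_nonneg
    gcongr
    exact hG.f_bdd.bound _
  have h2 : (√G.etaG * G.ft (G.fakeArg X ξ.2.1) * y) ^ 2 ≤ G.etaG * B ^ 2 * y ^ 2 := by
    rw [mul_pow, mul_pow, Real.sq_sqrt hG.etaG_nonneg, ← sq_abs (G.ft _)]
    have := hG.etaG_nonneg
    gcongr
    exact hG.ft_bdd.bound _
  have h3 : 0 ≤ G.etaG * B ^ 2 * x ^ 2 := by have := hG.etaG_nonneg; positivity
  have h4 : 0 ≤ G.etaT * B ^ 2 * y ^ 2 := by have := hG.etaT_nonneg; positivity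
  unfold noiseConst
  nlinarith [sq_nonneg (√G.etaT * G.f (G.realArg X ξ.1) * x
    + √G.etaG * G.ft (G.fakeArg X ξ.2.1) * y)]

theorem sum_mul_stepNoise (X : Matrix (Fin n) (MacroIdx d) ℝ)
    (ξ : Sample n d × Sample n d × Sample n d) (i : MacroIdx d) :
    ∑ k, X k i * G.stepNoise X ξ k
      = √G.etaT * G.f (G.realArg X ξ.1) * (ξ.1.2 ⬝ᵥ fun k => X k i)
        - √G.etaG * G.ft (G.fakeArg X ξ.2.1) * (ξ.2.1.2 ⬝ᵥ fun k => X k i) := by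
  simp only [stepNoise, dotProduct, Finset.mul_sum, ← Finset.sum_sub_distrib]
  exact Finset.sum_congr rfl fun _ _ => by ring

theorem sq_sum_mul_stepNoise_le (hG : G.Regular B) (X : Matrix (Fin n) (MacroIdx d) ℝ)
    (ξ : Sample n d × Sample n d × Sample n d) (i : MacroIdx d) :
    (∑ k, X k i * G.stepNoise X ξ k) ^ 2 ≤ G.noiseConst B * projSize X ξ := by
  rw [sum_mul_stepNoise]
  refine (sq_noise_le hG X ξ _ _).trans (mul_le_mul_of_nonneg_left ?_ hG.noiseConst_nonneg)
  exact Finset.single_le_sum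
    (f := fun i => (ξ.1.2 ⬝ᵥ fun k => X k i) ^ 2 + (ξ.2.1.2 ⬝ᵥ fun k => X k i) ^ 2)
    (fun _ _ => by positivity) (Finset.mem_univ i)

theorem sum_sq_stepNoise_le (hG : G.Regular B) (X : Matrix (Fin n) (MacroIdx d) ℝ)
    (ξ : Sample n d × Sample n d × Sample n d) :
    ∑ k, G.stepNoise X ξ k ^ 2
      ≤ G.noiseConst B * (ξ.1.2 ⬝ᵥ ξ.1.2 + ξ.2.1.2 ⬝ᵥ ξ.2.1.2) := by
  simp only [dotProduct, ← Finset.sum_add_distrib, Finset.mul_sum]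
  refine Finset.sum_le_sum fun k _ => (sq_noise_le hG X ξ _ _).trans (le_of_eq ?_)
  ring

theorem sum_sq_stepNoise (hG : G.Regular B) (X : Matrix (Fin n) (MacroIdx d) ℝ)
    (ξ : Sample n d × Sample n d × Sample n d) :
    ∑ k, G.stepNoise X ξ k ^ 2
      = G.etaT * G.f (G.realArg X ξ.1) ^ 2 * (ξ.1.2 ⬝ᵥ ξ.1.2)
        + G.etaG * G.ft (G.fakeArg X ξ.2.1) ^ 2 * (ξ.2.1.2 ⬝ᵥ ξ.2.1.2)
        - 2 * (√G.etaT * G.f (G.realArg X ξ.1) * (√G.etaG * G.ft (G.fakeArg X ξ.2.1)))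
          * (ξ.1.2 ⬝ᵥ ξ.2.1.2) := by
  simp only [dotProduct, Finset.mul_sum, ← Finset.sum_sub_distrib, ← Finset.sum_add_distrib]
  refine Finset.sum_congr rfl fun k _ => ?_
  rw [stepNoise]
  linear_combination G.f (G.realArg X ξ.1) ^ 2 * ξ.1.2 k ^ 2 * Real.sq_sqrt hG.etaT_nonneg
    + G.ft (G.fakeArg X ξ.2.1) ^ 2 * ξ.2.1.2 k ^ 2 * Real.sq_sqrt hG.etaG_nonneg

end GANModel

end StepBounds

/-! ### Averages over one sample. -/

section SampleAverages

variable {n d : ℕ}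

theorem measurable_dotProduct_fun {Ω κ : Type*} [MeasurableSpace Ω] [Fintype κ] {u v : Ω → κ → ℝ}
    (hu : ∀ k, Measurable fun ω => u ω k) (hv : ∀ k, Measurable fun ω => v ω k) :
    Measurable fun ω => u ω ⬝ᵥ v ω := by
  unfold dotProduct
  exact Finset.measurable_fun_sum _ fun k _ => (hu k).mul (hv k)

theorem measurable_sampleArg (v : Fin d → ℝ) (w : Fin n → ℝ) (r : ℝ) :
    Measurable fun s : Sample n d => s.1 ⬝ᵥ v + r * (s.2 ⬝ᵥ w) :=
  (measurable_dotProduct_fun (by fun_prop) (by fun_prop)).add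
    ((measurable_dotProduct_fun (by fun_prop) (by fun_prop)).const_mul r)

variable {μ : Measure (Fin d → ℝ)} [IsProbabilityMeasure μ] {θ : ℝ → ℝ} {B : ℝ}

theorem integral_latent_mul (hμ : HasAllMoments μ) (hθ : C2Bdd θ B) (v : Fin d → ℝ)
    (w : Fin n → ℝ) (η : ℝ) (l : Fin d) :
    Integrable (fun s : Sample n d => s.1 l * θ (s.1 ⬝ᵥ v + √η * (s.2 ⬝ᵥ w)))
      (μ.prod (stdGauss n)) ∧
    ∫ s : Sample n d, s.1 l * θ (s.1 ⬝ᵥ v + √η * (s.2 ⬝ᵥ w)) ∂(μ.prod (stdGauss n))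
      = bracket μ v ((w ⬝ᵥ w) * η) fun c x => c l * θ x := by
  constructor
  · have h1 : Integrable (fun c : Fin d → ℝ => c l) μ := by
      have := hμ 1
      simp only [pow_one] at this
      exact this.mono' (measurable_pi_apply l).aestronglyMeasurable
        (Filter.Eventually.of_forall fun c => norm_le_pi_norm c l)
    exact (h1.comp_fst (stdGauss n)).mul_bdd (c := B)
      (hθ.diff.continuous.measurable.comp (measurable_sampleArg v w (√η))).aestronglyMeasurable
      (Filter.Eventually.of_forall fun s => hθ.bound _)
  · refine integral_eq_bracket μ v w η (φ := fun c x => c l * θ x) ?_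
    exact ((measurable_pi_apply l).comp measurable_fst).mul
      (hθ.diff.continuous.measurable.comp measurable_snd)

theorem integral_of_arg {φ : ℝ → ℝ} (hφ : Measurable φ) (v : Fin d → ℝ) (w : Fin n → ℝ) (η : ℝ) :
    ∫ s : Sample n d, φ (s.1 ⬝ᵥ v + √η * (s.2 ⬝ᵥ w)) ∂(μ.prod (stdGauss n))
      = bracket μ v ((w ⬝ᵥ w) * η) fun _ x => φ x :=
  integral_eq_bracket μ v w η (φ := fun _ x => φ x) (hφ.comp measurable_snd)

/-- Stein's identity at a fixed latent vector, then integration over that vector. The factor `√η` is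
the weight of the noise in the argument; with the weight in `stepNoise` it gives the `η` in `h`. -/
theorem integral_noise_mul (hθ : C2Bdd θ B) (v : Fin d → ℝ)
    (w x : Fin n → ℝ) (η : ℝ) :
    Integrable (fun s : Sample n d => (s.2 ⬝ᵥ x) * θ (s.1 ⬝ᵥ v + √η * (s.2 ⬝ᵥ w)))
      (μ.prod (stdGauss n)) ∧
    ∫ s : Sample n d, (s.2 ⬝ᵥ x) * θ (s.1 ⬝ᵥ v + √η * (s.2 ⬝ᵥ w)) ∂(μ.prod (stdGauss n))
      = √η * (x ⬝ᵥ w) * bracket μ v ((w ⬝ᵥ w) * η) fun _ x => deriv θ x := by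
  have hi : Integrable (fun s : Sample n d => (s.2 ⬝ᵥ x) * θ (s.1 ⬝ᵥ v + √η * (s.2 ⬝ᵥ w)))
      (μ.prod (stdGauss n)) :=
    ((integrable_dotProduct x).comp_snd μ).mul_bdd (c := B)
      (hθ.diff.continuous.measurable.comp (measurable_sampleArg v w (√η))).aestronglyMeasurable
      (Filter.Eventually.of_forall fun s => hθ.bound _)
  refine ⟨hi, ?_⟩
  have hd : Integrable (fun s : Sample n d => deriv θ (s.1 ⬝ᵥ v + √η * (s.2 ⬝ᵥ w)))
      (μ.prod (stdGauss n)) :=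
    Integrable.of_bound (hθ.diff'.continuous.measurable.comp
      (measurable_sampleArg v w (√η))).aestronglyMeasurable B
      (Filter.Eventually.of_forall fun s => hθ.bound' _)
  rw [← integral_of_arg hθ.diff'.continuous.measurable, integral_prod _ hi, integral_prod _ hd,
    ← integral_const_mul]
  congr 1
  ext c
  have := stein hθ.diff hθ.bound hθ.bound' (c ⬝ᵥ v) (√η • w) x
  simp only [dotProduct_smul, smul_eq_mul] at this
  rw [this]

end SampleAverages

/-! ### Averages over the inputs of one step. -/

section StepAverages

variable {n d : ℕ}

/-- The law of the inputs of one step. -/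
noncomputable def GANModel.inputLaw (G : GANModel d) (n : ℕ) :
    Measure (Sample n d × Sample n d × Sample n d) :=
  (G.Pc.prod (stdGauss n)).prod ((G.Pct.prod (stdGauss n)).prod (G.Pct.prod (stdGauss n)))

theorem MeasureTheory.MeasurePreserving.integrable_and_integral {α β : Type*} [MeasurableSpace α]
    [MeasurableSpace β] {μ : Measure α} {ν : Measure β} {g : α → β} (hg : MeasurePreserving g μ ν)
    {φ : β → ℝ} (hφ : Integrable φ ν) :
    Integrable (fun x => φ (g x)) μ ∧ ∫ x, φ (g x) ∂μ = ∫ y, φ y ∂ν := by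
  refine ⟨(hg.integrable_comp hφ.1).2 hφ, ?_⟩
  rw [← hg.map_eq, integral_map hg.aemeasurable]
  rw [hg.map_eq]; exact hφ.1

namespace GANModel

variable {G : GANModel d} {B : ℝ}

namespace Regular

theorem isProbabilityMeasure_inputLaw (hG : G.Regular B) (n : ℕ) :
    IsProbabilityMeasure (G.inputLaw n) := by
  have := hG.prob_c
  have := hG.prob_ct
  unfold inputLaw; infer_instance

theorem measurePreserving_real (hG : G.Regular B) :
    MeasurePreserving (fun ξ : Sample n d × Sample n d × Sample n d => ξ.1) (G.inputLaw n)
      (G.Pc.prod (stdGauss n)) := by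
  have := hG.prob_c
  have := hG.prob_ct
  exact measurePreserving_fst

theorem measurePreserving_fake (hG : G.Regular B) :
    MeasurePreserving (fun ξ : Sample n d × Sample n d × Sample n d => ξ.2.1) (G.inputLaw n)
      (G.Pct.prod (stdGauss n)) := by
  have := hG.prob_c
  have := hG.prob_ct
  exact (measurePreserving_fst (μ := G.Pct.prod (stdGauss n))
    (ν := G.Pct.prod (stdGauss n))).comp measurePreserving_snd

theorem measurePreserving_fake' (hG : G.Regular B) :
    MeasurePreserving (fun ξ : Sample n d × Sample n d × Sample n d => ξ.2.2) (G.inputLaw n)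
      (G.Pct.prod (stdGauss n)) := by
  have := hG.prob_c
  have := hG.prob_ct
  exact (measurePreserving_snd (μ := G.Pct.prod (stdGauss n))
    (ν := G.Pct.prod (stdGauss n))).comp measurePreserving_snd

end Regular

theorem measurable_overlap {Ω : Type*} [MeasurableSpace Ω] {X : Ω → Matrix (Fin n) (MacroIdx d) ℝ}
    (hX : ∀ k i, Measurable fun ω => X ω k i) (i j : MacroIdx d) :
    Measurable fun ω => overlap (X ω) i j :=
  Finset.measurable_fun_sum _ fun k _ => (hX k i).mul (hX k j)

section

variable {Ω : Type*} [MeasurableSpace Ω] {X : Ω → Matrix (Fin n) (MacroIdx d) ℝ}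
  {s : Ω → Sample n d}

theorem measurable_realArg (hX : ∀ k i, Measurable fun ω => X ω k i) (hs : Measurable s) :
    Measurable fun ω => G.realArg (X ω) (s ω) := by
  refine (measurable_dotProduct_fun (fun l => (measurable_pi_apply l).comp hs.fst) fun l => ?_).add
    ((measurable_dotProduct_fun (fun l => (measurable_pi_apply l).comp hs.snd)
      fun k => hX k _).const_mul _)
  exact measurable_overlap hX _ _

theorem measurable_fakeArg (hX : ∀ k i, Measurable fun ω => X ω k i) (hs : Measurable s) :
    Measurable fun ω => G.fakeArg (X ω) (s ω) := by
  refine (measurable_dotProduct_fun (fun l => (measurable_pi_apply l).comp hs.fst) fun l => ?_).add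
    ((measurable_dotProduct_fun (fun l => (measurable_pi_apply l).comp hs.snd)
      fun k => hX k _).const_mul _)
  exact measurable_overlap hX _ _

theorem measurable_stepGen (hG : G.Regular B) (hX : ∀ k i, Measurable fun ω => X ω k i)
    {ξ : Ω → Sample n d × Sample n d × Sample n d} (hξ : Measurable ξ) (i j : MacroIdx d) :
    Measurable fun ω => G.stepGen (X ω) (ξ ω) i j := by
  have hf := hG.f_bdd.diff.continuous.measurable
  have hft := hG.ft_bdd.diff.continuous.measurable
  have hH := hG.H_lip.continuous.measurable
  rcases i with i | i | i <;> rcases j with j | j | j <;> simp only [stepGen, genMat, ldiag]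
  · exact measurable_const
  · exact measurable_const
  · exact (((measurable_pi_apply i).comp hξ.fst.fst).mul
      (hf.comp (measurable_realArg hX hξ.fst))).const_mul _
  · exact measurable_const
  · split_ifs
    · exact (((hH.comp (measurable_overlap hX _ _)).const_mul _).neg).const_mul _
    · exact measurable_const
  · exact ((((measurable_pi_apply i).comp hξ.snd.fst.fst).mul
      (hft.comp (measurable_fakeArg hX hξ.snd.fst))).const_mul _).neg
  · exact measurable_const
  · exact (((measurable_pi_apply j).comp hξ.snd.snd.fst).mul
      (hft.comp (measurable_fakeArg hX hξ.snd.snd))).const_mul _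
  · exact (((hH.comp (measurable_overlap hX _ _)).const_mul _).neg).const_mul _

theorem measurable_stepNoise (hG : G.Regular B) (hX : ∀ k i, Measurable fun ω => X ω k i)
    {ξ : Ω → Sample n d × Sample n d × Sample n d} (hξ : Measurable ξ) (i : Fin n) :
    Measurable fun ω => G.stepNoise (X ω) (ξ ω) i := by
  have hf := hG.f_bdd.diff.continuous.measurable
  have hft := hG.ft_bdd.diff.continuous.measurable
  exact (((hf.comp (measurable_realArg hX hξ.fst)).const_mul _).mul
    ((measurable_pi_apply i).comp hξ.fst.snd)).sub
    (((hft.comp (measurable_fakeArg hX hξ.snd.fst)).const_mul _).mul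
    ((measurable_pi_apply i).comp hξ.snd.fst.snd))

theorem measurable_stepDir (hG : G.Regular B) (hX : ∀ k i, Measurable fun ω => X ω k i)
    {ξ : Ω → Sample n d × Sample n d × Sample n d} (hξ : Measurable ξ) (k : Fin n)
    (j : MacroIdx d) : Measurable fun ω => G.stepDir (X ω) (ξ ω) k j := by
  simp only [stepDir_eq_updateDir, updateDir_apply]
  refine (Finset.measurable_fun_sum _ fun l _ =>
    (hX k l).mul (measurable_stepGen hG hX hξ l j)).add ?_
  split_ifs
  · exact (measurable_stepNoise hG hX hξ k).const_mul _
  · exact measurable_const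

end

/-- The averaged random generator, without the contribution of the background noises. -/
theorem integral_stepGen (hG : G.Regular B) (X : Matrix (Fin n) (MacroIdx d) ℝ)
    (i j : MacroIdx d) :
    Integrable (fun ξ => G.stepGen X ξ i j) (G.inputLaw n) ∧
    ∫ ξ, G.stepGen X ξ i j ∂(G.inputLaw n) = G.meanGen (overlap X) i j
      - if i = wIdx d ∧ j = wIdx d then G.tau *
        (G.etaT * bracket G.Pc (overlap X).state.q ((overlap X).state.z * G.etaT)
            (fun _ x => deriv G.f x)
          - G.etaG * bracket G.Pct (overlap X).state.r ((overlap X).state.z * G.etaG)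
            (fun _ x => deriv G.ft x)) else 0 := by
  have := hG.prob_c
  have := hG.prob_ct
  have := hG.isProbabilityMeasure_inputLaw n
  have h1 := fun l => integral_latent_mul (n := n) hG.moments_c hG.f_bdd (overlap X).state.q
    (fun k => X k (wIdx d)) G.etaT l
  have h2 := fun l => integral_latent_mul (n := n) hG.moments_ct hG.ft_bdd (overlap X).state.r
    (fun k => X k (wIdx d)) G.etaG l
  have hr := fun l => (hG.measurePreserving_real (n := n)).integrable_and_integral (h1 l).1
  have hf := fun l => (hG.measurePreserving_fake (n := n)).integrable_and_integral (h2 l).1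
  have hf' := fun l => (hG.measurePreserving_fake' (n := n)).integrable_and_integral (h2 l).1
  rcases i with i | i | i <;> rcases j with j | j | j <;>
    simp only [stepGen, genMat, meanGen, wIdx, Sum.inr.injEq, reduceCtorEq, and_false, false_and,
      if_false, sub_zero, and_self, if_true]
  · exact ⟨integrable_const _, by simp⟩
  · exact ⟨integrable_const _, by simp⟩
  · exact ⟨(hr i).1.const_mul _, by
      rw [integral_const_mul]
      exact congrArg _ ((hr i).2.trans (h1 i).2)⟩
  · exact ⟨integrable_const _, by simp⟩
  · exact ⟨integrable_const _, by simp⟩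
  · exact ⟨((hf i).1.const_mul _).neg, by
      rw [integral_neg, integral_const_mul]
      exact congrArg (fun x => -(G.tau * x)) ((hf i).2.trans (h2 i).2)⟩
  · exact ⟨integrable_const _, by simp⟩
  · exact ⟨(hf' j).1.const_mul _, by
      rw [integral_const_mul]
      exact congrArg _ ((hf' j).2.trans (h2 j).2)⟩
  · refine ⟨integrable_const _, ?_⟩
    simp only [integral_const, probReal_univ, one_smul, GANModel.h, Macro.state]
    ring

/-- The noise is correlated with the argument of the function that multiplies it. Stein's identity
turns this correlation into the overlap with `w` times the averaged derivatives, the very term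
missing in `integral_stepGen`. -/
theorem integral_proj_stepNoise (hG : G.Regular B) (X : Matrix (Fin n) (MacroIdx d) ℝ)
    (i : MacroIdx d) :
    Integrable (fun ξ => ∑ k, X k i * G.stepNoise X ξ k) (G.inputLaw n) ∧
    ∫ ξ, ∑ k, X k i * G.stepNoise X ξ k ∂(G.inputLaw n) = overlap X i (wIdx d) *
        (G.etaT * bracket G.Pc (overlap X).state.q ((overlap X).state.z * G.etaT)
            (fun _ x => deriv G.f x)
          - G.etaG * bracket G.Pct (overlap X).state.r ((overlap X).state.z * G.etaG)
            (fun _ x => deriv G.ft x)) := by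
  have := hG.prob_c
  have := hG.prob_ct
  have h1 := integral_noise_mul (μ := G.Pc) hG.f_bdd (overlap X).state.q
    (fun k => X k (wIdx d)) (fun k => X k i) G.etaT
  have h2 := integral_noise_mul (μ := G.Pct) hG.ft_bdd (overlap X).state.r
    (fun k => X k (wIdx d)) (fun k => X k i) G.etaG
  have hr := (hG.measurePreserving_real (n := n)).integrable_and_integral h1.1
  have hf := (hG.measurePreserving_fake (n := n)).integrable_and_integral h2.1
  have e : ∀ ξ, ∑ k, X k i * G.stepNoise X ξ k
      = √G.etaT * ((ξ.1.2 ⬝ᵥ fun k => X k i) * G.f (ξ.1.1 ⬝ᵥ (overlap X).state.q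
          + √G.etaT * (ξ.1.2 ⬝ᵥ fun k => X k (wIdx d))))
        - √G.etaG * ((ξ.2.1.2 ⬝ᵥ fun k => X k i) * G.ft (ξ.2.1.1 ⬝ᵥ (overlap X).state.r
          + √G.etaG * (ξ.2.1.2 ⬝ᵥ fun k => X k (wIdx d)))) := by
    intro ξ
    rw [sum_mul_stepNoise, realArg, fakeArg]
    ring
  simp only [e]
  refine ⟨(hr.1.const_mul _).sub (hf.1.const_mul _), ?_⟩
  rw [integral_sub (hr.1.const_mul _) (hf.1.const_mul _), integral_const_mul, integral_const_mul,
    hr.2, hf.2, h1.2, h2.2, ← mul_assoc, ← mul_assoc, ← mul_assoc, ← mul_assoc,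
    Real.mul_self_sqrt hG.etaT_nonneg, Real.mul_self_sqrt hG.etaG_nonneg]
  change G.etaT * overlap X i (wIdx d) * _ - G.etaG * overlap X i (wIdx d) * _ = _
  simp only [Macro.state, overlap, dotProduct]
  ring

/-- The corner term missing from the mean of `stepGen` and the Stein term from the noise cancel, and
the pure product with `meanGen` remains. -/
theorem integral_overlap_stepDir (hG : G.Regular B) (X : Matrix (Fin n) (MacroIdx d) ℝ)
    (i j : MacroIdx d) :
    Integrable (fun ξ => ∑ k, X k i * G.stepDir X ξ k j) (G.inputLaw n) ∧
    ∫ ξ, ∑ k, X k i * G.stepDir X ξ k j ∂(G.inputLaw n)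
      = ∑ l, overlap X i l * G.meanGen (overlap X) l j := by
  simp only [stepDir_eq_updateDir, sum_mul_updateDir]
  have h1 := fun l => integral_stepGen hG X l j
  have h2 := integral_proj_stepNoise hG X i
  have i1 : Integrable (fun ξ => ∑ l, overlap X i l * G.stepGen X ξ l j) (G.inputLaw n) :=
    integrable_finsetSum _ fun l _ => (h1 l).1.const_mul _
  have i2 : Integrable (fun ξ => if j = wIdx d then G.tau * ∑ k, X k i * G.stepNoise X ξ k else 0)
      (G.inputLaw n) := by
    split_ifs
    · exact h2.1.const_mul _
    · exact integrable_zero _ _ _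
  refine ⟨i1.add i2, ?_⟩
  rw [integral_add i1 i2, integral_finsetSum _ fun l _ => (h1 l).1.const_mul _]
  simp only [integral_const_mul, (h1 _).2, mul_sub, Finset.sum_sub_distrib]
  by_cases hj : j = wIdx d
  · simp only [hj, and_true, if_true, integral_const_mul, h2.2, mul_ite, mul_zero,
      Finset.sum_ite_eq', Finset.mem_univ]
    ring
  · simp [hj]

end GANModel

end StepAverages

/-! ### Bookkeeping for expectations. -/

section Means

variable {α : Type*} [MeasurableSpace α] {μ : Measure α} {φ ψ : α → ℝ} {x y : ℝ}

/-- The function `φ` is integrable with integral `x`. -/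
def HasMean (μ : Measure α) (φ : α → ℝ) (x : ℝ) : Prop := Integrable φ μ ∧ ∫ a, φ a ∂μ = x

theorem HasMean.add (h : HasMean μ φ x) (h' : HasMean μ ψ y) :
    HasMean μ (fun a => φ a + ψ a) (x + y) :=
  ⟨h.1.add h'.1, by rw [integral_add h.1 h'.1, h.2, h'.2]⟩

theorem HasMean.sub (h : HasMean μ φ x) (h' : HasMean μ ψ y) :
    HasMean μ (fun a => φ a - ψ a) (x - y) :=
  ⟨h.1.sub h'.1, by rw [integral_sub h.1 h'.1, h.2, h'.2]⟩

theorem HasMean.const_mul (h : HasMean μ φ x) (c : ℝ) : HasMean μ (fun a => c * φ a) (c * x) :=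
  ⟨h.1.const_mul c, by rw [integral_const_mul, h.2]⟩

theorem HasMean.div_const (h : HasMean μ φ x) (c : ℝ) : HasMean μ (fun a => φ a / c) (x / c) :=
  ⟨h.1.div_const c, by rw [integral_div, h.2]⟩

theorem hasMean_const [IsProbabilityMeasure μ] (c : ℝ) : HasMean μ (fun _ => c) c :=
  ⟨integrable_const c, by simp⟩

theorem HasMean.sum {ι : Type*} {s : Finset ι} {φ : ι → α → ℝ} {x : ι → ℝ}
    (h : ∀ i ∈ s, HasMean μ (φ i) (x i)) : HasMean μ (fun a => ∑ i ∈ s, φ i a) (∑ i ∈ s, x i) :=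
  ⟨integrable_finsetSum _ fun i hi => (h i hi).1, by
    rw [integral_finsetSum _ fun i hi => (h i hi).1]
    exact Finset.sum_congr rfl fun i hi => (h i hi).2⟩

theorem MeasureTheory.Integrable.hasMean (h : Integrable φ μ) : HasMean μ φ (∫ a, φ a ∂μ) :=
  ⟨h, rfl⟩

end Means

/-! ### Moments of the inputs and second moments of the increments. -/

section InputMoments

variable {n d : ℕ} {G : GANModel d} {B : ℝ}

theorem integrable_normSq_stdGauss (n : ℕ) :
    Integrable (fun a : Fin n → ℝ => a ⬝ᵥ a) (stdGauss n) ∧ ∫ a, a ⬝ᵥ a ∂(stdGauss n) = n := by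
  have h := fun i : Fin n => integrable_dotProduct_sq (Pi.single i 1)
  simp only [dotProduct_single_one, Pi.single_eq_same] at h
  have e : ∀ a : Fin n → ℝ, a ⬝ᵥ a = ∑ i, a i ^ 2 := fun a => by simp [dotProduct, sq]
  simp only [e]
  refine ⟨integrable_finsetSum _ fun i _ => (h i).1, ?_⟩
  rw [integral_finsetSum _ fun i _ => (h i).1]
  simp [(h _).2]

theorem measurable_dot_noise :
    Measurable fun p : (Fin n → ℝ) × (Fin n → ℝ) => p.1 ⬝ᵥ p.2 :=
  measurable_dotProduct_fun (by fun_prop) (by fun_prop)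

theorem integrable_dot_noise_sq (n : ℕ) :
    Integrable (fun p : (Fin n → ℝ) × (Fin n → ℝ) => (p.1 ⬝ᵥ p.2) ^ 2)
      ((stdGauss n).prod (stdGauss n)) ∧
    ∫ p : (Fin n → ℝ) × (Fin n → ℝ), (p.1 ⬝ᵥ p.2) ^ 2 ∂((stdGauss n).prod (stdGauss n)) = n := by
  have h := integrable_normSq_stdGauss n
  have hi : Integrable (fun p : (Fin n → ℝ) × (Fin n → ℝ) => (p.1 ⬝ᵥ p.2) ^ 2)
      ((stdGauss n).prod (stdGauss n)) := by
    refine (h.1.mul_prod h.1).mono' (measurable_dot_noise.pow_const 2).aestronglyMeasurable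
      (Filter.Eventually.of_forall fun p => ?_)
    rw [Real.norm_eq_abs, abs_of_nonneg (sq_nonneg _)]
    simp only [dotProduct, ← sq]
    exact Finset.sum_mul_sq_le_sq_mul_sq _ _ _
  refine ⟨hi, ?_⟩
  rw [integral_prod_symm _ hi]
  simp only [(integrable_dotProduct_sq _).2, h.2]

namespace GANModel

/-- The fluctuations of the norms and the inner product of the background noises. -/
noncomputable def noiseFluct (ξ : Sample n d × Sample n d × Sample n d) : ℝ :=
  (ξ.1.2 ⬝ᵥ ξ.1.2 - n) ^ 2 + (ξ.2.1.2 ⬝ᵥ ξ.2.1.2 - n) ^ 2 + (ξ.1.2 ⬝ᵥ ξ.2.1.2) ^ 2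

namespace Regular

theorem measurePreserving_realNoise (hG : G.Regular B) :
    MeasurePreserving (fun ξ : Sample n d × Sample n d × Sample n d => ξ.1.2) (G.inputLaw n)
      (stdGauss n) := by
  have := hG.prob_c
  exact (measurePreserving_snd (μ := G.Pc) (ν := stdGauss n)).comp hG.measurePreserving_real

theorem measurePreserving_fakeNoise (hG : G.Regular B) :
    MeasurePreserving (fun ξ : Sample n d × Sample n d × Sample n d => ξ.2.1.2) (G.inputLaw n)
      (stdGauss n) := by
  have := hG.prob_ct
  exact (measurePreserving_snd (μ := G.Pct) (ν := stdGauss n)).comp hG.measurePreserving_fake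

theorem measurePreserving_noises (hG : G.Regular B) :
    MeasurePreserving (fun ξ : Sample n d × Sample n d × Sample n d => (ξ.1.2, ξ.2.1.2))
      (G.inputLaw n) ((stdGauss n).prod (stdGauss n)) := by
  have := hG.prob_c
  have := hG.prob_ct
  exact (measurePreserving_snd (μ := G.Pc) (ν := stdGauss n)).prod
    ((measurePreserving_snd (μ := G.Pct) (ν := stdGauss n)).comp
      (measurePreserving_fst (μ := G.Pct.prod (stdGauss n)) (ν := G.Pct.prod (stdGauss n))))

/-- Fourth moments enter because `Dᵀ D` is quadratic in the generator and its square is averaged.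
The factor is `64 = 4 ^ 3`, the power-mean constant for four summands. -/
theorem exists_latentSize_bound (hG : G.Regular B) : ∃ C : ℝ, 0 ≤ C ∧ ∀ n : ℕ,
    Integrable (fun ξ : Sample n d × Sample n d × Sample n d => latentSize ξ ^ 4) (G.inputLaw n) ∧
    ∫ ξ, latentSize ξ ^ 4 ∂(G.inputLaw n) ≤ C := by
  have := hG.prob_c
  have := hG.prob_ct
  refine ⟨64 * (1 + ∫ c, ‖c‖ ^ 4 ∂G.Pc + ∫ c, ‖c‖ ^ 4 ∂G.Pct + ∫ c, ‖c‖ ^ 4 ∂G.Pct), ?_, fun n => ?_⟩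
  · have h1 : 0 ≤ ∫ c, ‖c‖ ^ 4 ∂G.Pc := integral_nonneg fun c => by positivity
    have h2 : 0 ≤ ∫ c, ‖c‖ ^ 4 ∂G.Pct := integral_nonneg fun c => by positivity
    positivity
  have := hG.isProbabilityMeasure_inputLaw n
  have h1 := ((measurePreserving_fst (μ := G.Pc) (ν := stdGauss n)).comp
    (hG.measurePreserving_real (n := n))).integrable_and_integral (hG.moments_c 4)
  have h2 := ((measurePreserving_fst (μ := G.Pct) (ν := stdGauss n)).comp
    (hG.measurePreserving_fake (n := n))).integrable_and_integral (hG.moments_ct 4)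
  have h3 := ((measurePreserving_fst (μ := G.Pct) (ν := stdGauss n)).comp
    (hG.measurePreserving_fake' (n := n))).integrable_and_integral (hG.moments_ct 4)
  simp only [Function.comp_apply] at h1 h2 h3
  have hle : ∀ ξ : Sample n d × Sample n d × Sample n d, latentSize ξ ^ 4
      ≤ 64 * (1 + ‖ξ.1.1‖ ^ 4 + ‖ξ.2.1.1‖ ^ 4 + ‖ξ.2.2.1‖ ^ 4) := by
    intro ξ
    unfold latentSize
    have hs : ∀ a b : ℝ, (a + b) ^ 2 ≤ 2 * (a ^ 2 + b ^ 2) := fun a b => by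
      nlinarith [sq_nonneg (a - b)]
    generalize ‖ξ.1.1‖ = a
    generalize ‖ξ.2.1.1‖ = b
    generalize ‖ξ.2.2.1‖ = c
    have t1 : (1 + a + b + c) ^ 2 ≤ 4 * (1 + a ^ 2 + (b ^ 2 + c ^ 2)) := by
      nlinarith [hs (1 + a) (b + c), hs 1 a, hs b c]
    have t2 := pow_le_pow_left₀ (sq_nonneg (1 + a + b + c)) t1 2
    nlinarith [hs (1 + a ^ 2) (b ^ 2 + c ^ 2), hs 1 (a ^ 2), hs (b ^ 2) (c ^ 2)]
  have hg := ((((hasMean_const (μ := G.inputLaw n) (1 : ℝ)).add h1).add h2).add h3).const_mul 64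
  have hi : Integrable (fun ξ : Sample n d × Sample n d × Sample n d => latentSize ξ ^ 4)
      (G.inputLaw n) := by
    refine hg.1.mono' ?_ (Filter.Eventually.of_forall fun ξ => ?_)
    · unfold latentSize; fun_prop
    · rw [Real.norm_eq_abs, abs_of_nonneg (by positivity)]; exact hle ξ
  exact ⟨hi, (integral_mono hi hg.1 hle).trans (le_of_eq hg.2)⟩

theorem integral_projSize (hG : G.Regular B) (X : Matrix (Fin n) (MacroIdx d) ℝ) :
    Integrable (projSize X) (G.inputLaw n) ∧
      ∫ ξ, projSize X ξ ∂(G.inputLaw n) = 2 * energy X := by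
  have h := fun i => integrable_dotProduct_sq fun k => X k i
  have h1 : ∀ i, HasMean (G.inputLaw n) (fun ξ => (ξ.1.2 ⬝ᵥ fun k => X k i) ^ 2)
      (overlap X i i) := fun i => by
    have := (hG.measurePreserving_realNoise (n := n)).integrable_and_integral (h i).1
    exact ⟨this.1, this.2.trans (h i).2⟩
  have h2 : ∀ i, HasMean (G.inputLaw n) (fun ξ => (ξ.2.1.2 ⬝ᵥ fun k => X k i) ^ 2)
      (overlap X i i) := fun i => by
    have := (hG.measurePreserving_fakeNoise (n := n)).integrable_and_integral (h i).1
    exact ⟨this.1, this.2.trans (h i).2⟩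
  have h3 := HasMean.sum fun i (_ : i ∈ Finset.univ) => (h1 i).add (h2 i)
  refine ⟨h3.1, h3.2.trans ?_⟩
  rw [energy_eq_sum_overlap, Finset.mul_sum]
  exact Finset.sum_congr rfl fun i _ => (two_mul _).symm

/-- Each of the two squared lengths has variance at most `K * n`, and the inner product of the two
independent noises has second moment `n`. -/
theorem exists_noiseFluct_bound (hG : G.Regular B) : ∃ C : ℝ, 0 ≤ C ∧ ∀ n : ℕ,
    Integrable (fun ξ : Sample n d × Sample n d × Sample n d => noiseFluct ξ) (G.inputLaw n) ∧
    ∫ ξ, noiseFluct ξ ∂(G.inputLaw n) ≤ C * n := by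
  obtain ⟨K, hK, h⟩ := exists_normSq_moments
  refine ⟨2 * K + 1, by positivity, fun n => ?_⟩
  have hi : Integrable (fun a : Fin n → ℝ => (a ⬝ᵥ a - n) ^ 2) (stdGauss n) := by
    have e : ∀ a : Fin n → ℝ, (a ⬝ᵥ a - n) ^ 2 = (a ⬝ᵥ a) ^ 2 - 2 * n * (a ⬝ᵥ a) + n ^ 2 :=
      fun a => by ring
    simp only [e]
    exact ((h n).1.sub ((integrable_normSq_stdGauss n).1.const_mul _)).add (integrable_const _)
  have h1 := (hG.measurePreserving_realNoise (n := n)).integrable_and_integral hi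
  have h2 := (hG.measurePreserving_fakeNoise (n := n)).integrable_and_integral hi
  have h3 := (hG.measurePreserving_noises (n := n)).integrable_and_integral
    (integrable_dot_noise_sq n).1
  have h4 := (HasMean.add h1 h2).add h3
  refine ⟨h4.1, h4.2.trans_le ?_⟩
  rw [(integrable_dot_noise_sq n).2]
  linarith [(h n).2]

end Regular

variable (G) in
/-- The increment of an overlap in one step. -/
noncomputable def overlapStep (X : Matrix (Fin n) (MacroIdx d) ℝ)
    (ξ : Sample n d × Sample n d × Sample n d) (i j : MacroIdx d) : ℝ :=
  overlap (X + (n : ℝ)⁻¹ • G.stepDir X ξ) i j - overlap X i j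

theorem measurable_overlapStep (hG : G.Regular B) (X : Matrix (Fin n) (MacroIdx d) ℝ)
    (i j : MacroIdx d) : Measurable fun ξ => G.overlapStep X ξ i j := by
  unfold overlapStep
  refine (measurable_overlap (fun k l => ?_) i j).sub measurable_const
  exact measurable_const.add ((measurable_stepDir hG (X := fun _ => X)
    (fun _ _ => measurable_const) measurable_id k l).const_mul _)

/-- Second moments of the increments of the overlaps. -/
theorem exists_overlapStep_sq_bound (hG : G.Regular B) : ∃ C : ℝ, 0 ≤ C ∧ ∀ n : ℕ, 1 ≤ n →
    ∀ (X : Matrix (Fin n) (MacroIdx d) ℝ) (i j : MacroIdx d),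
      Integrable (fun ξ => G.overlapStep X ξ i j ^ 2) (G.inputLaw n) ∧
      ∫ ξ, G.overlapStep X ξ i j ^ 2 ∂(G.inputLaw n) ≤ C * (1 + energy X ^ 2) / (n : ℝ) ^ 2 := by
  obtain ⟨Cρ, hCρ, hρ⟩ := hG.exists_latentSize_bound
  obtain ⟨Cν, hCν, hν⟩ := hG.exists_noiseFluct_bound
  set N : ℝ := ((Fintype.card (MacroIdx d) : ℕ) : ℝ) with hN
  set cB := G.genConst B
  set cN := G.noiseConst B
  have hcB : 0 ≤ cB := hG.genConst_nonneg
  have hcN : 0 ≤ cN := hG.noiseConst_nonneg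
  set A1 := 12 * (N * cB) ^ 2 + 24 * (N * cB ^ 2) ^ 2
  set A2 := 12 * (G.tau ^ 2 * cN)
  set A3 := 24 * (G.tau ^ 2 * cN) ^ 2
  have hA1 : 0 ≤ A1 := by positivity
  have hA2 : 0 ≤ A2 := by positivity
  have hA3 : 0 ≤ A3 := by positivity
  refine ⟨A1 * Cρ + 2 * A2 + A3 * (3 * Cν + 12), by positivity, fun n hn X i j => ?_⟩
  have := hG.isProbabilityMeasure_inputLaw n
  have hn' : (1:ℝ) ≤ n := by exact_mod_cast hn
  have hn0 : (0:ℝ) < n := by linarith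
  set Q := energy X
  have hQ : 0 ≤ Q := energy_nonneg X
  obtain ⟨ip, hp⟩ := hG.integral_projSize X
  have hpt : ∀ ξ, G.overlapStep X ξ i j ^ 2 ≤ (A1 * Q ^ 2 * latentSize ξ ^ 4 + A2 * projSize X ξ
      + A3 * (3 * noiseFluct ξ / (n : ℝ) ^ 2 + 12)) / (n : ℝ) ^ 2 := by
    intro ξ
    have h := sq_overlap_update_le (τ := G.tau) hn (abs_stepGen_le hG X ξ)
      (sq_sum_mul_stepNoise_le hG X ξ) i j
    rw [← stepDir_eq_updateDir] at h
    refine h.trans (div_le_div_of_nonneg_right ?_ (by positivity))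
    have hρ1 := one_le_latentSize ξ
    have hρ2 : latentSize ξ ^ 2 ≤ latentSize ξ ^ 4 := pow_le_pow_right₀ hρ1 (by norm_num)
    have hs := sum_sq_stepNoise_le hG X ξ
    have hs0 : 0 ≤ ∑ k, G.stepNoise X ξ k ^ 2 := Finset.sum_nonneg fun _ _ => sq_nonneg _
    have h1 : (G.tau ^ 2 * (∑ k, G.stepNoise X ξ k ^ 2) / n) ^ 2
        ≤ (G.tau ^ 2 * cN) ^ 2 * (3 * noiseFluct ξ / (n : ℝ) ^ 2 + 12) := by
      -- The sum of the squared lengths is two fluctuations plus `2 n`; three summands give `3 (2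
      -- n)² = 12 n²`.
      have h2 : (∑ k, G.stepNoise X ξ k ^ 2) ^ 2 ≤ cN ^ 2 * (3 * noiseFluct ξ + 12 * n ^ 2) := by
        refine (pow_le_pow_left₀ hs0 hs 2).trans ?_
        rw [mul_pow]
        refine mul_le_mul_of_nonneg_left ?_ (sq_nonneg _)
        unfold noiseFluct
        generalize ξ.1.2 ⬝ᵥ ξ.1.2 = a
        generalize ξ.2.1.2 ⬝ᵥ ξ.2.1.2 = b
        nlinarith [sq_nonneg (ξ.1.2 ⬝ᵥ ξ.2.1.2), sq_nonneg (a - n - (b - n)),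
          sq_nonneg (a - n - 2 * n), sq_nonneg (b - n - 2 * n)]
      have e1 : (G.tau ^ 2 * (∑ k, G.stepNoise X ξ k ^ 2) / n) ^ 2
          = (G.tau ^ 2) ^ 2 * ((∑ k, G.stepNoise X ξ k ^ 2) ^ 2 / n ^ 2) := by
        rw [div_pow, mul_pow, mul_div_assoc]
      have e2 : (G.tau ^ 2 * cN) ^ 2 * (3 * noiseFluct ξ / (n : ℝ) ^ 2 + 12)
          = (G.tau ^ 2) ^ 2 * (cN ^ 2 * (3 * noiseFluct ξ + 12 * n ^ 2) / n ^ 2) := by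
        field_simp
      rw [e1, e2]
      exact mul_le_mul_of_nonneg_left (div_le_div_of_nonneg_right h2 (by positivity))
        (by positivity)
    have e3 : 12 * (N * (cB * latentSize ξ) * Q) ^ 2 = 12 * (N * cB) ^ 2 * Q ^ 2 * latentSize ξ ^ 2 := by
      ring
    have e4 : 24 * (N * (cB * latentSize ξ) ^ 2 * Q) ^ 2
        = 24 * (N * cB ^ 2) ^ 2 * Q ^ 2 * latentSize ξ ^ 4 := by ring
    have h3 : 12 * (N * cB) ^ 2 * Q ^ 2 * latentSize ξ ^ 2
        ≤ 12 * (N * cB) ^ 2 * Q ^ 2 * latentSize ξ ^ 4 :=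
      mul_le_mul_of_nonneg_left hρ2 (by positivity)
    rw [e3, e4]
    simp only [A1, A2, A3]
    nlinarith
  have hg := ((((hρ n).1.hasMean.const_mul (A1 * Q ^ 2)).add (HasMean.const_mul ⟨ip, hp⟩ A2)).add
    ((((((hν n).1.hasMean.const_mul 3).div_const ((n : ℝ) ^ 2)).add
      (hasMean_const 12)).const_mul A3))).div_const ((n : ℝ) ^ 2)
  have hi : Integrable (fun ξ => G.overlapStep X ξ i j ^ 2) (G.inputLaw n) := by
    refine hg.1.mono' ((measurable_overlapStep hG X i j).pow_const 2).aestronglyMeasurable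
      (Filter.Eventually.of_forall fun ξ => ?_)
    rw [Real.norm_eq_abs, abs_of_nonneg (sq_nonneg _)]
    exact hpt ξ
  refine ⟨hi, (integral_mono hi hg.1 hpt).trans (hg.2.trans_le ?_)⟩
  refine div_le_div_of_nonneg_right ?_ (by positivity)
  have h1 : 3 * (∫ ξ : Sample n d × Sample n d × Sample n d, noiseFluct ξ ∂(G.inputLaw n))
      / (n:ℝ) ^ 2 ≤ 3 * Cν := by
    rw [div_le_iff₀ (by positivity)]
    have := (hν n).2
    have h2 : Cν * n ≤ Cν * n ^ 2 := mul_le_mul_of_nonneg_left (by nlinarith) hCν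
    linarith
  have h2 := mul_le_mul_of_nonneg_left (hρ n).2 (by positivity : 0 ≤ A1 * Q ^ 2)
  have h3 := mul_le_mul_of_nonneg_left h1 hA3
  have h4 : A2 * (2 * Q) ≤ 2 * A2 * (1 + Q ^ 2) := by nlinarith [sq_nonneg (Q - 1)]
  have h5 : 0 ≤ A1 * Cρ := by positivity
  have h6 : 0 ≤ A3 * (3 * Cν + 12) * Q ^ 2 := by positivity
  nlinarith

end GANModel

end InputMoments

/-! ### Mean increments follow the drift. -/

section MeanStep

variable {n d : ℕ} {G : GANModel d} {B : ℝ}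

theorem HasMean.abs_le {α : Type*} [MeasurableSpace α] {μ : Measure α} {φ ψ : α → ℝ} {x y : ℝ}
    (h : HasMean μ φ x) (h' : HasMean μ ψ y) (hle : ∀ a, |φ a| ≤ ψ a) : |x| ≤ y := by
  rw [← h.2, ← h'.2]
  exact (abs_integral_le_integral_abs).trans (integral_mono h.1.abs h'.1 hle)

namespace GANModel

theorem hasMean_sq_rates (hG : G.Regular B) (X : Matrix (Fin n) (MacroIdx d) ℝ) :
    HasMean (G.inputLaw n) (fun ξ => G.etaT * G.f (G.realArg X ξ.1) ^ 2
      + G.etaG * G.ft (G.fakeArg X ξ.2.1) ^ 2) (G.b (overlap X).state) := by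
  have := hG.prob_c
  have := hG.prob_ct
  have hsq : ∀ {θ : ℝ → ℝ} (_ : C2Bdd θ B) {μ : Measure (Fin d → ℝ)} [IsProbabilityMeasure μ]
      (v : Fin d → ℝ) (w : Fin n → ℝ) (η : ℝ),
      HasMean (μ.prod (stdGauss n)) (fun s : Sample n d => θ (s.1 ⬝ᵥ v + √η * (s.2 ⬝ᵥ w)) ^ 2)
        (bracket μ v ((w ⬝ᵥ w) * η) fun _ x => θ x ^ 2) := by
    intro θ hθ μ _ v w η
    have hm := hθ.diff.continuous.measurable.pow_const 2
    refine ⟨Integrable.of_bound (hm.comp (measurable_sampleArg v w (√η))).aestronglyMeasurable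
      (B ^ 2) (Filter.Eventually.of_forall fun s => ?_), integral_of_arg hm v w η⟩
    rw [Real.norm_eq_abs, abs_pow]
    exact pow_le_pow_left₀ (abs_nonneg _) (hθ.bound _) 2
  have h1 := hsq hG.f_bdd (μ := G.Pc) (overlap X).state.q (fun k => X k (wIdx d)) G.etaT
  have h2 := hsq hG.ft_bdd (μ := G.Pct) (overlap X).state.r (fun k => X k (wIdx d)) G.etaG
  have hr := (hG.measurePreserving_real (n := n)).integrable_and_integral h1.1
  have hf := (hG.measurePreserving_fake (n := n)).integrable_and_integral h2.1
  exact (HasMean.const_mul ⟨hr.1, hr.2.trans h1.2⟩ G.etaT).add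
    (HasMean.const_mul ⟨hf.1, hf.2.trans h2.2⟩ G.etaG)

theorem integrable_sum_sq_stepNoise (hG : G.Regular B) (X : Matrix (Fin n) (MacroIdx d) ℝ) :
    Integrable (fun ξ => ∑ k, G.stepNoise X ξ k ^ 2) (G.inputLaw n) := by
  have h := (integrable_normSq_stdGauss n).1
  have h1 := (hG.measurePreserving_realNoise (n := n)).integrable_and_integral h
  have h2 := (hG.measurePreserving_fakeNoise (n := n)).integrable_and_integral h
  refine ((h1.1.add h2.1).const_mul (G.noiseConst B)).mono' ?_
    (Filter.Eventually.of_forall fun ξ => ?_)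
  · exact (Finset.measurable_fun_sum _ fun k _ => (measurable_stepNoise hG (X := fun _ => X)
      (fun _ _ => measurable_const) measurable_id k).pow_const 2).aestronglyMeasurable
  · rw [Real.norm_eq_abs, abs_of_nonneg (Finset.sum_nonneg fun _ _ => sq_nonneg _)]
    exact sum_sq_stepNoise_le hG X ξ

/-- The coefficients depend on the noises whose lengths they multiply, so the mean does not
factorize. Instead the squared lengths are replaced by `n` and the inner product by zero pointwise;
the error is a bounded multiple of fluctuations of order `√n`. -/
theorem exists_sum_sq_stepNoise_mean_bound (hG : G.Regular B) : ∃ C : ℝ, 0 ≤ C ∧ ∀ n : ℕ, 1 ≤ n →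
    ∀ X : Matrix (Fin n) (MacroIdx d) ℝ,
      |∫ ξ, ∑ k, G.stepNoise X ξ k ^ 2 ∂(G.inputLaw n) - n * G.b (overlap X).state| ≤ C * √n := by
  obtain ⟨Cν, hCν, hν⟩ := hG.exists_noiseFluct_bound
  set cN := G.noiseConst B with hcNdef
  have hcN : 0 ≤ cN := hG.noiseConst_nonneg
  refine ⟨cN * ((Cν + 3) / 2), by positivity, fun n hn X => ?_⟩
  have := hG.isProbabilityMeasure_inputLaw n
  have hn0 : (0:ℝ) < n := by exact_mod_cast hn
  have hs : 0 < √(n:ℝ) := Real.sqrt_pos.2 hn0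
  have hss := Real.sq_sqrt hn0.le
  have h1 := (integrable_sum_sq_stepNoise hG X).hasMean.sub ((hasMean_sq_rates hG X).const_mul n)
  have h2 := (((hν n).1.hasMean.div_const √(n:ℝ)).add (hasMean_const (3 * √(n:ℝ)))).const_mul (cN / 2)
  refine (h1.abs_le h2 fun ξ => ?_).trans ?_
  · rw [sum_sq_stepNoise hG]
    have hf := hG.f_bdd.bound (G.realArg X ξ.1)
    have hft := hG.ft_bdd.bound (G.fakeArg X ξ.2.1)
    unfold noiseFluct
    set f := G.f (G.realArg X ξ.1)
    set f' := G.ft (G.fakeArg X ξ.2.1)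
    set x := ξ.1.2 ⬝ᵥ ξ.1.2 - n with hx
    set y := ξ.2.1.2 ⬝ᵥ ξ.2.1.2 - n with hy
    set z := ξ.1.2 ⬝ᵥ ξ.2.1.2
    have e : G.etaT * f ^ 2 * (ξ.1.2 ⬝ᵥ ξ.1.2) + G.etaG * f' ^ 2 * (ξ.2.1.2 ⬝ᵥ ξ.2.1.2)
        - 2 * (√G.etaT * f * (√G.etaG * f')) * z - n * (G.etaT * f ^ 2 + G.etaG * f' ^ 2)
        = G.etaT * f ^ 2 * x + G.etaG * f' ^ 2 * y - 2 * (√G.etaT * f * (√G.etaG * f')) * z := by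
      rw [hx, hy]; ring
    rw [e]
    have hT : G.etaT * f ^ 2 ≤ cN / 2 := by
      have : f ^ 2 ≤ B ^ 2 := by rw [← sq_abs]; exact pow_le_pow_left₀ (abs_nonneg _) hf 2
      rw [hcNdef, noiseConst]
      nlinarith [hG.etaT_nonneg, hG.etaG_nonneg, mul_le_mul_of_nonneg_left this hG.etaT_nonneg,
        mul_nonneg hG.etaG_nonneg (sq_nonneg B)]
    have hT' : G.etaG * f' ^ 2 ≤ cN / 2 := by
      have : f' ^ 2 ≤ B ^ 2 := by rw [← sq_abs]; exact pow_le_pow_left₀ (abs_nonneg _) hft 2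
      rw [hcNdef, noiseConst]
      nlinarith [hG.etaT_nonneg, hG.etaG_nonneg, mul_le_mul_of_nonneg_left this hG.etaG_nonneg,
        mul_nonneg hG.etaT_nonneg (sq_nonneg B)]
    have hT0 : 0 ≤ G.etaT * f ^ 2 := mul_nonneg hG.etaT_nonneg (sq_nonneg _)
    have hG0 : 0 ≤ G.etaG * f' ^ 2 := mul_nonneg hG.etaG_nonneg (sq_nonneg _)
    have hc : |2 * (√G.etaT * f * (√G.etaG * f'))| ≤ cN := by
      have e1 : (√G.etaT * f) ^ 2 = G.etaT * f ^ 2 := by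
        rw [mul_pow, Real.sq_sqrt hG.etaT_nonneg]
      have e2 : (√G.etaG * f') ^ 2 = G.etaG * f' ^ 2 := by
        rw [mul_pow, Real.sq_sqrt hG.etaG_nonneg]
      rw [abs_le]
      constructor <;>
        nlinarith [sq_nonneg (√G.etaT * f + √G.etaG * f'), sq_nonneg (√G.etaT * f - √G.etaG * f')]
    -- The weights make both terms of order `√n` when `u ^ 2` has mean of order `n`.
    have young : ∀ u : ℝ, |u| ≤ (u ^ 2 / √n + √n) / 2 := by
      intro u
      have : |u| * √n ≤ (u ^ 2 + √n ^ 2) / 2 := by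
        nlinarith [sq_nonneg (|u| - √n), sq_abs u]
      rw [← mul_le_mul_iff_left₀ hs]
      have e3 : (u ^ 2 / √n + √n) / 2 * √n = (u ^ 2 + √n ^ 2) / 2 := by field_simp
      rw [e3]; exact this
    have a1 : |G.etaT * f ^ 2 * x| ≤ cN * |x| := by
      rw [abs_mul, abs_of_nonneg hT0]
      exact mul_le_mul_of_nonneg_right (by linarith) (abs_nonneg x)
    have a2 : |G.etaG * f' ^ 2 * y| ≤ cN * |y| := by
      rw [abs_mul, abs_of_nonneg hG0]
      exact mul_le_mul_of_nonneg_right (by linarith) (abs_nonneg y)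
    have a3 : |2 * (√G.etaT * f * (√G.etaG * f')) * z| ≤ cN * |z| := by
      rw [abs_mul]
      exact mul_le_mul_of_nonneg_right hc (abs_nonneg z)
    calc _ ≤ cN * (|x| + |y| + |z|) := by
          refine (abs_sub _ _).trans ?_
          linarith [abs_add_le (G.etaT * f ^ 2 * x) (G.etaG * f' ^ 2 * y)]
      _ ≤ cN * ((x ^ 2 / √n + √n) / 2 + (y ^ 2 / √n + √n) / 2 + (z ^ 2 / √n + √n) / 2) := by
          gcongr <;> exact young _
      _ = _ := by ring
  · have h3 : (∫ ξ : Sample n d × Sample n d × Sample n d, noiseFluct ξ ∂(G.inputLaw n)) / √n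
        ≤ Cν * √n := by
      rw [div_le_iff₀ hs, mul_assoc, ← sq, hss]
      exact (hν n).2
    have h4 := mul_le_mul_of_nonneg_left h3 (by positivity : 0 ≤ cN / 2)
    linarith

/-- The increments of the overlaps follow the drift of the macroscopic state in the mean. -/
theorem exists_overlapStep_mean_bound (hG : G.Regular B) : ∃ C : ℝ, 0 ≤ C ∧ ∀ n : ℕ, 1 ≤ n →
    ∀ (X : Matrix (Fin n) (MacroIdx d) ℝ) (i j : MacroIdx d),
      Integrable (fun ξ => G.overlapStep X ξ i j) (G.inputLaw n) ∧
      |∫ ξ, G.overlapStep X ξ i j ∂(G.inputLaw n) - (n : ℝ)⁻¹ * G.macroDrift (overlap X) i j|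
        ≤ C * (1 + energy X) / (n * √n) := by
  obtain ⟨Cρ, hCρ, hρ⟩ := hG.exists_latentSize_bound
  obtain ⟨Cs, hCs, hs⟩ := exists_sum_sq_stepNoise_mean_bound hG
  set N : ℝ := ((Fintype.card (MacroIdx d) : ℕ) : ℝ) with hN
  set cB := G.genConst B
  set cN := G.noiseConst B
  have hcB : 0 ≤ cB := hG.genConst_nonneg
  have hcN : 0 ≤ cN := hG.noiseConst_nonneg
  refine ⟨N * (cB ^ 2 * Cρ + G.tau ^ 2 * cN * 2) + G.tau ^ 2 * Cs, by positivity,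
    fun n hn X i j => ?_⟩
  have := hG.isProbabilityMeasure_inputLaw n
  have hn1 : (1:ℝ) ≤ n := by exact_mod_cast hn
  have hn0 : (0:ℝ) < n := by linarith
  have hsn : 1 ≤ √(n:ℝ) := Real.one_le_sqrt.2 hn1
  have hss := Real.sq_sqrt hn0.le
  set Q := energy X
  have hQ : 0 ≤ Q := energy_nonneg X
  set ν := G.inputLaw n
  have hD : ∀ k j, Measurable fun ξ => G.stepDir X ξ k j := fun k j =>
    measurable_stepDir hG (X := fun _ => X) (fun _ _ => measurable_const) measurable_id k j
  have hα : ∀ k, Measurable fun ξ => G.stepNoise X ξ k := fun k =>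
    measurable_stepNoise hG (X := fun _ => X) (fun _ _ => measurable_const) measurable_id k
  set S : Sample n d × Sample n d × Sample n d → ℝ := fun ξ =>
    if i = wIdx d ∧ j = wIdx d then G.tau ^ 2 * ∑ k, G.stepNoise X ξ k ^ 2 else 0 with hS
  set s := if i = wIdx d ∧ j = wIdx d then
    G.tau ^ 2 * ∫ ξ, ∑ k, G.stepNoise X ξ k ^ 2 ∂ν else 0 with hs_def
  have mS : HasMean ν S s := by
    rw [hS, hs_def]
    split_ifs
    · exact (integrable_sum_sq_stepNoise hG X).hasMean.const_mul _
    · exact hasMean_const 0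
  -- The quadratic term splits into `S`, the squared length of the noise, and `R`, whose mean is
  -- bounded by a multiple of one plus the energy.
  set R : Sample n d × Sample n d × Sample n d → ℝ := fun ξ =>
    (∑ k, G.stepDir X ξ k i * G.stepDir X ξ k j) - S ξ with hR
  have hRle : ∀ ξ, |R ξ| ≤ N * (cB ^ 2 * (Q + 1) * latentSize ξ ^ 4
      + G.tau ^ 2 * cN * projSize X ξ) := by
    intro ξ
    refine (abs_sum_updateDir_mul_sub_le (τ := G.tau) (abs_stepGen_le hG X ξ)
      (sq_sum_mul_stepNoise_le hG X ξ) i j).trans ?_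
    refine mul_le_mul_of_nonneg_left ?_ (Nat.cast_nonneg _)
    have hρ2 : latentSize ξ ^ 2 ≤ latentSize ξ ^ 4 :=
      pow_le_pow_right₀ (one_le_latentSize ξ) (by norm_num)
    have := mul_le_mul_of_nonneg_left hρ2 (by positivity : 0 ≤ cB ^ 2 * (Q + 1))
    simp only [cB, cN, Q] at *
    linarith
  obtain ⟨ip, hp⟩ := hG.integral_projSize X
  have mb := (((hρ n).1.hasMean.const_mul (cB ^ 2 * (Q + 1))).add
    (HasMean.const_mul ⟨ip, hp⟩ (G.tau ^ 2 * cN))).const_mul N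
  have mR : HasMean ν R (∫ ξ, R ξ ∂ν) := by
    refine ⟨mb.1.mono' (Measurable.aestronglyMeasurable ?_) (Filter.Eventually.of_forall hRle), rfl⟩
    refine (Finset.measurable_fun_sum _ fun k _ => (hD k i).mul (hD k j)).sub ?_
    rw [hS]
    split_ifs
    · exact (Finset.measurable_fun_sum _ fun k _ => (hα k).pow_const 2).const_mul _
    · exact measurable_const
  have hr := mR.abs_le mb hRle
  set r := ∫ ξ, R ξ ∂ν
  have k1 : HasMean ν _ _ := integral_overlap_stepDir hG X i j
  have k2 : HasMean ν _ _ := integral_overlap_stepDir hG X j i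
  have m := ((k1.add k2).const_mul (n:ℝ)⁻¹).add ((mR.add mS).const_mul ((n:ℝ)⁻¹ ^ 2))
  have e : (fun ξ => G.overlapStep X ξ i j) = fun ξ => (n:ℝ)⁻¹ * ((∑ k, X k i * G.stepDir X ξ k j)
      + ∑ k, X k j * G.stepDir X ξ k i) + (n:ℝ)⁻¹ ^ 2 * (R ξ + S ξ) := by
    funext ξ
    rw [overlapStep, overlap_add_smul, hR, sub_add_cancel]
  refine ⟨e ▸ m.1, ?_⟩
  rw [e, m.2]
  have e2 : ∑ l, overlap X j l * G.meanGen (overlap X) l i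
      = ∑ k, overlap X k j * G.meanGen (overlap X) k i :=
    Finset.sum_congr rfl fun k _ => by rw [overlap_symm X j k]
  set b' := if i = wIdx d ∧ j = wIdx d then G.tau ^ 2 * G.b (overlap X).state else 0 with hb'
  have hsb : |s - n * b'| ≤ G.tau ^ 2 * Cs * √n := by
    rw [hs_def, hb']
    split_ifs
    · rw [mul_left_comm, ← mul_sub, abs_mul, abs_of_nonneg (sq_nonneg _), mul_assoc]
      exact mul_le_mul_of_nonneg_left (hs n hn X) (sq_nonneg _)
    · simp only [mul_zero, sub_zero, abs_zero]
      positivity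
  -- The linear terms and `b'` make up the drift exactly. The leftover is at most of order `√n` in
  -- `n`, and division by `n ^ 2` yields the rate `n ^ (-3/2)`.
  have e3 : (n:ℝ)⁻¹ * ((∑ l, overlap X i l * G.meanGen (overlap X) l j)
      + ∑ l, overlap X j l * G.meanGen (overlap X) l i) + (n:ℝ)⁻¹ ^ 2 * (r + s)
      - (n:ℝ)⁻¹ * G.macroDrift (overlap X) i j = (r + (s - n * b')) / n ^ 2 := by
    rw [macroDrift, ← hb', e2]
    field_simp
    ring
  rw [e3, abs_div, abs_of_pos (by positivity : (0:ℝ) < (n:ℝ) ^ 2),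
    div_le_div_iff₀ (by positivity) (by positivity)]
  have h1 : |r| ≤ N * (cB ^ 2 * Cρ + G.tau ^ 2 * cN * 2) * (1 + Q) := by
    refine hr.trans ?_
    rw [mul_assoc N]
    refine mul_le_mul_of_nonneg_left ?_ (Nat.cast_nonneg _)
    have h2 := mul_le_mul_of_nonneg_left (hρ n).2 (by positivity : 0 ≤ cB ^ 2 * (Q + 1))
    have h3 : 0 ≤ G.tau ^ 2 * cN := by positivity
    nlinarith
  have h2 : |r + (s - n * b')| ≤ (N * (cB ^ 2 * Cρ + G.tau ^ 2 * cN * 2) + G.tau ^ 2 * Cs)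
      * (1 + Q) * √n := by
    refine (abs_add_le _ _).trans ?_
    have h3 : 0 ≤ N * (cB ^ 2 * Cρ + G.tau ^ 2 * cN * 2) * (1 + Q) := by positivity
    have h4 : 0 ≤ G.tau ^ 2 * Cs * √n := by positivity
    nlinarith [mul_le_mul_of_nonneg_left hsn h3, mul_nonneg h4 hQ]
  calc _ ≤ (N * (cB ^ 2 * Cρ + G.tau ^ 2 * cN * 2) + G.tau ^ 2 * Cs) * (1 + Q) * √n * (n * √n) :=
        mul_le_mul_of_nonneg_right h2 (by positivity)
    _ = (N * (cB ^ 2 * Cρ + G.tau ^ 2 * cN * 2) + G.tau ^ 2 * Cs) * (1 + Q) * (n * √n ^ 2) := by ring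
    _ = _ := by rw [hss]; ring

end GANModel

end MeanStep

/-! ### Independence of the state and the next inputs. -/

section Independence

variable {n d : ℕ} {G : GANModel d} {B : ℝ}

/-- The σ-algebra on `Ω` is left free, so that it can be the one generated by the sources used in
the first `k` steps. -/
theorem GANModel.measurable_micro {Ω : Type*} [MeasurableSpace Ω] (hG : G.Regular B)
    (X : TrainingData n d Ω) (h0 : ∀ i l, Measurable fun ω => G.micro X 0 ω i l) (k : ℕ)
    (h : ∀ j < k, Measurable (X.input j)) : ∀ i l, Measurable fun ω => G.micro X k ω i l := by
  induction k with
  | zero => exact h0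
  | succ k ih =>
    have ih := ih fun j hj => h j (by omega)
    intro i l
    simp only [micro_succ hG, Matrix.add_apply, Matrix.smul_apply, smul_eq_mul]
    exact (ih i l).add ((measurable_stepDir hG ih (h k (by omega)) i l).const_mul _)

/-- The sources of randomness that determine the state after `k` steps. -/
def Source.past (k : ℕ) : Set Source
  | .init => True
  | .latent j => j < k
  | .noise j => j < k
  | .fakeLatent j => j < 2 * k
  | .fakeNoise j => j < 2 * k

/-- The sources of randomness of the inputs of the `k`-th step. -/
def Source.current (k : ℕ) : Set Source
  | .init => False
  | .latent j => j = k
  | .noise j => j = k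
  | .fakeLatent j => j = 2 * k ∨ j = 2 * k + 1
  | .fakeNoise j => j = 2 * k ∨ j = 2 * k + 1

theorem Source.disjoint_past_current (k : ℕ) : Disjoint (Source.past k) (Source.current k) := by
  rw [Set.disjoint_left]
  rintro (_ | j | j | j | j) h1 h2
  · exact h2
  · change j < k at h1
    change j = k at h2
    omega
  · change j < 2 * k at h1
    change j = 2 * k ∨ j = 2 * k + 1 at h2
    omega
  · change j < k at h1
    change j = k at h2
    omega
  · change j < 2 * k at h1
    change j = 2 * k ∨ j = 2 * k + 1 at h2
    omega

namespace TrainingData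

variable {Ω : Type*} {X : TrainingData n d Ω}

/-- The σ-algebra generated by a set of sources of randomness. -/
abbrev sigmaOf (X : TrainingData n d Ω) (S : Set Source) : MeasurableSpace Ω :=
  ⨆ s ∈ S, X.sigma s

theorem sigma_le_sigmaOf {S : Set Source} {s : Source} (hs : s ∈ S) : X.sigma s ≤ X.sigmaOf S :=
  le_iSup₂ (f := fun s (_ : s ∈ S) => X.sigma s) s hs

theorem measurable_c_sigmaOf {S : Set Source} {k : ℕ} (hs : Source.latent k ∈ S) :
    Measurable[X.sigmaOf S] (X.c k) :=
  (comap_measurable (X.c k)).mono (sigma_le_sigmaOf (X := X) hs) le_rfl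

theorem measurable_ct_sigmaOf {S : Set Source} {k : ℕ} (hs : Source.fakeLatent k ∈ S) :
    Measurable[X.sigmaOf S] (X.ct k) :=
  (comap_measurable (X.ct k)).mono (sigma_le_sigmaOf (X := X) hs) le_rfl

theorem measurable_a_sigmaOf {S : Set Source} {k : ℕ} (hs : Source.noise k ∈ S) :
    Measurable[X.sigmaOf S] (X.a k) :=
  (comap_measurable (X.a k)).mono (sigma_le_sigmaOf (X := X) hs) le_rfl

theorem measurable_at_sigmaOf {S : Set Source} {k : ℕ} (hs : Source.fakeNoise k ∈ S) :
    Measurable[X.sigmaOf S] (X.atil k) :=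
  (comap_measurable (X.atil k)).mono (sigma_le_sigmaOf (X := X) hs) le_rfl

theorem measurable_real_sigmaOf {S : Set Source} {k : ℕ} (h : Source.latent k ∈ S)
    (h' : Source.noise k ∈ S) : Measurable[X.sigmaOf S] fun ω => (X.c k ω, X.a k ω) := by
  let := X.sigmaOf S
  exact Measurable.prodMk (measurable_c_sigmaOf h) (measurable_a_sigmaOf h')

theorem measurable_fake_sigmaOf {S : Set Source} {k : ℕ} (h : Source.fakeLatent k ∈ S)
    (h' : Source.fakeNoise k ∈ S) : Measurable[X.sigmaOf S] fun ω => (X.ct k ω, X.atil k ω) := by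
  let := X.sigmaOf S
  exact Measurable.prodMk (measurable_ct_sigmaOf h) (measurable_at_sigmaOf h')

theorem measurable_fakes_sigmaOf {S : Set Source} {j k : ℕ} (h : Source.fakeLatent j ∈ S)
    (h' : Source.fakeNoise j ∈ S) (h2 : Source.fakeLatent k ∈ S) (h2' : Source.fakeNoise k ∈ S) :
    Measurable[X.sigmaOf S] fun ω => ((X.ct j ω, X.atil j ω), (X.ct k ω, X.atil k ω)) := by
  let := X.sigmaOf S
  exact Measurable.prodMk (measurable_fake_sigmaOf h h') (measurable_fake_sigmaOf h2 h2')

theorem measurable_input_sigmaOf {S : Set Source} {k : ℕ} (hs : Source.current k ⊆ S) :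
    Measurable[X.sigmaOf S] (X.input k) := by
  let := X.sigmaOf S
  refine Measurable.prodMk (measurable_real_sigmaOf (hs ?_) (hs ?_))
    (measurable_fakes_sigmaOf (hs ?_) (hs ?_) (hs ?_) (hs ?_))
  exacts [rfl, rfl, Or.inl rfl, Or.inl rfl, Or.inr rfl, Or.inr rfl]

theorem measurable_micro_zero_sigmaOf {S : Set Source} (hs : Source.init ∈ S)
    (i : Fin n) (l : MacroIdx d) : Measurable[X.sigmaOf S] fun ω => G.micro X 0 ω i l := by
  have h := (comap_measurable (fun ω => ((fun i l => X.U ω i l, fun i l => X.V0 ω i l, X.w0 ω) :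
      (Fin n → Fin d → ℝ) × (Fin n → Fin d → ℝ) × (Fin n → ℝ)))).mono
    (sigma_le_sigmaOf (X := X) hs) le_rfl
  rcases l with l | l | l
  · exact ((measurable_pi_apply l).comp ((measurable_pi_apply i).comp measurable_fst)).comp h
  · exact ((measurable_pi_apply l).comp ((measurable_pi_apply i).comp
      (measurable_fst.comp measurable_snd))).comp h
  · exact ((measurable_pi_apply i).comp (measurable_snd.comp measurable_snd)).comp h

theorem measurable_micro_past (hG : G.Regular B) (k : ℕ) (i : Fin n) (l : MacroIdx d) :
    Measurable[X.sigmaOf (Source.past k)] fun ω => G.micro X k ω i l := by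
  let := X.sigmaOf (Source.past k)
  have hp : Source.init ∈ Source.past k := trivial
  refine GANModel.measurable_micro hG X (fun i l => measurable_micro_zero_sigmaOf hp i l) k
    (fun j hj => measurable_input_sigmaOf ?_) i l
  rintro (_ | i | i | i | i) h
  · exact h.elim
  · change i = j at h
    change i < k
    omega
  · change i = 2 * j ∨ i = 2 * j + 1 at h
    change i < 2 * k
    omega
  · change i = j at h
    change i < k
    omega
  · change i = 2 * j ∨ i = 2 * j + 1 at h
    change i < 2 * k
    omega

namespace IsValid

variable [MeasurableSpace Ω] {Pr : Measure Ω}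

theorem sigma_le (hX : X.IsValid G Pr) (s : Source) : X.sigma s ≤ ‹MeasurableSpace Ω› := by
  rcases s with _ | k | k | k | k
  · refine Measurable.comap_le (Measurable.prodMk ?_ (Measurable.prodMk ?_ hX.measurable_w0))
    · exact measurable_pi_lambda _ fun i => measurable_pi_lambda _ fun l => hX.measurable_U i l
    · exact measurable_pi_lambda _ fun i => measurable_pi_lambda _ fun l => hX.measurable_V0 i l
  · exact (hX.measurable_c k).comap_le
  · exact (hX.measurable_ct k).comap_le
  · exact (hX.measurable_a k).comap_le
  · exact (hX.measurable_at k).comap_le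

theorem sigmaOf_le (hX : X.IsValid G Pr) (S : Set Source) :
    X.sigmaOf S ≤ ‹MeasurableSpace Ω› :=
  iSup₂_le fun s _ => hX.sigma_le s

variable [IsProbabilityMeasure Pr]

/-- Disjoint families of sources generate independent σ-algebras, and independence means that the
joint law is a product. -/
theorem map_prod (hX : X.IsValid G Pr) {S T : Set Source} (hST : Disjoint S T) {α β : Type*}
    [MeasurableSpace α] [MeasurableSpace β] {φ : Ω → α} {ψ : Ω → β}
    (hφ : Measurable[X.sigmaOf S] φ) (hψ : Measurable[X.sigmaOf T] ψ) :
    Pr.map (fun ω => (φ ω, ψ ω)) = (Pr.map φ).prod (Pr.map ψ) := by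
  have h := indep_iSup_of_disjoint hX.sigma_le hX.indep hST
  have hi : IndepFun φ ψ Pr := by
    rw [IndepFun_iff_Indep]
    exact indep_of_indep_of_le_left (indep_of_indep_of_le_right h hψ.comap_le) hφ.comap_le
  exact (indepFun_iff_map_prod_eq_prod_map_map
    (hφ.mono (hX.sigmaOf_le S) le_rfl).aemeasurable
    (hψ.mono (hX.sigmaOf_le T) le_rfl).aemeasurable).1 hi

theorem map_real (hX : X.IsValid G Pr) (k : ℕ) :
    Pr.map (fun ω => (X.c k ω, X.a k ω)) = G.Pc.prod (stdGauss n) := by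
  rw [hX.map_prod (S := {Source.latent k}) (T := {Source.noise k}) (by simp)
    (measurable_c_sigmaOf rfl) (measurable_a_sigmaOf rfl), hX.law_c, hX.law_a]

theorem map_fake (hX : X.IsValid G Pr) (k : ℕ) :
    Pr.map (fun ω => (X.ct k ω, X.atil k ω)) = G.Pct.prod (stdGauss n) := by
  rw [hX.map_prod (S := {Source.fakeLatent k}) (T := {Source.fakeNoise k}) (by simp)
    (measurable_ct_sigmaOf rfl) (measurable_at_sigmaOf rfl), hX.law_ct, hX.law_at]

theorem map_input (hX : X.IsValid G Pr) (k : ℕ) : Pr.map (X.input k) = G.inputLaw n := by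
  have h1 := hX.map_prod (S := {Source.fakeLatent (2 * k), Source.fakeNoise (2 * k)})
    (T := {Source.fakeLatent (2 * k + 1), Source.fakeNoise (2 * k + 1)}) (by simp)
    (measurable_fake_sigmaOf (k := 2 * k) (by simp) (by simp))
    (measurable_fake_sigmaOf (k := 2 * k + 1) (by simp) (by simp))
  have h2 := hX.map_prod (S := {Source.latent k, Source.noise k})
    (T := {Source.fakeLatent (2 * k), Source.fakeNoise (2 * k),
      Source.fakeLatent (2 * k + 1), Source.fakeNoise (2 * k + 1)}) (by simp)
    (measurable_real_sigmaOf (k := k) (by simp) (by simp))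
    (measurable_fakes_sigmaOf (j := 2 * k) (k := 2 * k + 1) (by simp) (by simp) (by simp)
      (by simp))
  rw [h1, hX.map_real, hX.map_fake, hX.map_fake] at h2
  exact h2

/-- The state depends on the sources used before step `k`, among the fake samples those with index
below `2 * k`. The step itself draws only fresh sources. -/
theorem map_micro_input (hX : X.IsValid G Pr) (hG : G.Regular B) (k : ℕ) :
    Pr.map (fun ω => ((fun i l => G.micro X k ω i l : Fin n → MacroIdx d → ℝ), X.input k ω))
      = (Pr.map fun ω => (fun i l => G.micro X k ω i l : Fin n → MacroIdx d → ℝ)).prod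
        (G.inputLaw n) := by
  rw [hX.map_prod (Source.disjoint_past_current k) ?_ (measurable_input_sigmaOf subset_rfl),
    hX.map_input]
  exact @measurable_pi_lambda _ _ _ (X.sigmaOf _) _ _ fun i =>
    @measurable_pi_lambda _ _ _ (X.sigmaOf _) _ _ fun l => measurable_micro_past hG k i l

theorem measurable_input (hX : X.IsValid G Pr) (k : ℕ) : Measurable (X.input k) :=
  ((hX.measurable_c _).prodMk (hX.measurable_a _)).prodMk
    (((hX.measurable_ct _).prodMk (hX.measurable_at _)).prodMk
      ((hX.measurable_ct _).prodMk (hX.measurable_at _)))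

theorem measurable_micro (hX : X.IsValid G Pr) (hG : G.Regular B) (k : ℕ) (i : Fin n)
    (l : MacroIdx d) : Measurable fun ω => G.micro X k ω i l :=
  (measurable_micro_past hG k i l).mono (hX.sigmaOf_le _) le_rfl

theorem measurable_macro (hX : X.IsValid G Pr) (hG : G.Regular B) (k : ℕ) :
    Measurable fun ω => overlap (G.micro X k ω) :=
  measurable_pi_lambda _ fun i => measurable_pi_lambda _ fun j =>
    GANModel.measurable_overlap (hX.measurable_micro hG k) i j

/-- A bound on the conditional mean of a function of the next macroscopic state gives a bound on
its mean. -/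
theorem lintegral_macro_succ_le (hX : X.IsValid G Pr) (hG : G.Regular B) (k : ℕ)
    {ψ R : Macro d → ℝ} (hψ : Measurable ψ) (hψ0 : ∀ M, 0 ≤ ψ M)
    (h : ∀ Y : Matrix (Fin n) (MacroIdx d) ℝ,
      Integrable (fun ξ => ψ (overlap (Y + (n : ℝ)⁻¹ • G.stepDir Y ξ))) (G.inputLaw n) ∧
      ∫ ξ, ψ (overlap (Y + (n : ℝ)⁻¹ • G.stepDir Y ξ)) ∂(G.inputLaw n) ≤ R (overlap Y)) :
    ∫⁻ ω, ENNReal.ofReal (ψ (overlap (G.micro X (k + 1) ω))) ∂Pr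
      ≤ ∫⁻ ω, ENNReal.ofReal (R (overlap (G.micro X k ω))) ∂Pr := by
  have := hG.isProbabilityMeasure_inputLaw n
  set Φ : (Fin n → MacroIdx d → ℝ) × (Sample n d × Sample n d × Sample n d) → ENNReal := fun p =>
    ENNReal.ofReal (ψ (overlap (Matrix.of p.1 + (n : ℝ)⁻¹ • G.stepDir (Matrix.of p.1) p.2)))
    with hΦ
  have hY : ∀ k i, Measurable fun p : (Fin n → MacroIdx d → ℝ) ×
      (Sample n d × Sample n d × Sample n d) => (Matrix.of p.1) k i := fun k i => by
    simp only [Matrix.of_apply]; fun_prop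
  have mΦ : Measurable Φ := by
    refine (hψ.comp (measurable_pi_lambda _ fun i => measurable_pi_lambda _ fun j =>
      GANModel.measurable_overlap (fun k l => ?_) i j)).ennreal_ofReal
    exact (hY k l).add ((GANModel.measurable_stepDir hG hY measurable_snd k l).const_mul _)
  have mm : Measurable fun ω => (fun i l => G.micro X k ω i l : Fin n → MacroIdx d → ℝ) :=
    measurable_pi_lambda _ fun i => measurable_pi_lambda _ fun l => hX.measurable_micro hG k i l
  -- Tonelli for the product law takes the place of conditional expectation. With extended
  -- nonnegative integrals the state need not be known to have moments.
  calc ∫⁻ ω, ENNReal.ofReal (ψ (overlap (G.micro X (k + 1) ω))) ∂Pr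
      = ∫⁻ ω, Φ ((fun i l => G.micro X k ω i l), X.input k ω) ∂Pr := by
        refine lintegral_congr fun ω => ?_
        rw [GANModel.micro_succ hG]; rfl
    _ = ∫⁻ p, Φ p ∂(Pr.map fun ω => ((fun i l => G.micro X k ω i l : Fin n → MacroIdx d → ℝ),
          X.input k ω)) := (lintegral_map mΦ (mm.prodMk (hX.measurable_input k))).symm
    _ = ∫⁻ Y, ∫⁻ ξ, Φ (Y, ξ) ∂(G.inputLaw n)
          ∂(Pr.map fun ω => (fun i l => G.micro X k ω i l : Fin n → MacroIdx d → ℝ)) := by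
        rw [hX.map_micro_input hG, lintegral_prod _ mΦ.aemeasurable]
    _ = ∫⁻ ω, ∫⁻ ξ, Φ ((fun i l => G.micro X k ω i l), ξ) ∂(G.inputLaw n) ∂Pr :=
        lintegral_map mΦ.lintegral_prod_right' mm
    _ ≤ _ := by
        refine lintegral_mono fun ω => ?_
        obtain ⟨h1, h2⟩ := h (G.micro X k ω)
        change ∫⁻ ξ, ENNReal.ofReal (ψ (overlap (G.micro X k ω
          + (n : ℝ)⁻¹ • G.stepDir (G.micro X k ω) ξ))) ∂(G.inputLaw n) ≤ _
        rw [← ofReal_integral_eq_lintegral_ofReal h1 (Filter.Eventually.of_forall fun _ => hψ0 _)]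
        exact ENNReal.ofReal_le_ofReal h2

end IsValid

end TrainingData

end Independence

/-! ### One-step inequalities for the trace and for the error. -/

section OneStep

variable {n d : ℕ} {G : GANModel d} {B : ℝ}

theorem HasMean.integrable_of_le {α : Type*} [MeasurableSpace α] {μ : Measure α} {φ ψ : α → ℝ}
    {y z : ℝ} (h : HasMean μ ψ y) (hφ : Measurable φ) (hφ0 : ∀ a, 0 ≤ φ a) (hle : ∀ a, φ a ≤ ψ a)
    (hy : y ≤ z) : Integrable φ μ ∧ ∫ a, φ a ∂μ ≤ z := by
  have hi : Integrable φ μ := h.1.mono' hφ.aestronglyMeasurable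
    (Filter.Eventually.of_forall fun a => by
      rw [Real.norm_eq_abs, abs_of_nonneg (hφ0 a)]; exact hle a)
  exact ⟨hi, (integral_mono hi h.1 hle).trans (h.2.trans_le hy)⟩

/-- The trace of a macroscopic state. -/
def Macro.trace (M : Macro d) : ℝ := ∑ i, M i i

theorem Macro.measurable_trace : Measurable (Macro.trace (d := d)) :=
  Finset.measurable_fun_sum _ fun i _ => (measurable_pi_apply i).comp (measurable_pi_apply i)

theorem energy_eq_trace (X : Matrix (Fin n) (MacroIdx d) ℝ) : energy X = (overlap X).trace :=
  energy_eq_sum_overlap X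

/-- A smoothed Euclidean norm on macroscopic states. -/
noncomputable def smoothNorm (ε : ℝ) (e : Macro d) : ℝ := √(∑ i, ∑ j, e i j ^ 2 + ε)

theorem measurable_smoothNorm (ε : ℝ) : Measurable (smoothNorm (d := d) ε) := by
  unfold smoothNorm
  refine Measurable.sqrt ((Finset.measurable_fun_sum _ fun i _ =>
    Finset.measurable_fun_sum _ fun j _ => Measurable.pow_const ?_ 2).add_const ε)
  exact (measurable_pi_apply j).comp (measurable_pi_apply i)

theorem smoothNorm_nonneg (ε : ℝ) (e : Macro d) : 0 ≤ smoothNorm ε e := Real.sqrt_nonneg _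

theorem sum_sq_nonneg (e : Macro d) : 0 ≤ ∑ i, ∑ j, e i j ^ 2 :=
  Finset.sum_nonneg fun _ _ => Finset.sum_nonneg fun _ _ => sq_nonneg _

theorem abs_le_smoothNorm {ε : ℝ} (hε : 0 ≤ ε) (e : Macro d) (i j : MacroIdx d) :
    |e i j| ≤ smoothNorm ε e := by
  refine Real.abs_le_sqrt ?_
  have h1 := Finset.single_le_sum (f := fun j => e i j ^ 2) (fun _ _ => sq_nonneg _)
    (Finset.mem_univ j)
  have h2 := Finset.single_le_sum (f := fun i => ∑ j, e i j ^ 2)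
    (fun _ _ => Finset.sum_nonneg fun _ _ => sq_nonneg _) (Finset.mem_univ i)
  linarith

theorem sqrt_le_smoothNorm (ε : ℝ) (e : Macro d) : √ε ≤ smoothNorm ε e :=
  Real.sqrt_le_sqrt (by linarith [sum_sq_nonneg e])

/-- This is `b ≤ (a² + b²) / (2 a)` for the smoothed norms `a` before and `b` after the increment.
The smoothing keeps the denominators at least of order `√ε`. -/
theorem smoothNorm_add_le {ε : ℝ} (hε : 0 < ε) (e δ : Macro d) :
    smoothNorm ε (e + δ) ≤ smoothNorm ε e + ((∑ i, ∑ j, e i j * δ i j) / smoothNorm ε e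
      + (∑ i, ∑ j, δ i j ^ 2) / (2 * smoothNorm ε e)) := by
  have ha : 0 < smoothNorm ε e := (Real.sqrt_pos.2 hε).trans_le (sqrt_le_smoothNorm ε e)
  have hsq : smoothNorm ε e ^ 2 = ∑ i, ∑ j, e i j ^ 2 + ε :=
    Real.sq_sqrt (by linarith [sum_sq_nonneg e])
  have hsq' : smoothNorm ε (e + δ) ^ 2 = ∑ i, ∑ j, (e + δ) i j ^ 2 + ε :=
    Real.sq_sqrt (by linarith [sum_sq_nonneg (e + δ)])
  have hexp : ∑ i, ∑ j, (e + δ) i j ^ 2 = ∑ i, ∑ j, e i j ^ 2 + 2 * ∑ i, ∑ j, e i j * δ i j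
      + ∑ i, ∑ j, δ i j ^ 2 := by
    simp only [Finset.mul_sum, ← Finset.sum_add_distrib, Pi.add_apply]
    exact Finset.sum_congr rfl fun _ _ => Finset.sum_congr rfl fun _ _ => by ring
  have e1 : smoothNorm ε e + ((∑ i, ∑ j, e i j * δ i j) / smoothNorm ε e
      + (∑ i, ∑ j, δ i j ^ 2) / (2 * smoothNorm ε e))
      = (smoothNorm ε e ^ 2 + smoothNorm ε (e + δ) ^ 2) / (2 * smoothNorm ε e) := by
    have h2 : smoothNorm ε (e + δ) ^ 2 = smoothNorm ε e ^ 2 + 2 * ∑ i, ∑ j, e i j * δ i j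
      + ∑ i, ∑ j, δ i j ^ 2 := by rw [hsq', hexp, hsq]; ring
    rw [h2]
    field_simp
    ring
  rw [e1, le_div_iff₀ (by positivity)]
  nlinarith [sq_nonneg (smoothNorm ε e - smoothNorm ε (e + δ))]

namespace GANModel

theorem overlap_step (X : Matrix (Fin n) (MacroIdx d) ℝ)
    (ξ : Sample n d × Sample n d × Sample n d) :
    overlap (X + (n : ℝ)⁻¹ • G.stepDir X ξ) = overlap X + G.overlapStep X ξ := by
  ext i j
  simp [overlapStep]

/-- Second moments suffice: `2 q s ≤ q² / n + n s²`, where the change `s` of the trace `q` has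
second moment `O((1 + q²) / n²)`. -/
theorem exists_trace_step_bound (hG : G.Regular B) : ∃ K : ℝ, 0 ≤ K ∧ ∀ n : ℕ, 1 ≤ n →
    ∀ X : Matrix (Fin n) (MacroIdx d) ℝ,
      Integrable (fun ξ => 1 + (overlap (X + (n : ℝ)⁻¹ • G.stepDir X ξ)).trace ^ 2)
        (G.inputLaw n) ∧
      ∫ ξ, 1 + (overlap (X + (n : ℝ)⁻¹ • G.stepDir X ξ)).trace ^ 2 ∂(G.inputLaw n)
        ≤ (1 + K / n) * (1 + (overlap X).trace ^ 2) := by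
  obtain ⟨C, hC, hs⟩ := exists_overlapStep_sq_bound hG
  set N : ℝ := ((Fintype.card (MacroIdx d) : ℕ) : ℝ) with hN
  refine ⟨1 + 2 * N ^ 2 * C, by positivity, fun n hn X => ?_⟩
  have := hG.isProbabilityMeasure_inputLaw n
  have hn1 : (1:ℝ) ≤ n := by exact_mod_cast hn
  have hn0 : (0:ℝ) < n := by linarith
  have m := (hasMean_const (μ := G.inputLaw n) (1 + (1 + (n:ℝ)⁻¹) * (overlap X).trace ^ 2)).add
    ((HasMean.sum fun i (_ : i ∈ Finset.univ) =>
      (hs n hn X i i).1.hasMean).const_mul (2 * n * N))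
  refine m.integrable_of_le ?_ (fun ξ => by positivity) (fun ξ => ?_) ?_
  · simp only [overlap_step]
    refine ((Macro.measurable_trace.comp (measurable_const.add (measurable_pi_lambda _ fun i =>
      measurable_pi_lambda _ fun j => measurable_overlapStep hG X i j))).pow_const 2).const_add 1
  · have e : (overlap (X + (n : ℝ)⁻¹ • G.stepDir X ξ)).trace
        = (overlap X).trace + ∑ i, G.overlapStep X ξ i i := by
      rw [overlap_step]
      simp [Macro.trace, Finset.sum_add_distrib]
    rw [e]
    have h1 := sq_sum_le_card_mul_sum_sq (s := Finset.univ) (f := fun i => G.overlapStep X ξ i i)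
    rw [Finset.card_univ] at h1
    set q := (overlap X).trace
    set s := ∑ i, G.overlapStep X ξ i i
    have h2 : 2 * q * s ≤ (n:ℝ)⁻¹ * q ^ 2 + n * s ^ 2 := by
      have e2 : (n:ℝ)⁻¹ * q ^ 2 + n * s ^ 2 - 2 * q * s = (n:ℝ)⁻¹ * (q - n * s) ^ 2 := by
        field_simp; ring
      have : 0 ≤ (n:ℝ)⁻¹ * (q - n * s) ^ 2 := by positivity
      linarith
    have h3 : s ^ 2 ≤ n * s ^ 2 := le_mul_of_one_le_left (sq_nonneg s) hn1
    have h4 := mul_le_mul_of_nonneg_left h1 (by positivity : (0:ℝ) ≤ 2 * n)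
    rw [← hN] at h4
    nlinarith
  · have h1 : ∑ i, ∫ ξ, G.overlapStep X ξ i i ^ 2 ∂(G.inputLaw n)
        ≤ N * (C * (1 + energy X ^ 2) / (n:ℝ) ^ 2) :=
      (Finset.sum_le_card_nsmul _ _ _ fun i _ => (hs n hn X i i).2).trans (by simp [hN])
    have h2 := mul_le_mul_of_nonneg_left h1 (by positivity : 0 ≤ 2 * n * N)
    rw [energy_eq_trace] at h2
    set q := (overlap X).trace
    have e3 : 2 * n * N * (N * (C * (1 + q ^ 2) / (n:ℝ) ^ 2))
        = (n:ℝ)⁻¹ * (2 * N ^ 2 * C) * (1 + q ^ 2) := by field_simp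
    rw [e3] at h2
    have h3 : 0 ≤ (n:ℝ)⁻¹ := by positivity
    rw [div_eq_inv_mul]
    nlinarith

set_option maxHeartbeats 1000000 in
-- Here `m` and `m'` will be consecutive grid values of the ODE solution. The linear term pairs `e /
-- Ψ`, with entries at most one, with the mean of `δ`, which is a difference of drifts of size `L Ψ
-- / n` plus `O(n ^ (-3/2))`. The quadratic term has mean `O(n⁻²)` and is divided by `Ψ ≥ 1 / √n`.
theorem exists_smoothNorm_step_bound (hG : G.Regular B) {R : ℝ} (hR : 0 ≤ R) :
    ∃ K : ℝ, 0 ≤ K ∧ ∀ n : ℕ, 1 ≤ n → ∀ m m' : Macro d, ‖m‖ ≤ R → ‖G.macroDrift m‖ ≤ R →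
      ‖m' - m - (n : ℝ)⁻¹ • G.macroDrift m‖ ≤ R * (n : ℝ)⁻¹ ^ 2 →
      ∀ X : Matrix (Fin n) (MacroIdx d) ℝ,
        Integrable (fun ξ => smoothNorm (n : ℝ)⁻¹ (overlap (X + (n : ℝ)⁻¹ • G.stepDir X ξ) - m'))
          (G.inputLaw n) ∧
        ∫ ξ, smoothNorm (n : ℝ)⁻¹ (overlap (X + (n : ℝ)⁻¹ • G.stepDir X ξ) - m') ∂(G.inputLaw n)
          ≤ (1 + K / n) * smoothNorm (n : ℝ)⁻¹ (overlap X - m)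
            + K / (n * √n) * (1 + (overlap X).trace ^ 2) := by
  obtain ⟨C, hC, hs⟩ := exists_overlapStep_sq_bound hG
  obtain ⟨C', hC', hs'⟩ := exists_overlapStep_mean_bound hG
  obtain ⟨L, hL, hlip⟩ := hG.semiLip_macroDrift R
  set N : ℝ := ((Fintype.card (MacroIdx d) : ℕ) : ℝ) with hN
  have hN0 : 0 ≤ N := Nat.cast_nonneg _
  refine ⟨N * (N * (2 * C' + R)) + N * (N * (C + 4 * R ^ 2)) + N * (N * L), by positivity,
    fun n hn m m' hm hΦm hm' X => ?_⟩
  have := hG.isProbabilityMeasure_inputLaw n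
  have hn1 : (1:ℝ) ≤ n := by exact_mod_cast hn
  have hn0 : (0:ℝ) < n := by linarith
  have hsn : 0 < √(n:ℝ) := Real.sqrt_pos.2 hn0
  have hss := Real.sq_sqrt hn0.le
  have hε : 0 < (n:ℝ)⁻¹ := by positivity
  have hε1 : (n:ℝ)⁻¹ ≤ 1 := inv_le_one_of_one_le₀ hn1
  set e := overlap X - m with he
  set Ψ := smoothNorm (n:ℝ)⁻¹ e with hΨdef
  have hΨ : (√(n:ℝ))⁻¹ ≤ Ψ := by
    rw [← Real.sqrt_inv]; exact sqrt_le_smoothNorm _ _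
  have hΨ0 : 0 < Ψ := (inv_pos.2 hsn).trans_le hΨ
  have hΨ1 : 1 / Ψ ≤ √n := by
    rw [div_le_iff₀ hΨ0]
    have := mul_le_mul_of_nonneg_left hΨ hsn.le
    rwa [mul_inv_cancel₀ hsn.ne'] at this
  set q := (overlap X).trace
  have hq : energy X = q := energy_eq_trace X
  have hq0 : 0 ≤ q := hq ▸ energy_nonneg X
  set κ := 1 / (n * √(n:ℝ)) with hκ
  have hκ0 : 0 < κ := by positivity
  have hεκ : (n:ℝ)⁻¹ ^ 2 ≤ κ := by
    rw [hκ, inv_pow, ← one_div, sq]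
    refine one_div_le_one_div_of_le (by positivity) (mul_le_mul_of_nonneg_left ?_ hn0.le)
    nlinarith [Real.one_le_sqrt.2 hn1]
  set δ : Sample n d × Sample n d × Sample n d → Macro d := fun ξ =>
    G.overlapStep X ξ - (m' - m) with hδ
  have hstep : ∀ ξ, overlap (X + (n : ℝ)⁻¹ • G.stepDir X ξ) - m' = e + δ ξ := fun ξ => by
    rw [overlap_step, he]
    ext i j
    simp only [hδ, Pi.add_apply, Pi.sub_apply]
    ring
  simp only [hstep]
  have mδ : ∀ i j, Measurable fun ξ => δ ξ i j := fun i j =>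
    (measurable_overlapStep hG X i j).sub measurable_const
  have h1 : ∀ i j, HasMean (G.inputLaw n) (fun ξ => δ ξ i j)
      (∫ ξ, G.overlapStep X ξ i j ∂(G.inputLaw n) - (m' - m) i j) := fun i j =>
    (hs' n hn X i j).1.hasMean.sub (hasMean_const _)
  have hmean : ∀ i j, |∫ ξ, G.overlapStep X ξ i j ∂(G.inputLaw n) - (m' - m) i j|
      ≤ κ * (C' * (1 + q) + R) + (n:ℝ)⁻¹ * L * Ψ := by
    intro i j
    have a1 := (hs' n hn X i j).2
    rw [hq] at a1
    have a2 : |(m' - m - (n : ℝ)⁻¹ • G.macroDrift m) i j| ≤ R * κ :=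
      (abs_coord_le _ i j).trans (hm'.trans (mul_le_mul_of_nonneg_left hεκ hR))
    -- Only `m` is bounded here; the overlap of the random state may be arbitrarily large.
    have a3 : |(G.macroDrift (overlap X) - G.macroDrift m) i j| ≤ L * Ψ := by
      refine (abs_coord_le _ i j).trans ((hlip m (overlap X) hm).trans
        (mul_le_mul_of_nonneg_left ?_ hL))
      refine (pi_norm_le_iff_of_nonneg hΨ0.le).2 fun i => (pi_norm_le_iff_of_nonneg hΨ0.le).2
        fun j => abs_le_smoothNorm hε.le e i j
    have a4 := mul_le_mul_of_nonneg_left a3 hε.le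
    rw [← abs_of_pos hε, ← abs_mul, abs_of_pos hε] at a4
    have e1 : ∫ ξ, G.overlapStep X ξ i j ∂(G.inputLaw n) - (m' - m) i j
        = (∫ ξ, G.overlapStep X ξ i j ∂(G.inputLaw n) - (n : ℝ)⁻¹ * G.macroDrift (overlap X) i j)
          + (n : ℝ)⁻¹ * (G.macroDrift (overlap X) - G.macroDrift m) i j
          + -(m' - m - (n : ℝ)⁻¹ • G.macroDrift m) i j := by
      simp only [Pi.sub_apply, Pi.smul_apply, smul_eq_mul]
      ring
    rw [e1]
    refine (abs_add_three _ _ _).trans ?_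
    rw [abs_neg]
    have e2 : C' * (1 + q) / (n * √n) = κ * (C' * (1 + q)) := by rw [hκ]; ring
    rw [e2] at a1
    linarith
  have hd : ∀ i j, |(m' - m) i j| ≤ 2 * R * (n:ℝ)⁻¹ := by
    intro i j
    have a1 := (abs_coord_le _ i j).trans hm'
    have a2 := (abs_coord_le _ i j).trans hΦm
    have e1 : (m' - m) i j = (m' - m - (n : ℝ)⁻¹ • G.macroDrift m) i j
        + (n:ℝ)⁻¹ * G.macroDrift m i j := by
      simp [Pi.sub_apply, Pi.smul_apply, smul_eq_mul]
    rw [e1]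
    refine (abs_add_le _ _).trans ?_
    rw [abs_mul, abs_of_pos hε]
    have a3 := mul_le_mul_of_nonneg_left a2 hε.le
    have a4 : R * (n:ℝ)⁻¹ ^ 2 ≤ R * (n:ℝ)⁻¹ := by
      refine mul_le_mul_of_nonneg_left ?_ hR
      nlinarith
    linarith
  have h2 : ∀ i j, HasMean (G.inputLaw n) (fun ξ => δ ξ i j ^ 2)
      (∫ ξ, δ ξ i j ^ 2 ∂(G.inputLaw n)) ∧
      ∫ ξ, δ ξ i j ^ 2 ∂(G.inputLaw n) ≤ (n:ℝ)⁻¹ ^ 2 * (2 * C + 8 * R ^ 2) * (1 + q ^ 2) := by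
    intro i j
    have mb := ((hs n hn X i j).1.hasMean.const_mul 2).add
      (hasMean_const (2 * (2 * R * (n:ℝ)⁻¹) ^ 2))
    have := mb.integrable_of_le (φ := fun ξ => δ ξ i j ^ 2) ((mδ i j).pow_const 2)
      (fun ξ => sq_nonneg _) (fun ξ => ?_)
      (z := (n:ℝ)⁻¹ ^ 2 * (2 * C + 8 * R ^ 2) * (1 + q ^ 2)) ?_
    · exact ⟨this.1.hasMean, this.2⟩
    · have a1 := pow_le_pow_left₀ (abs_nonneg _) (hd i j) 2
      rw [sq_abs] at a1
      simp only [hδ, Pi.sub_apply] at a1 ⊢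
      nlinarith [sq_nonneg (G.overlapStep X ξ i j + (m' i j - m i j))]
    · have a1 := (hs n hn X i j).2
      rw [hq, div_eq_inv_mul, ← inv_pow] at a1
      have a2 : 0 ≤ (n:ℝ)⁻¹ ^ 2 * (8 * R ^ 2) * q ^ 2 := by positivity
      nlinarith
  have mlin := (HasMean.sum fun i (_ : i ∈ Finset.univ) => HasMean.sum fun j
    (_ : j ∈ Finset.univ) => (h1 i j).const_mul (e i j)).div_const Ψ
  have mquad := (HasMean.sum fun i (_ : i ∈ Finset.univ) => HasMean.sum fun j
    (_ : j ∈ Finset.univ) => (h2 i j).1).div_const (2 * Ψ)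
  have mtot := (hasMean_const (μ := G.inputLaw n) Ψ).add (mlin.add mquad)
  refine mtot.integrable_of_le ?_ (fun ξ => smoothNorm_nonneg _ _)
    (fun ξ => smoothNorm_add_le hε e (δ ξ)) ?_
  · exact (measurable_smoothNorm _).comp (measurable_const.add (measurable_pi_lambda _ fun i =>
      measurable_pi_lambda _ fun j => mδ i j))
  · have hlin : (∑ i, ∑ j, e i j * (∫ ξ, G.overlapStep X ξ i j ∂(G.inputLaw n) - (m' - m) i j)) / Ψ
        ≤ N * (N * (κ * (C' * (1 + q) + R) + (n:ℝ)⁻¹ * L * Ψ)) := by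
      rw [Finset.sum_div]
      refine (Finset.sum_le_card_nsmul _ _
        (N * (κ * (C' * (1 + q) + R) + (n:ℝ)⁻¹ * L * Ψ)) fun i _ => ?_).trans (by rw [Finset.card_univ, nsmul_eq_mul])
      rw [Finset.sum_div]
      refine (Finset.sum_le_card_nsmul _ _
        (κ * (C' * (1 + q) + R) + (n:ℝ)⁻¹ * L * Ψ) fun j _ => ?_).trans (by rw [Finset.card_univ, nsmul_eq_mul])
      rw [div_le_iff₀ hΨ0, mul_comm _ Ψ]
      refine (le_abs_self _).trans ?_
      rw [abs_mul]
      exact mul_le_mul (abs_le_smoothNorm hε.le e i j) (hmean i j) (abs_nonneg _) hΨ0.le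
    have hquad : (∑ i, ∑ j, ∫ ξ, δ ξ i j ^ 2 ∂(G.inputLaw n)) / (2 * Ψ)
        ≤ N * (N * (κ * (C + 4 * R ^ 2) * (1 + q ^ 2))) := by
      have a1 : ∑ i, ∑ j, ∫ ξ, δ ξ i j ^ 2 ∂(G.inputLaw n)
          ≤ N * (N * ((n:ℝ)⁻¹ ^ 2 * (2 * C + 8 * R ^ 2) * (1 + q ^ 2))) := by
        refine (Finset.sum_le_card_nsmul _ _ (N * ((n:ℝ)⁻¹ ^ 2 * (2 * C + 8 * R ^ 2) * (1 + q ^ 2)))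
          fun i _ => ?_).trans (by rw [Finset.card_univ, nsmul_eq_mul])
        exact (Finset.sum_le_card_nsmul _ _ _ fun j _ => (h2 i j).2).trans (by rw [Finset.card_univ, nsmul_eq_mul])
      have a0 : 0 ≤ ∑ i, ∑ j, ∫ ξ, δ ξ i j ^ 2 ∂(G.inputLaw n) :=
        Finset.sum_nonneg fun _ _ => Finset.sum_nonneg fun _ _ => integral_nonneg fun _ =>
          sq_nonneg _
      have e1 : (∑ i, ∑ j, ∫ ξ, δ ξ i j ^ 2 ∂(G.inputLaw n)) / (2 * Ψ)
          = (∑ i, ∑ j, ∫ ξ, δ ξ i j ^ 2 ∂(G.inputLaw n)) * (1 / Ψ) / 2 := by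
        ring
      have e2 : (n:ℝ)⁻¹ ^ 2 * √n = κ := by
        rw [hκ, eq_div_iff (by positivity)]
        have e3 : (n:ℝ)⁻¹ ^ 2 * √n * (n * √n) = (n:ℝ)⁻¹ ^ 2 * n * √n ^ 2 := by ring
        rw [e3, hss]
        field_simp
      rw [e1]
      calc _ ≤ N * (N * ((n:ℝ)⁻¹ ^ 2 * (2 * C + 8 * R ^ 2) * (1 + q ^ 2))) * √n / 2 := by
            gcongr
        _ = N * (N * (((n:ℝ)⁻¹ ^ 2 * √n) * (C + 4 * R ^ 2) * (1 + q ^ 2))) := by ring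
        _ = _ := by rw [e2]
    have e4 : ∀ K : ℝ, K / (n * √n) = K * κ := fun K => by rw [hκ]; ring
    rw [e4, div_eq_inv_mul _ (n:ℝ)]
    have hqq : 1 + q ≤ 2 * (1 + q ^ 2) := by nlinarith [sq_nonneg (q - 1)]
    have b1 : N * (N * (κ * (C' * (1 + q) + R)))
        ≤ N * (N * (2 * C' + R)) * κ * (1 + q ^ 2) := by
      have b2 : C' * (1 + q) + R ≤ (2 * C' + R) * (1 + q ^ 2) := by
        nlinarith [mul_le_mul_of_nonneg_left hqq hC', mul_nonneg hR (sq_nonneg q)]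
      calc _ ≤ N * (N * (κ * ((2 * C' + R) * (1 + q ^ 2)))) := by gcongr
        _ = _ := by ring
    have b3 : 0 ≤ N * (N * L) * κ * (1 + q ^ 2) := by positivity
    have b4 : 0 ≤ (n:ℝ)⁻¹ * (N * (N * (2 * C' + R)) + N * (N * (C + 4 * R ^ 2))) * Ψ := by
      positivity
    linarith only [hlin, hquad, b1, b3, b4]

end GANModel

end OneStep

/-! ### Iteration over the training steps. -/

section Recursion

/-- The exponential dominates `(1 + κ) ^ k`, and every added `c` is charged the full exponential
factor, which costs only a constant when `κ * k` is bounded. -/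
theorem ennreal_discrete_gronwall {u : ℕ → ENNReal} {κ c a : ℝ} (hκ : 0 ≤ κ) (hc : 0 ≤ c)
    (ha : 0 ≤ a) (h0 : u 0 ≤ ENNReal.ofReal a) {m : ℕ}
    (h : ∀ k < m, u (k + 1) ≤ ENNReal.ofReal (1 + κ) * u k + ENNReal.ofReal c) :
    ∀ k ≤ m, u k ≤ ENNReal.ofReal (Real.exp (κ * k) * (a + k * c)) := by
  intro k
  induction k with
  | zero => intro _; simpa using h0
  | succ k ih =>
    intro hk
    refine (h k (by omega)).trans ?_
    calc ENNReal.ofReal (1 + κ) * u k + ENNReal.ofReal c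
        ≤ ENNReal.ofReal (1 + κ) * ENNReal.ofReal (Real.exp (κ * k) * (a + k * c))
          + ENNReal.ofReal c := by gcongr; exact ih (by omega)
      _ = ENNReal.ofReal ((1 + κ) * (Real.exp (κ * k) * (a + k * c)) + c) := by
          rw [← ENNReal.ofReal_mul (by positivity), ← ENNReal.ofReal_add (by positivity) hc]
      _ ≤ _ := by
          refine ENNReal.ofReal_le_ofReal ?_
          have e : Real.exp (κ * (k + 1 : ℕ)) = Real.exp κ * Real.exp (κ * k) := by
            rw [← Real.exp_add]; push_cast; ring_nf
          have h1 : 1 + κ ≤ Real.exp κ := by linarith [Real.add_one_le_exp κ]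
          have h2 : 1 ≤ Real.exp (κ * (k + 1 : ℕ)) := Real.one_le_exp (by positivity)
          have h3 := mul_le_mul_of_nonneg_right h1
            (by positivity : 0 ≤ Real.exp (κ * k) * (a + k * c))
          have h4 := mul_le_mul_of_nonneg_right h2 hc
          rw [← mul_assoc (Real.exp κ), ← e] at h3
          push_cast at *
          linarith

variable {d : ℕ} {G : GANModel d} {B : ℝ}

namespace GANModel

/-- The squared trace multiplies the error added in each step, so its mean has to stay bounded up to
time `T`. -/
theorem exists_energy_bound (hG : G.Regular B) {T a : ℝ} (ha : 0 ≤ a) :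
    ∃ C : ℝ, 0 ≤ C ∧ ∀ n : ℕ, 1 ≤ n → ∀ (Ω : Type*) [MeasurableSpace Ω] (Pr : Measure Ω)
      [IsProbabilityMeasure Pr] (X : TrainingData n d Ω), X.IsValid G Pr →
      ∫⁻ ω, ENNReal.ofReal (1 + (overlap (G.micro X 0 ω)).trace ^ 2) ∂Pr ≤ ENNReal.ofReal a →
      ∀ k : ℕ, (k : ℝ) ≤ n * T →
        ∫⁻ ω, ENNReal.ofReal (1 + (overlap (G.micro X k ω)).trace ^ 2) ∂Pr
          ≤ ENNReal.ofReal C := by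
  obtain ⟨K, hK, hstep⟩ := exists_trace_step_bound hG
  refine ⟨Real.exp (K * T) * a, by positivity, fun n hn Ω _ Pr _ X hX h0 k hk => ?_⟩
  have hn0 : (0:ℝ) < n := by exact_mod_cast hn
  have h := ennreal_discrete_gronwall (m := k)
    (u := fun k => ∫⁻ ω, ENNReal.ofReal (1 + (overlap (G.micro X k ω)).trace ^ 2) ∂Pr)
    (κ := K / n) (c := 0) (by positivity) le_rfl ha h0 ?_ k le_rfl
  · refine h.trans (ENNReal.ofReal_le_ofReal ?_)
    rw [mul_zero, add_zero]
    refine mul_le_mul_of_nonneg_right (Real.exp_le_exp.2 ?_) ha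
    rw [div_mul_eq_mul_div, div_le_iff₀ hn0, mul_assoc]
    exact mul_le_mul_of_nonneg_left (by linarith) hK
  · intro j _
    rw [ENNReal.ofReal_zero, add_zero]
    refine (hX.lintegral_macro_succ_le hG j (ψ := fun M => 1 + M.trace ^ 2)
      (R := fun M => (1 + K / n) * (1 + M.trace ^ 2))
      ((Macro.measurable_trace.pow_const 2).const_add 1) (fun M => by positivity)
      (hstep n hn)).trans (le_of_eq ?_)
    simp only [ENNReal.ofReal_mul (show 0 ≤ 1 + K / n by positivity)]
    exact lintegral_const_mul _ (((Macro.measurable_trace.comp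
      (hX.measurable_macro hG j)).pow_const 2).const_add 1).ennreal_ofReal

/-- The macroscopic state follows a solution of the limiting equation, in the mean. -/
theorem exists_error_bound (hG : G.Regular B) {T a b : ℝ} (hT : 0 < T) (ha : 0 ≤ a) (hb : 0 ≤ b)
    {M : ℝ → Macro d}
    (hM : ∀ t ∈ Set.Icc 0 T, HasDerivWithinAt M (G.macroDrift (M t)) (Set.Icc 0 T) t) :
    ∃ C : ℝ, 0 ≤ C ∧ ∀ n : ℕ, 1 ≤ n → ∀ (Ω : Type*) [MeasurableSpace Ω] (Pr : Measure Ω)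
      [IsProbabilityMeasure Pr] (X : TrainingData n d Ω), X.IsValid G Pr →
      ∫⁻ ω, ENNReal.ofReal (1 + (overlap (G.micro X 0 ω)).trace ^ 2) ∂Pr ≤ ENNReal.ofReal a →
      ∫⁻ ω, ENNReal.ofReal (smoothNorm (n:ℝ)⁻¹ (overlap (G.micro X 0 ω) - M 0)) ∂Pr
        ≤ ENNReal.ofReal (b / √n) →
      ∀ k : ℕ, (k : ℝ) ≤ n * T →
        ∫⁻ ω, ENNReal.ofReal (smoothNorm (n:ℝ)⁻¹ (overlap (G.micro X k ω) - M (k / n))) ∂Pr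
          ≤ ENNReal.ofReal (C / √n) := by
  obtain ⟨R, hR, hbdd, heuler⟩ := hG.semiLip_macroDrift.euler_error hM
  obtain ⟨K, hK, hstep⟩ := exists_smoothNorm_step_bound hG hR
  obtain ⟨C, hC, hen⟩ := exists_energy_bound hG (T := T) ha
  refine ⟨Real.exp (K * T) * (b + T * (K * C)), by positivity,
    fun n hn Ω _ Pr _ X hX h0 h0' k hk => ?_⟩
  have hn0 : (0:ℝ) < n := by exact_mod_cast hn
  have hs0 : 0 < √(n:ℝ) := Real.sqrt_pos.2 hn0
  have h := ennreal_discrete_gronwall (m := k) (u := fun k =>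
      ∫⁻ ω, ENNReal.ofReal (smoothNorm (n:ℝ)⁻¹ (overlap (G.micro X k ω) - M (k / n))) ∂Pr)
    (κ := K / n) (c := K / (n * √n) * C) (a := b / √n) (by positivity) (by positivity)
    (by positivity) (by simpa using h0') ?_ k le_rfl
  · refine h.trans (ENNReal.ofReal_le_ofReal ?_)
    have h1 : Real.exp (K / n * k) ≤ Real.exp (K * T) := by
      refine Real.exp_le_exp.2 ?_
      rw [div_mul_eq_mul_div, div_le_iff₀ hn0, mul_assoc]
      exact mul_le_mul_of_nonneg_left (by linarith) hK
    -- At most `n T` steps contribute `K C / (n √n)` each.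
    have h2 : b / √n + k * (K / (n * √n) * C) ≤ (b + T * (K * C)) / √n := by
      have e : k * (K / (n * √n) * C) = k / n * (K * C) / √n := by field_simp
      rw [e, ← add_div]
      refine div_le_div_of_nonneg_right ?_ hs0.le
      have : (k:ℝ) / n ≤ T := by rw [div_le_iff₀ hn0]; linarith
      linarith [mul_le_mul_of_nonneg_right this (by positivity : 0 ≤ K * C)]
    rw [mul_div_assoc]
    exact mul_le_mul h1 h2 (by positivity) (by positivity)
  · intro j hj
    have hj' : ((j + 1 : ℕ) : ℝ) ≤ n * T := by
      have : ((j + 1 : ℕ) : ℝ) ≤ k := by exact_mod_cast hj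
      linarith
    have hjs : (j : ℝ) ≤ n * T := by push_cast at hj'; linarith
    have ht0 : 0 ≤ (j : ℝ) / n := by positivity
    have ht1 : ((j + 1 : ℕ) : ℝ) / n ≤ T := by rw [div_le_iff₀ hn0]; linarith
    have hdt : ((j + 1 : ℕ) : ℝ) / n - (j : ℝ) / n = (n:ℝ)⁻¹ := by push_cast; field_simp; ring
    have hle : (j : ℝ) / n ≤ ((j + 1 : ℕ) : ℝ) / n := by
      have : 0 < (n:ℝ)⁻¹ := by positivity
      linarith
    have hb1 := hbdd _ ⟨ht0, hle.trans ht1⟩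
    have he := heuler _ _ ht0 hle ht1
    rw [hdt] at he
    have hm := hX.measurable_macro hG j
    have m1 : Measurable fun ω =>
        ENNReal.ofReal (smoothNorm (n:ℝ)⁻¹ (overlap (G.micro X j ω) - M (j / n))) :=
      ((measurable_smoothNorm _).comp (hm.sub_const _)).ennreal_ofReal
    have m2 : Measurable fun ω => ENNReal.ofReal (1 + (overlap (G.micro X j ω)).trace ^ 2) :=
      (((Macro.measurable_trace.comp hm).pow_const 2).const_add 1).ennreal_ofReal
    refine (hX.lintegral_macro_succ_le hG j
      (ψ := fun Y => smoothNorm (n:ℝ)⁻¹ (Y - M ((j + 1 : ℕ) / n)))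
      (R := fun Y => (1 + K / n) * smoothNorm (n:ℝ)⁻¹ (Y - M (j / n))
        + K / (n * √n) * (1 + Y.trace ^ 2))
      ((measurable_smoothNorm _).comp (measurable_id.sub_const _))
      (fun Y => smoothNorm_nonneg _ _)
      (hstep n hn _ _ hb1.1 hb1.2 he)).trans ?_
    calc _ ≤ ∫⁻ ω, (ENNReal.ofReal (1 + K / n)
            * ENNReal.ofReal (smoothNorm (n:ℝ)⁻¹ (overlap (G.micro X j ω) - M (j / n)))
          + ENNReal.ofReal (K / (n * √n))
            * ENNReal.ofReal (1 + (overlap (G.micro X j ω)).trace ^ 2)) ∂Pr := by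
          refine lintegral_mono fun ω => ?_
          rw [← ENNReal.ofReal_mul (by positivity), ← ENNReal.ofReal_mul (by positivity)]
          exact ENNReal.ofReal_add_le
      _ = ENNReal.ofReal (1 + K / n) * ∫⁻ ω, ENNReal.ofReal
            (smoothNorm (n:ℝ)⁻¹ (overlap (G.micro X j ω) - M (j / n))) ∂Pr
          + ENNReal.ofReal (K / (n * √n)) * ∫⁻ ω, ENNReal.ofReal
            (1 + (overlap (G.micro X j ω)).trace ^ 2) ∂Pr := by
          rw [lintegral_add_left (m1.const_mul _), lintegral_const_mul _ m1,
            lintegral_const_mul _ m2]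
      _ ≤ _ := by
          rw [ENNReal.ofReal_mul (by positivity : 0 ≤ K / (n * √n))]
          gcongr
          exact hen n hn Ω Pr X hX h0 j hjs

end GANModel

end Recursion

/-! ### Norms and initial data. -/

section Bounds

variable {d n : ℕ} {Ω : Type*} [MeasurableSpace Ω] {Pr : Measure Ω}

theorem MeanLE.lintegral_le {Y : Ω → ℝ} {b : ℝ} (h : MeanLE Pr Y b) (h0 : ∀ ω, 0 ≤ Y ω) :
    ∫⁻ ω, ENNReal.ofReal (Y ω) ∂Pr ≤ ENNReal.ofReal b := by
  rw [← ofReal_integral_eq_lintegral_ofReal h.1 (Filter.Eventually.of_forall h0)]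
  exact ENNReal.ofReal_le_ofReal h.2

theorem MeanLE.of_lintegral_le {Y Z : Ω → ℝ} {b : ℝ} (hb : 0 ≤ b) (hY : Measurable Y)
    (h0 : ∀ ω, 0 ≤ Y ω) (hle : ∀ ω, Y ω ≤ Z ω)
    (h : ∫⁻ ω, ENNReal.ofReal (Z ω) ∂Pr ≤ ENNReal.ofReal b) : MeanLE Pr Y b := by
  have h1 : ∫⁻ ω, ENNReal.ofReal (Y ω) ∂Pr ≤ ENNReal.ofReal b :=
    (lintegral_mono fun ω => ENNReal.ofReal_le_ofReal (hle ω)).trans h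
  constructor
  · refine ⟨hY.aestronglyMeasurable, ?_⟩
    rw [hasFiniteIntegral_iff_ofReal (Filter.Eventually.of_forall h0)]
    exact h1.trans_lt ENNReal.ofReal_lt_top
  · rw [integral_eq_lintegral_of_nonneg_ae (Filter.Eventually.of_forall h0)
      hY.aestronglyMeasurable]
    exact ENNReal.toReal_le_of_le_ofReal hb h1

theorem frobenius_norm_eq (A : Matrix (MacroIdx d) (MacroIdx d) ℝ) :
    ‖A‖ = √(∑ i, ∑ j, A i j ^ 2) := by
  rw [frobenius_norm_def, Real.sqrt_eq_rpow]
  simp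

theorem frobenius_norm_le_smoothNorm {ε : ℝ} (hε : 0 ≤ ε)
    (A : Matrix (MacroIdx d) (MacroIdx d) ℝ) : ‖A‖ ≤ smoothNorm ε fun i j => A i j := by
  rw [frobenius_norm_eq]
  exact Real.sqrt_le_sqrt (by linarith)

theorem smoothNorm_le_frobenius_norm {ε : ℝ} (hε : 0 ≤ ε)
    (A : Matrix (MacroIdx d) (MacroIdx d) ℝ) : smoothNorm ε (fun i j => A i j) ≤ ‖A‖ + √ε := by
  rw [frobenius_norm_eq]
  refine Real.sqrt_le_iff.2 ⟨by positivity, ?_⟩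
  have h := sum_sq_nonneg fun i j => A i j
  nlinarith [Real.sq_sqrt h, Real.sq_sqrt hε,
    mul_nonneg (Real.sqrt_nonneg (∑ i, ∑ j, A i j ^ 2)) (Real.sqrt_nonneg ε)]

/-- Cauchy–Schwarz over the rows and within each row. With row sums of fourth powers of mean `C /
n²`, the right-hand side has bounded mean. -/
theorem sq_energy_le (X : Matrix (Fin n) (MacroIdx d) ℝ) :
    energy X ^ 2 ≤ n * Fintype.card (MacroIdx d) * ∑ k, ∑ i, X k i ^ 4 := by
  have h1 := sq_sum_le_card_mul_sum_sq (s := Finset.univ) (f := fun k => ∑ i, X k i ^ 2)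
  rw [Finset.card_univ, Fintype.card_fin] at h1
  refine h1.trans ?_
  rw [mul_assoc]
  refine mul_le_mul_of_nonneg_left ?_ (Nat.cast_nonneg _)
  rw [Finset.mul_sum]
  refine Finset.sum_le_sum fun k _ => ?_
  have h2 := sq_sum_le_card_mul_sum_sq (s := Finset.univ) (f := fun i => X k i ^ 2)
  rw [Finset.card_univ] at h2
  refine h2.trans (le_of_eq ?_)
  congr 1
  exact Finset.sum_congr rfl fun _ _ => by ring

/-- The fourth power of the entry of `w0` is counted `d` times on the right, hence at least once. -/
theorem sum_pow_four_le_fourthPowers (hd : 0 < d) (G : GANModel d) (X : TrainingData n d Ω)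
    (i : Fin n) (ω : Ω) : ∑ l, G.micro X 0 ω i l ^ 4 ≤ X.fourthPowers i ω := by
  have h1 : (1:ℝ) ≤ d := by exact_mod_cast hd
  have h2 : 0 ≤ X.w0 ω i ^ 4 := by positivity
  simp only [GANModel.micro, GANModel.params, TrainingData.fourthPowers, Fintype.sum_sum_type,
    fromCols_apply_inl, fromCols_apply_inr, replicateCol_apply, Finset.univ_unique,
    Finset.sum_add_distrib, Finset.sum_const, Finset.card_univ,
    Fintype.card_fin, nsmul_eq_mul, Finset.card_singleton, Nat.cast_one, one_mul]
  nlinarith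

theorem lintegral_initial_energy_le [IsProbabilityMeasure Pr] (hd : 0 < d) (hn : 1 ≤ n)
    (G : GANModel d) (X : TrainingData n d Ω) {C : ℝ}
    (h : ∀ i, MeanLE Pr (X.fourthPowers i) (C / (n : ℝ) ^ 2)) :
    ∫⁻ ω, ENNReal.ofReal (1 + (overlap (G.micro X 0 ω)).trace ^ 2) ∂Pr
      ≤ ENNReal.ofReal (1 + Fintype.card (MacroIdx d) * C) := by
  have hn0 : (0:ℝ) < n := by exact_mod_cast hn
  have m := (hasMean_const (μ := Pr) 1).add ((HasMean.sum fun i (_ : i ∈ Finset.univ) =>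
    (h i).1.hasMean).const_mul (n * Fintype.card (MacroIdx d)))
  have hle : ∀ ω, 1 + (overlap (G.micro X 0 ω)).trace ^ 2
      ≤ 1 + n * Fintype.card (MacroIdx d) * ∑ i, X.fourthPowers i ω := by
    intro ω
    rw [← energy_eq_trace]
    have h1 := sq_energy_le (G.micro X 0 ω)
    have h2 := Finset.sum_le_sum fun i (_ : i ∈ Finset.univ) =>
      sum_pow_four_le_fourthPowers hd G X i ω
    have h3 := mul_le_mul_of_nonneg_left h2
      (by positivity : (0:ℝ) ≤ n * Fintype.card (MacroIdx d))
    linarith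
  refine (lintegral_mono fun ω => ENNReal.ofReal_le_ofReal (hle ω)).trans
    (MeanLE.lintegral_le ⟨m.1, m.2.trans_le ?_⟩ fun ω => le_trans (by positivity) (hle ω))
  have h1 : ∑ i, ∫ ω, X.fourthPowers i ω ∂Pr ≤ n * (C / (n:ℝ) ^ 2) :=
    (Finset.sum_le_card_nsmul _ _ _ fun i _ => (h i).2).trans (by simp)
  have h2 := mul_le_mul_of_nonneg_left h1
    (by positivity : (0:ℝ) ≤ n * Fintype.card (MacroIdx d))
  have e : (n:ℝ) * Fintype.card (MacroIdx d) * (n * (C / (n:ℝ) ^ 2))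
      = Fintype.card (MacroIdx d) * C := by field_simp
  rw [e] at h2
  linarith

end Bounds

/-! ### Admissibility of the limit path and the theorem. -/

section Limit

variable {d n : ℕ} {G : GANModel d} {B : ℝ}

theorem isGood_overlap (G : GANModel d) {Ω : Type*} (X : TrainingData n d Ω) (k : ℕ) {ω : Ω}
    (h : (X.U ω)ᵀ * X.U ω = 1) : (overlap (G.micro X k ω)).IsGood where
  symm := overlap_symm _
  one i j := by
    rw [← h]
    simp [overlap, GANModel.micro, mul_apply]
  nonneg := Finset.sum_nonneg fun _ _ => mul_self_nonneg _

theorem GANModel.exists_regular (G : GANModel d) (hηT : 0 ≤ G.etaT) (hηG : 0 ≤ G.etaG)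
    (pc : IsProbabilityMeasure G.Pc) (pct : IsProbabilityMeasure G.Pct)
    (hc : HasAllMoments G.Pc) (hct : HasAllMoments G.Pct)
    (hF : BoundedDerivs 4 (G.F ∘ G.D)) (hFt : BoundedDerivs 4 (G.Ft ∘ G.D))
    (hH : BoundedDerivs 1 G.H) (hH' : LocallyLipschitz (deriv G.H)) : ∃ B, G.Regular B := by
  obtain ⟨dF, B1, f1, f1'⟩ := hF.c2Bdd
  obtain ⟨dFt, B2, f2, f2'⟩ := hFt.c2Bdd
  obtain ⟨B3, h3⟩ := hH.2 1 (by simp)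
  have dH := hH.1 0 (by norm_num)
  rw [iteratedDeriv_zero] at dH
  rw [iteratedDeriv_one] at h3
  have p3 : 0 ≤ B3 := (abs_nonneg _).trans (h3 0)
  have p1 := f1.nonneg
  have p2 := f2.nonneg
  exact ⟨B1 + B2 + B3, pc, pct, hc, hct, hηT, hηG, f1.mono (by linarith), f1'.mono (by linarith),
    f2.mono (by linarith), f2'.mono (by linarith), dF, dFt, dH,
    fun x => (h3 x).trans (by linarith), hH'⟩

/-- A path to which the macroscopic states converge consists of admissible states. -/
theorem isGood_of_approx {Ω : ℕ → Type*} [∀ n, MeasurableSpace (Ω n)] (Pr : ∀ n, Measure (Ω n))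
    [∀ n, IsProbabilityMeasure (Pr n)] (X : ∀ n, TrainingData n d (Ω n))
    (hX : ∀ n, d ≤ n → (X n).IsValid G (Pr n)) {T C : ℝ} {M : ℝ → Macro d}
    (hM : ContinuousOn M (Set.Icc 0 T))
    (h : ∀ n, d ≤ n → ∀ k : ℕ, (k : ℝ) ≤ n * T → MeanLE (Pr n)
      (fun ω => ‖G.macroState (X n) k ω - Matrix.of (M (k / n))‖) (C / √(n : ℝ))) :
    ∀ t ∈ Set.Icc 0 T, (M t).IsGood := by
  intro t ht
  have key : ∀ n : ℕ, d ≤ n → ∃ Y : Macro d, Y.IsGood ∧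
      ‖Y - M ((⌊n * t⌋₊ : ℕ) / n)‖ ≤ C / √(n:ℝ) := by
    intro n hn
    have hk : ((⌊n * t⌋₊ : ℕ) : ℝ) ≤ n * T :=
      (Nat.floor_le (mul_nonneg (Nat.cast_nonneg _) ht.1)).trans
        (mul_le_mul_of_nonneg_left ht.2 (Nat.cast_nonneg _))
    obtain ⟨hi, hle⟩ := h n hn _ hk
    -- Off the null set where `Uᵀ U = 1` fails, some outcome has an error at most the mean. It
    -- yields a true Gram matrix near `M`.
    obtain ⟨ω, hω, hω'⟩ := exists_notMem_null_le_integral hi (hX n hn).orthonormal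
    refine ⟨overlap (G.micro (X n) ⌊n * t⌋₊ ω), isGood_overlap G _ _ (not_not.1 hω), ?_⟩
    refine le_trans ?_ (hω'.trans hle)
    refine (pi_norm_le_iff_of_nonneg (norm_nonneg _)).2 fun i =>
      (pi_norm_le_iff_of_nonneg (norm_nonneg _)).2 fun j => ?_
    rw [frobenius_norm_eq]
    have e : (overlap (G.micro (X n) ⌊n * t⌋₊ ω) - M ((⌊n * t⌋₊ : ℕ) / n)) i j
        = (G.macroState (X n) ⌊n * t⌋₊ ω - Matrix.of (M ((⌊n * t⌋₊ : ℕ) / n))) i j := rfl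
    rw [e, Real.norm_eq_abs]
    have := abs_le_smoothNorm (le_refl 0) (fun i j =>
      (G.macroState (X n) ⌊n * t⌋₊ ω - Matrix.of (M ((⌊n * t⌋₊ : ℕ) / n))) i j) i j
    rwa [smoothNorm, add_zero] at this
  choose! Y hY hYle using key
  have ht' : Filter.Tendsto (fun n : ℕ => ((⌊n * t⌋₊ : ℕ) : ℝ) / n) Filter.atTop
      (nhdsWithin t (Set.Icc 0 T)) := by
    refine tendsto_nhdsWithin_iff.2 ⟨?_, ?_⟩
    · have := (tendsto_nat_floor_mul_div_atTop ht.1).comp tendsto_natCast_atTop_atTop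
      refine this.congr fun n => ?_
      simp [mul_comm]
    · filter_upwards [Filter.eventually_gt_atTop 0] with n hn
      have hn0 : (0:ℝ) < n := by exact_mod_cast hn
      refine ⟨by positivity, ?_⟩
      rw [div_le_iff₀ hn0, mul_comm T]
      exact (Nat.floor_le (mul_nonneg hn0.le ht.1)).trans (mul_le_mul_of_nonneg_left ht.2 hn0.le)
  have h1 : Filter.Tendsto (fun n : ℕ => M ((⌊n * t⌋₊ : ℕ) / n)) Filter.atTop (nhds (M t)) :=
    (hM t ht).tendsto.comp ht'
  have h2 : Filter.Tendsto (fun n : ℕ => C / √(n:ℝ)) Filter.atTop (nhds 0) :=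
    Filter.Tendsto.const_div_atTop (Real.tendsto_sqrt_atTop.comp tendsto_natCast_atTop_atTop) C
  have h3 : Filter.Tendsto (fun n : ℕ => Y n - M ((⌊n * t⌋₊ : ℕ) / n)) Filter.atTop (nhds 0) :=
    squeeze_zero_norm' ((Filter.eventually_ge_atTop d).mono fun n hn => hYle n hn) h2
  have h4 : Filter.Tendsto Y Filter.atTop (nhds (M t)) := by
    have := h3.add h1
    simpa using this
  exact Macro.isClosed_isGood.mem_of_tendsto h4
    ((Filter.eventually_ge_atTop d).mono fun n hn => hY n hn)

end Limit

theorem theorem1 {d : ℕ} (hd : 0 < d) (G : GANModel d)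
    (hηT : 0 ≤ G.etaT) (hηG : 0 ≤ G.etaG)
    {Ω : ℕ → Type*} [∀ n, MeasurableSpace (Ω n)] (Pr : ∀ n, Measure (Ω n))
    [∀ n, IsProbabilityMeasure (Pr n)] (X : ∀ n, TrainingData n d (Ω n))
    (hX : ∀ n, d ≤ n → (X n).IsValid G (Pr n))
    (hc : HasAllMoments G.Pc) (hct : HasAllMoments G.Pct)
    (hF : BoundedDerivs 4 (G.F ∘ G.D)) (hFt : BoundedDerivs 4 (G.Ft ∘ G.D))
    (hH : BoundedDerivs 1 G.H) (hH' : LocallyLipschitz (deriv G.H))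
    (hinit : ∃ C : ℝ, ∀ n, d ≤ n → ∀ i : Fin n,
      MeanLE (Pr n) ((X n).fourthPowers i) (C / (n : ℝ) ^ 2))
    (M₀ : Matrix (Fin d ⊕ Fin d ⊕ Unit) (Fin d ⊕ Fin d ⊕ Unit) ℝ)
    (hM₀ : ∃ C : ℝ, ∀ n, d ≤ n →
      MeanLE (Pr n) (fun ω => ‖G.macroState (X n) 0 ω - M₀‖) (C / √(n : ℝ)))
    (T : ℝ) (hT : 0 < T) :
    ∃ m : ℝ → MacroState d,
      (G.IsODESolution T m ∧ (m 0).toMatrix = M₀) ∧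
      (∀ m' : ℝ → MacroState d, G.IsODESolution T m' → (m' 0).toMatrix = M₀ →
        ∀ t ∈ Set.Icc 0 T, m' t = m t) ∧
      ∃ C : ℝ, ∀ n, d ≤ n → ∀ k : ℕ, (k : ℝ) ≤ n * T →
        MeanLE (Pr n) (fun ω => ‖G.macroState (X n) k ω - (m ((k : ℝ) / n)).toMatrix‖)
          (C / √(n : ℝ)) := by
  -- Dimension `n = d` already shows that the latent laws are probability measures, being laws of
  -- random vectors.
  have hXd := hX d le_rfl
  obtain ⟨B, hG⟩ := G.exists_regular hηT hηG
    (hXd.law_c 0 ▸ Measure.isProbabilityMeasure_map (hXd.measurable_c 0).aemeasurable)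
    (hXd.law_ct 0 ▸ Measure.isProbabilityMeasure_map (hXd.measurable_ct 0).aemeasurable)
    hc hct hF hFt hH hH'
  obtain ⟨M, hM0, hM⟩ := hG.semiLip_macroDrift.exists_solution (fun i j => M₀ i j) hT
  obtain ⟨Ci, hCi⟩ := hinit
  obtain ⟨Cm, hCm⟩ := hM₀
  set N : ℝ := ((Fintype.card (MacroIdx d) : ℕ) : ℝ) with hN
  -- The absolute values guard against negative given constants. The `+ 1` pays for `√(1/n)`, the
  -- gap between the smoothed and the Frobenius norm.
  obtain ⟨C, hC, herr⟩ := GANModel.exists_error_bound hG hT (a := 1 + N * |Ci|) (b := |Cm| + 1)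
    (by positivity) (by positivity) hM
  have hmean : ∀ n, d ≤ n → ∀ k : ℕ, (k : ℝ) ≤ n * T → MeanLE (Pr n)
      (fun ω => ‖G.macroState (X n) k ω - Matrix.of (M (k / n))‖) (C / √(n : ℝ)) := by
    intro n hn k hk
    have hn1 : 1 ≤ n := by omega
    have hn0 : (0:ℝ) < n := by exact_mod_cast hn1
    have hs0 : 0 < √(n:ℝ) := Real.sqrt_pos.2 hn0
    have hε : 0 ≤ (n:ℝ)⁻¹ := by positivity
    refine MeanLE.of_lintegral_le (by positivity) ?_ (fun ω => norm_nonneg _)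
      (fun ω => frobenius_norm_le_smoothNorm hε _) (herr n hn1 (Ω n) (Pr n) (X n) (hX n hn)
        (lintegral_initial_energy_le hd hn1 G (X n) fun i => ?_) ?_ k hk)
    · simp only [frobenius_norm_eq]
      refine Measurable.sqrt (Finset.measurable_fun_sum _ fun i _ =>
        Finset.measurable_fun_sum _ fun j _ => Measurable.pow_const ?_ 2)
      exact (GANModel.measurable_overlap ((hX n hn).measurable_micro hG k) i j).sub_const _
    · have h := hCi n hn i
      exact ⟨h.1, h.2.trans (div_le_div_of_nonneg_right (le_abs_self _) (by positivity))⟩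
    · have h := hCm n hn
      rw [hM0]
      have hle : ∀ ω, smoothNorm (n:ℝ)⁻¹ (overlap (G.micro (X n) 0 ω) - fun i j => M₀ i j)
          ≤ ‖G.macroState (X n) 0 ω - M₀‖ + √(n:ℝ)⁻¹ := fun ω =>
        smoothNorm_le_frobenius_norm hε (G.macroState (X n) 0 ω - M₀)
      have m := h.1.hasMean.add (hasMean_const (μ := Pr n) (√(n:ℝ)⁻¹))
      refine (lintegral_mono fun ω => ENNReal.ofReal_le_ofReal (hle ω)).trans
        (MeanLE.lintegral_le ⟨m.1, m.2.trans_le ?_⟩ fun ω => by positivity)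
      rw [Real.sqrt_inv, add_div, one_div]
      have := h.2.trans (div_le_div_of_nonneg_right (le_abs_self Cm) hs0.le)
      linarith
  -- Convergence to the matrix solution comes first; it shows that this solution is symmetric with
  -- identity block and `z ≥ 0`, so that its blocks solve the original system.
  have hgood := isGood_of_approx Pr X hX
    (fun t ht => (hM t ht).continuousWithinAt) hmean
  have hmat : ∀ t ∈ Set.Icc 0 T, (M t).state.toMatrix = Matrix.of (M t) := fun t ht => by
    ext i j
    exact (hgood t ht).toMatrix_state i j
  have h0T : (0:ℝ) ∈ Set.Icc 0 T := ⟨le_rfl, hT.le⟩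
  have hinit' : (M 0).state.toMatrix = M₀ := by
    rw [hmat 0 h0T, hM0]; rfl
  refine ⟨fun t => (M t).state, ⟨isODESolution_of_macroDrift hM hgood, hinit'⟩, ?_, C, ?_⟩
  · intro m' hm' hm0 t ht
    -- Equal block matrices have equal blocks, so the competing `S` starts symmetric and hence
    -- remains so.
    have hst : m' 0 = (M 0).state := by
      have h1 := MacroState.state_toMatrix (m' 0)
      rw [hm0, ← hinit', MacroState.state_toMatrix] at h1
      exact h1.symm
    have hsymm : ∀ i j, (m' 0).S i j = (m' 0).S j i := fun i j => by
      rw [hst]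
      exact (hgood 0 h0T).symm _ _
    have h1 := macroDrift_of_isODESolution hG hm' hsymm
    have h2 := hG.semiLip_macroDrift.unique_solution (by rw [hm0, hM0]) h1 hM t ht
    change m' t = (M t).state
    rw [← h2, MacroState.state_toMatrix]
  · intro n hn k hk
    have hn0 : (0:ℝ) < n := by exact_mod_cast (by omega : 0 < n)
    rw [hmat (k / n) ⟨by positivity, by rw [div_le_iff₀ hn0]; linarith⟩]
    exact hmean n hn k hk
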